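/- **Theorem 4.1.** Let $V\subseteq H\subseteq V^\star$ be a Gelfand triple with a finite dimensional real Hilbert space $V$ and let $A\colon V\to V^\star$ be symmetric with $\langle Av,v\rangle\ge\alpha\|v\|_V^2$ and $|\langle Av,w\rangle|\le\beta\|v\|_V\|w\|_V$, where $0<\alpha\le\beta$. (The case of interest is a finite dimensional $V=V_h\subset H^1_0(\Omega)$ with the $L^2(\Omega)$-inner product on $H$ and $A=A_h=-\Delta$.) Let $t_{\rm end}>0$, let $\mathcal T_0$ be the uniform mesh of $[0,t_{\rm end}]$ with $n_0\ge1$ time steps, let $f\in\mathcal S^2(\mathcal T_0;V^\star)$ (continuous and quadratic on each time step of $\mathcal T_0$), and let $u_{0,h}\in V$. Let $u_h\in H^1(0,t_{\rm end};V)$ solve $(\partial_t+A)u_h=f$ in $V^\star$ almost everywhere on $[0,t_{\rm end}]$, $u_h(0)=u_{0,h}$. Let $V_R\subseteq V$ be any linear subspace (in particular, a reduced basis space of dimension at most $R$ that is optimal in whatever sense), with the norm of $V$, and let $P_R\colon V\to V_R$ be the $V$-orthogonal projection. Let $u_R\in H^1(0,t_{\rm end};V_R)$ solve the projected problem $(\partial_t+A)u_R=f$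 in $V_R^\star$ almost everywhere, $u_R(0)=P_Ru_{0,h}$. For $w\in H^1(0,t_{\rm end};V)$ put $$\|w\|_{\mathcal X_R}^2=\|w\|_{L^2(0,t_{\rm end};V)}^2+\|\partial_tw\|_{L^2(0,t_{\rm end};V_R^\star)}^2,$$ where $\partial_tw$ acts on $V_R$ through the inner product of $H$. *Scheme and estimator.* For a mesh $\mathcal T$ of closed intervals $T=[t_T,t_{T+1}]$, the approximation $u_{\mathcal T}\in\mathcal S^2(\mathcal T;V_R)$ satisfies $u_{\mathcal T}(0)=P_Ru_{0,h}$ and, for all $T\in\mathcal T$ and $v\in V_R$, $$\int_T\langle(\partial_t+A)u_{\mathcal T},v\rangle\,ds=\int_T\langle f,v\rangle\,ds,\qquad \langle(\partial_t+A)u_{\mathcal T}(t_{T+1}),v\rangle=\langle f(t_{T+1}),v\rangle,$$ with the derivative at $t_{T+1}$ taken from inside $T$. Put $\eta_{\mathcal T}(T)^2=|T|^2\|\partial_tf-\partial_t^2u_{\mathcal T}-\partial_tAu_{\mathcal T}\|_{L^2(T;V_R^\star)}^2$ and $\eta_{\mathcal T}^2=\sum_{T\in\mathcal T}\eta_{\mathcal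 T}(T)^2$. *Adaptive algorithm*, with marking parameter $\theta$ and grading parameter $G\in\mathbb N$. Starting with $\mathcal T_0$, in step $\ell$ compute $u_\ell=u_{\mathcal T_\ell}$ and $\eta_\ell=\eta_{\mathcal T_\ell}$, choose a set $\mathcal M_\ell\subseteq\mathcal T_\ell$ of minimal cardinality with $\sum_{T\in\mathcal M_\ell}\eta_{\mathcal T_\ell}(T)^2\ge\theta\eta_\ell^2$, and obtain $\mathcal T_{\ell+1}$ by calling $\mathrm{trisect}(\cdot,T)$ successively for all $T\in\mathcal M_\ell$. Here $\mathrm{trisect}(\mathcal T,T)$ does nothing if $T\notin\mathcal T$; otherwise it calls itself for all $T'\in\mathcal T$ with $\mathrm{dist}(T,T')\le G|T|$ and $|T'|\ge3|T|$, and then replaces $T$ by its three thirds. *Approximation class.* For $C_g\ge1$ and $0<g_0<1$ let $\mathbb T$ be the set of all meshes that are generated from $\mathcal T_0$ by iterated trisections of time steps and satisfy $|T_i|/|T_j|\le C_gg_0^{-|i-j|}$ for all their time steps $T_i,T_j$, numbered from left to right. For $s>0$ let $$|u_R|_s=\sup_{N\in\mathbb N}\;N^s\inf_{\mathcal T\in\mathbb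 T,\ \#\mathcal T-\#\mathcal T_0\le N}\ \min_{v\in\mathcal S^2(\mathcal T;V_R)}\|u_R-v\|_{\mathcal X_R}.$$ *Claim.* There are $\gamma\in(0,1)$, $G_0\in\mathbb N$, $\theta_0\in(0,1]$ and $C>0$ that depend only on $\alpha,\beta,C_g$ such that the following holds for all $g_0\in[\gamma,1)$, $G\ge G_0$, $0<\theta\le\theta_0$, $s>0$, $n_0\ge 1$ and $L\in\mathbb R$. There is a constant $K>0$ that depends only on $\alpha,\beta,C_g,g_0,G,\theta,s,n_0,L$ such that, for all data as above with $t_{\rm end}\|v\|_V^2\le L\|v\|_H^2$ for all $v\in V_R$ and with $|u_R|_s<\infty$, every sequence produced by the adaptive algorithm satisfies $$\|u_h-u_\ell\|_{\mathcal X_R}\le C\Big(\min\big\{\eta_\ell,\;K\,|u_R|_s\,(\#\mathcal T_\ell)^{-s}\big\}+\|u_h-P_Ru_h\|_{\mathcal X_R}\Big)\qquad\text{for all }\ell\in\mathbb N_0.$$ In particular the constants do not depend on the dimensions of $V$ and $V_R$. -/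

import Mathlib

open Set MeasureTheory

noncomputable section

namespace AdaptiveRadau

/-! ### Time meshes -/

/-- A closed time interval `[T.1, T.2]`, stored through its end points. -/
abbrev TimeStep : Type := ℝ × ℝ

/-- A time mesh is the finite set of its time steps. -/
abbrev TimeMesh : Type := Finset TimeStep

namespace TimeStep

/-- The length `|T|`. -/
def len (T : TimeStep) : ℝ := T.2 - T.1

/-- The distance of two closed intervals (as sets of reals). -/
def dist (T T' : TimeStep) : ℝ := max 0 (max (T'.1 - T.2) (T.1 - T'.2))

open scoped Classical in
/-- The three intervals of equal length into which `T` is split. -/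
def children (T : TimeStep) : Finset TimeStep :=
  {(T.1, T.1 + len T / 3), (T.1 + len T / 3, T.1 + 2 * len T / 3), (T.1 + 2 * len T / 3, T.2)}

end TimeStep

namespace TimeMesh

open scoped Classical in
/-- The uniform mesh of `[0, t]` with `n` time steps. -/
def uniform (t : ℝ) (n : ℕ) : TimeMesh :=
  (Finset.range n).image fun i : ℕ => (t * (i : ℝ) / n, t * ((i : ℝ) + 1) / n)

open scoped Classical in
/-- Replace the time step `T` of the mesh by its three children. -/
def split (𝒯 : TimeMesh) (T : TimeStep) : TimeMesh := 𝒯.erase T ∪ T.children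

/-- `GeneratedFrom 𝒯₀ 𝒯`: the mesh `𝒯` arises from `𝒯₀` by iterated trisections of time steps. -/
inductive GeneratedFrom (𝒯₀ : TimeMesh) : TimeMesh → Prop
  | refl : GeneratedFrom 𝒯₀ 𝒯₀
  | split {𝒯 : TimeMesh} {T : TimeStep} (h : GeneratedFrom 𝒯₀ 𝒯) (hT : T ∈ 𝒯) :
      GeneratedFrom 𝒯₀ (𝒯.split T)

open scoped Classical in
/-- The index `i` of the time step `T = T_i` in the mesh, counted from the left. -/
def index (𝒯 : TimeMesh) (T : TimeStep) : ℕ := (𝒯.filter fun T' => T'.1 < T.1).card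

/-- Moderate grading: `|T_i| / |T_j| ≤ C_g g₀ ^ (-|i-j|)` for all time steps of the mesh. -/
def Graded (Cg g₀ : ℝ) (𝒯 : TimeMesh) : Prop :=
  ∀ T ∈ 𝒯, ∀ T' ∈ 𝒯,
    T.len / T'.len ≤ Cg * g₀ ^ (-|(𝒯.index T : ℤ) - (𝒯.index T' : ℤ)|)

/-- The class of meshes that are moderately graded and are generated by iterated trisections
from `𝒯₀`. -/
def Admissible (Cg g₀ : ℝ) (𝒯₀ 𝒯 : TimeMesh) : Prop :=
  GeneratedFrom 𝒯₀ 𝒯 ∧ Graded Cg g₀ 𝒯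

/-- `TrisectList G 𝒯 l 𝒯'`: calling the recursive procedure `trisect(·, T)` with grading parameter
`G` successively for the time steps `T` of the list `l`, starting with the mesh `𝒯`, ends with the
mesh `𝒯'`. A call `trisect(𝒯, T)` does nothing if `T ∉ 𝒯`. Otherwise it first calls itself for all
`T' ∈ 𝒯` with `dist(T, T') ≤ G |T|` and `|T'| / |T| ≥ 3` (visited in some order), and then replaces
`T` by its three children. -/
inductive TrisectList (G : ℕ) : TimeMesh → List TimeStep → TimeMesh → Prop
  | nil (𝒯 : TimeMesh) : TrisectList G 𝒯 [] 𝒯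
  | skip {𝒯 𝒯' : TimeMesh} {T : TimeStep} {l : List TimeStep} (hT : T ∉ 𝒯)
      (h : TrisectList G 𝒯 l 𝒯') : TrisectList G 𝒯 (T :: l) 𝒯'
  | refine {𝒯 𝒯₁ 𝒯' : TimeMesh} {T : TimeStep} {l l₁ : List TimeStep} (hT : T ∈ 𝒯)
      (hnodup : l₁.Nodup)
      (hl₁ : ∀ T', T' ∈ l₁ ↔ T' ∈ 𝒯 ∧ T.dist T' ≤ G * T.len ∧ 3 ≤ T'.len / T.len)
      (h₁ : TrisectList G 𝒯 l₁ 𝒯₁)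
      (h : TrisectList G (𝒯₁.split T) l 𝒯') : TrisectList G 𝒯 (T :: l) 𝒯'

end TimeMesh

/-! ### Function spaces in time -/

/-- `u ∈ 𝒮²(𝒯; E)`: continuous on `[0, t]` and a polynomial of degree at most two with coefficients
in `E` on every time step. Only the values on `[0, t]` are relevant. -/
def IsSpline {E : Type*} [NormedAddCommGroup E] [NormedSpace ℝ E] (t : ℝ) (𝒯 : TimeMesh)
    (u : ℝ → E) : Prop :=
  ContinuousOn u (Icc 0 t) ∧
    ∀ T ∈ 𝒯, ∃ c₀ c₁ c₂ : E, ∀ r ∈ Icc T.1 T.2, u r = c₀ + r • c₁ + r ^ 2 • c₂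

/-- `u ∈ H¹(0, t; E)`, for the continuous representative: `u` is the integral of its almost
everywhere derivative, and the latter is square integrable. -/
def MemH1 {E : Type*} [NormedAddCommGroup E] [NormedSpace ℝ E] (t : ℝ) (u : ℝ → E) : Prop :=
  MemLp (deriv u) 2 (volume.restrict (Icc 0 t)) ∧
    ∀ r ∈ Icc 0 t, u r = u 0 + ∫ q in 0..r, deriv u q

/-! ### The parabolic problem -/

/-- The data of an abstract parabolic problem `(∂_t + A) u = f` on `[0, t_end]`, `u(0) = u₀`, for
a Gelfand triple `V ⊆ H ⊆ V*`. The dual `V*` is the space of continuous linear functionals on `V`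
with its operator norm, and `ι` is the embedding of `V` into `H`. -/
structure ParabolicProblem (V H : Type*) [NormedAddCommGroup V] [InnerProductSpace ℝ V]
    [NormedAddCommGroup H] [InnerProductSpace ℝ H] where
  /-- the final time -/
  tEnd : ℝ
  tEnd_pos : 0 < tEnd
  /-- the embedding of `V` into `H` -/
  ι : V →L[ℝ] H
  ι_injective : Function.Injective ι
  /-- the operator -/
  A : V →L[ℝ] (V →L[ℝ] ℝ)
  A_symm : ∀ v w : V, A v w = A w v
  /-- the right-hand side -/
  f : ℝ → (V →L[ℝ] ℝ)
  /-- the initial value -/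
  u₀ : V

namespace ParabolicProblem

variable {V H : Type*} [NormedAddCommGroup V] [InnerProductSpace ℝ V]
  [NormedAddCommGroup H] [InnerProductSpace ℝ H] (P : ParabolicProblem V H)

/-- Ellipticity and boundedness of the operator `A`, with constants `α` and `β`. -/
def IsElliptic (α β : ℝ) : Prop :=
  (∀ v : V, α * ‖v‖ ^ 2 ≤ P.A v v) ∧ ∀ v w : V, |P.A v w| ≤ β * ‖v‖ * ‖w‖

/-- The embedding `V → V*`, `w ↦ ⟨w, ·⟩_H`, of the Gelfand triple. -/
def toDual (w : V) : V →L[ℝ] ℝ := (innerSL ℝ (P.ι w)).comp P.ι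

/-- The norm in `W*` of the restriction of a functional to the subspace `W` of `V`, where `W`
carries the norm of `V`. -/
def dualNorm (W : Submodule ℝ V) (φ : V →L[ℝ] ℝ) : ℝ := ‖φ.comp W.subtypeL‖

/-- The norm `(‖w‖²_{L²(0,t_end;V)} + ‖∂_t w‖²_{L²(0,t_end;W*)})^{1/2}`, where `∂_t w` acts on
`W` through the inner product of `H`. On functions with values in `W` it is the norm of
`L²(0,t_end;W) ∩ H¹(0,t_end;W*)`. -/
def xNorm (W : Submodule ℝ V) (w : ℝ → V) : ℝ :=
  Real.sqrt (∫ t in 0..P.tEnd, (‖w t‖ ^ 2 + dualNorm W (P.toDual (deriv w t)) ^ 2))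

/-- The Galerkin projection of the parabolic problem onto the finite dimensional subspace `W`:
`u ∈ H¹(0,t_end;W)`, `(∂_t + A) u = f` in `W*` almost everywhere, and `u(0)` is the `V`-orthogonal
projection of `u₀` onto `W`. For `W = ⊤` this is the original problem. -/
structure IsSolution (W : Submodule ℝ V) [W.HasOrthogonalProjection] (u : ℝ → V) : Prop where
  memH1 : MemH1 P.tEnd u
  mem : ∀ t ∈ Icc 0 P.tEnd, u t ∈ W
  eqn : ∀ᵐ t ∂(volume.restrict (Icc 0 P.tEnd)), ∀ v ∈ W,
    P.toDual (deriv u t) v + P.A (u t) v = P.f t v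
  init : u 0 = W.starProjection P.u₀

/-- The ansatz space `𝒳_𝒯(W) = 𝒮²(𝒯; W)`. -/
def ansatz (W : Submodule ℝ V) (𝒯 : TimeMesh) : Set (ℝ → V) :=
  {u | IsSpline P.tEnd 𝒯 u ∧ ∀ t ∈ Icc 0 P.tEnd, u t ∈ W}

/-- The time stepping scheme for the problem on `W`: on every time step the residual has vanishing
integral mean and vanishes at the right end point. The derivative at the end point is the one-sided
derivative from within the time step. -/
structure IsDiscreteSolution (W : Submodule ℝ V) [W.HasOrthogonalProjection] (𝒯 : TimeMesh)
    (u : ℝ → V) : Prop where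
  mem : u ∈ P.ansatz W 𝒯
  init : u 0 = W.starProjection P.u₀
  mean : ∀ T ∈ 𝒯, ∀ v ∈ W,
    ∫ t in T.1..T.2, (P.toDual (deriv u t) v + P.A (u t) v) = ∫ t in T.1..T.2, P.f t v
  point : ∀ T ∈ 𝒯, ∀ v ∈ W,
    P.toDual (derivWithin u (Icc T.1 T.2) T.2) v + P.A (u T.2) v = P.f T.2 v

/-- The squared error indicator
`η_𝒯(T)² = |T|² ‖∂_t f - ∂_t² u - ∂_t A u‖²_{L²(T;W*)}`. -/
def indicatorSq (W : Submodule ℝ V) (u : ℝ → V) (T : TimeStep) : ℝ :=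
  T.len ^ 2 * ∫ t in T.1..T.2,
    dualNorm W (deriv P.f t - P.toDual (deriv (deriv u) t) - P.A (deriv u t)) ^ 2

/-- The error estimator `η_𝒯`. -/
def estimator (W : Submodule ℝ V) (𝒯 : TimeMesh) (u : ℝ → V) : ℝ :=
  Real.sqrt (∑ T ∈ 𝒯, P.indicatorSq W u T)

/-- `M` is a set of minimal cardinality among the subsets of `𝒯` that satisfy the Dörfler
criterion `∑_{T ∈ M} η_𝒯(T)² ≥ θ η_𝒯²`. -/
def IsMarked (W : Submodule ℝ V) (𝒯 : TimeMesh) (u : ℝ → V) (θ : ℝ) (M : Finset TimeStep) : Prop :=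
  M ⊆ 𝒯 ∧ θ * P.estimator W 𝒯 u ^ 2 ≤ ∑ T ∈ M, P.indicatorSq W u T ∧
    ∀ M' ⊆ 𝒯, θ * P.estimator W 𝒯 u ^ 2 ≤ ∑ T ∈ M', P.indicatorSq W u T → M.card ≤ M'.card

/-- The sequences `𝒯_ℓ` and `u_ℓ` are produced by the adaptive time stepping algorithm with marking
parameter `θ` and grading parameter `G`, applied to the problem on `W` and started with the mesh
`𝒯₀`. The marked time steps may be visited in any order. -/
structure IsAdaptiveRun (W : Submodule ℝ V) [W.HasOrthogonalProjection] (𝒯₀ : TimeMesh) (θ : ℝ)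
    (G : ℕ) (𝒯 : ℕ → TimeMesh) (u : ℕ → ℝ → V) : Prop where
  init : 𝒯 0 = 𝒯₀
  solve : ∀ ℓ, P.IsDiscreteSolution W (𝒯 ℓ) (u ℓ)
  refine : ∀ ℓ, ∃ (M : Finset TimeStep) (l : List TimeStep),
    P.IsMarked W (𝒯 ℓ) (u ℓ) θ M ∧ l.Nodup ∧ (∀ T, T ∈ l ↔ T ∈ M) ∧
      TimeMesh.TrisectList G (𝒯 ℓ) l (𝒯 (ℓ + 1))

/-- The best approximation error
`inf {‖u - v‖_𝒳 : v ∈ 𝒳_𝒯(W), 𝒯 admissible, #𝒯 - #𝒯₀ ≤ N}`. -/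
def bestError (W : Submodule ℝ V) (Cg g₀ : ℝ) (𝒯₀ : TimeMesh) (u : ℝ → V) (N : ℕ) : ℝ :=
  sInf {e | ∃ 𝒯 : TimeMesh, TimeMesh.Admissible Cg g₀ 𝒯₀ 𝒯 ∧ 𝒯.card ≤ 𝒯₀.card + N ∧
    ∃ v ∈ P.ansatz W 𝒯, e = P.xNorm W fun t => u t - v t}

/-- `sup_N N^s · bestError N ≤ M`: the function `u` is approximable with rate `s`, and `M` bounds
its approximation seminorm. -/
def ApproxClass (W : Submodule ℝ V) (Cg g₀ : ℝ) (𝒯₀ : TimeMesh) (u : ℝ → V) (s M : ℝ) : Prop :=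
  ∀ N : ℕ, P.bestError W Cg g₀ 𝒯₀ u N * (N : ℝ) ^ s ≤ M

end ParabolicProblem

end AdaptiveRadau

end

/-! Two facts are combined: the estimator is reliable up to the projection error, and it is itself
bounded by `K * M * card ^ (-s)`. The minimum in the claim is then the estimator.

Reliability (`xNorm_sq_le`) is an energy estimate. On a time step the residual is a quadratic
polynomial in time that vanishes at the right end and in the mean. It is therefore the right Radau
polynomial times one functional ρ (`exists_residual`), and the indicator is 4/9 |T|⁵‖ρ‖². The
constant involves only α and β.

For the rate, `K` may depend on L and n₀. The inverse inequality on V_R turns the projected problem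
into a linear equation y' = q - B y in V_R*, with t_end ‖B‖ ≤ βL and q quadratic on each initial
step. There y''' solves the homogeneous equation w' = -B w, so its norm is comparable to the value
ωᵢ at the left end of the i-th initial step. These finitely many weights govern everything
(`exists_weight`). With N = ∑ |T|⁵ω², every spline on every refinement has squared error at least a
multiple of N, while the indicator of T is at most a multiple of |T|⁵(ω² + N/t_end⁵). The extra N is
the discretization error transported in time.

Consequently the squared error on a refinement with m steps is at least a multiple of m⁻⁴ max ω², by
the power mean inequality. A rate s > 2 thus forces all weights, and with them the estimator, to
vanish. For s ≤ 2 it suffices that the algorithm always attains order two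
(`exists_card_pow_mul_le`). Dörfler marking makes N decay geometrically. Minimality of the marked
set lets at most one marked step be much shorter than the fourth root of the normalized N
(`marked_small_unique`). Its refinement, including the grading, creates only O(j) short steps in
iteration j. So there are O(ℓ²) short steps up to iteration ℓ, which geometric decay absorbs, and
the number of remaining steps is bounded because their lengths add up to t_end. -/

noncomputable section

namespace AdaptiveRadau

/-! ### Triadic meshes and sums over their refinements -/

/-- The `i`-th interval of level `k` in the triadic tree over intervals of length `h`. -/
def node (h : ℝ) (k i : ℕ) : TimeStep := (h * i / 3 ^ k, h * (i + 1) / 3 ^ k)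

theorem len_node (h : ℝ) (k i : ℕ) : (node h k i).len = h / 3 ^ k := by
  simp only [node, TimeStep.len]; ring

/-- A mesh of nonoverlapping triadic intervals, subordinate to the uniform mesh with `n` steps of
length `h`, in which every time step is preceded by another one or starts at `0`. -/
structure IsTriadic (h : ℝ) (n : ℕ) (𝒯 : TimeMesh) : Prop where
  exists_node : ∀ T ∈ 𝒯, ∃ k i : ℕ, T = node h k i
  nonoverlap : ∀ T ∈ 𝒯, ∀ T' ∈ 𝒯, T ≠ T' → T.2 ≤ T'.1 ∨ T'.2 ≤ T.1
  exists_left : ∀ T ∈ 𝒯, T.1 = 0 ∨ ∃ T' ∈ 𝒯, T'.2 = T.1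
  exists_sub : ∀ T ∈ 𝒯, ∃ i < n, h * i ≤ T.1 ∧ T.2 ≤ h * (i + 1)

theorem TimeStep.mem_children {T T' : TimeStep} :
    T' ∈ T.children ↔ T' = (T.1, T.1 + T.len / 3) ∨
      T' = (T.1 + T.len / 3, T.1 + 2 * T.len / 3) ∨ T' = (T.1 + 2 * T.len / 3, T.2) := by
  simp [TimeStep.children]

theorem TimeMesh.mem_split {𝒯 : TimeMesh} {T T' : TimeStep} :
    T' ∈ 𝒯.split T ↔ (T' ≠ T ∧ T' ∈ 𝒯) ∨ T' ∈ T.children := by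
  simp [TimeMesh.split]

theorem TimeStep.len_child {T c : TimeStep} (hc : c ∈ T.children) : c.len = T.len / 3 := by
  rcases TimeStep.mem_children.1 hc with rfl | rfl | rfl <;> simp only [TimeStep.len] <;> ring

theorem TimeStep.child_bounds {T c : TimeStep} (hT : 0 < T.len) (hc : c ∈ T.children) :
    T.1 ≤ c.1 ∧ c.2 ≤ T.2 ∧ c.1 < c.2 := by
  have h : T.len = T.2 - T.1 := rfl
  rcases TimeStep.mem_children.1 hc with rfl | rfl | rfl <;>
    refine ⟨?_, ?_, ?_⟩ <;> dsimp only <;> linarith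

theorem child_node {h : ℝ} {k i : ℕ} {c : TimeStep} (hc : c ∈ (node h k i).children) :
    ∃ j, c = node h (k + 1) j := by
  have h3 : (3 : ℝ) ^ k ≠ 0 := by positivity
  rcases TimeStep.mem_children.1 hc with rfl | rfl | rfl
  · refine ⟨3 * i, ?_⟩
    simp only [node, TimeStep.len, Prod.mk.injEq]
    constructor <;> push_cast <;> field_simp <;> ring
  · refine ⟨3 * i + 1, ?_⟩
    simp only [node, TimeStep.len, Prod.mk.injEq]
    constructor <;> push_cast <;> field_simp <;> ring
  · refine ⟨3 * i + 2, ?_⟩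
    simp only [node, TimeStep.len, Prod.mk.injEq]
    constructor <;> push_cast <;> field_simp <;> ring

namespace IsTriadic

variable {h : ℝ} {n : ℕ} {𝒯 𝒯' : TimeMesh}

theorem len_pos (hh : 0 < h) (H : IsTriadic h n 𝒯) {T : TimeStep} (hT : T ∈ 𝒯) : 0 < T.len := by
  obtain ⟨k, i, rfl⟩ := H.exists_node T hT
  rw [len_node]; positivity

theorem lt (hh : 0 < h) (H : IsTriadic h n 𝒯) {T : TimeStep} (hT : T ∈ 𝒯) : T.1 < T.2 :=
  sub_pos.1 (H.len_pos hh hT)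

theorem bounds (hh : 0 < h) (H : IsTriadic h n 𝒯) {T : TimeStep} (hT : T ∈ 𝒯) :
    0 ≤ T.1 ∧ T.2 ≤ h * n := by
  obtain ⟨i, hi, h1, h2⟩ := H.exists_sub T hT
  have hi' : (i : ℝ) + 1 ≤ n := by exact_mod_cast hi
  exact ⟨le_trans (by positivity) h1, h2.trans (mul_le_mul_of_nonneg_left hi' hh.le)⟩

/-- A child lies inside its parent and is shorter, which nonoverlap forbids for a second member of
the mesh. Hence splitting is a disjoint replacement. -/
theorem child_not_mem (hh : 0 < h) (H : IsTriadic h n 𝒯) {T c : TimeStep} (hT : T ∈ 𝒯)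
    (hc : c ∈ T.children) : c ∉ 𝒯 := by
  intro hc'
  have hp := H.len_pos hh hT
  obtain ⟨h1, h2, h3⟩ := TimeStep.child_bounds hp hc
  have hne : T ≠ c := by
    rintro rfl
    have := TimeStep.len_child hc
    linarith
  rcases H.nonoverlap T hT c hc' hne with h4 | h4 <;> linarith

-- Positive length makes the three children distinct, so the finite set really has three elements.
open scoped Classical in
theorem sum_children {T : TimeStep} (hp : 0 < T.len) (F : TimeStep → ℝ) :
    ∑ c ∈ T.children, F c = F (T.1, T.1 + T.len / 3) +
      F (T.1 + T.len / 3, T.1 + 2 * T.len / 3) + F (T.1 + 2 * T.len / 3, T.2) := by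
  unfold TimeStep.children
  rw [Finset.sum_insert, Finset.sum_insert, Finset.sum_singleton]
  · ring
  · simp only [Finset.mem_singleton, Prod.mk.injEq, not_and]
    intro h; linarith
  · simp only [Finset.mem_insert, Finset.mem_singleton, Prod.mk.injEq, not_or, not_and]
    constructor <;> intro h <;> linarith

open scoped Classical in
theorem sum_split (hh : 0 < h) (H : IsTriadic h n 𝒯) {T : TimeStep} (hT : T ∈ 𝒯)
    (F : TimeStep → ℝ) :
    ∑ T' ∈ 𝒯.split T, F T' = ∑ T' ∈ 𝒯, F T' - F T + ∑ c ∈ T.children, F c := by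
  have e : 𝒯.split T = 𝒯.erase T ∪ T.children := by
    ext; simp [TimeMesh.split]
  rw [e, Finset.sum_union, ← Finset.add_sum_erase 𝒯 F hT]
  · ring
  · rw [Finset.disjoint_left]
    intro c hc hc'
    exact H.child_not_mem hh hT hc' (Finset.mem_of_mem_erase hc)

theorem split (hh : 0 < h) (H : IsTriadic h n 𝒯) {T : TimeStep} (hT : T ∈ 𝒯) :
    IsTriadic h n (𝒯.split T) := by
  have hp := H.len_pos hh hT
  have hl : T.len = T.2 - T.1 := rfl
  refine ⟨?_, ?_, ?_, ?_⟩
  · intro T' hT'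
    rcases TimeMesh.mem_split.1 hT' with ⟨-, h1⟩ | h1
    · exact H.exists_node T' h1
    · obtain ⟨k, i, rfl⟩ := H.exists_node T hT
      obtain ⟨j, hj⟩ := child_node h1
      exact ⟨_, _, hj⟩
  · intro T₁ h1 T₂ h2 hne
    rcases TimeMesh.mem_split.1 h1 with ⟨n1, m1⟩ | c1 <;>
      rcases TimeMesh.mem_split.1 h2 with ⟨n2, m2⟩ | c2
    · exact H.nonoverlap _ m1 _ m2 hne
    · obtain ⟨a, b, c⟩ := TimeStep.child_bounds hp c2
      rcases H.nonoverlap _ m1 _ hT n1 with h | h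
      · left; linarith
      · right; linarith
    · obtain ⟨a, b, c⟩ := TimeStep.child_bounds hp c1
      rcases H.nonoverlap _ hT _ m2 n2.symm with h | h
      · left; linarith
      · right; linarith
    · rcases TimeStep.mem_children.1 c1 with rfl | rfl | rfl <;>
        rcases TimeStep.mem_children.1 c2 with rfl | rfl | rfl <;>
        first
          | exact absurd rfl hne
          | (left; dsimp only; linarith)
          | (right; dsimp only; linarith)
  · intro T' hT'
    rcases TimeMesh.mem_split.1 hT' with ⟨n1, m1⟩ | c1
    · rcases H.exists_left T' m1 with h0 | ⟨S, hS, hS'⟩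
      · exact Or.inl h0
      · right
        by_cases hST : S = T
        · subst hST
          exact ⟨(S.1 + 2 * S.len / 3, S.2), TimeMesh.mem_split.2 (Or.inr
            (TimeStep.mem_children.2 (Or.inr (Or.inr rfl)))), hS'⟩
        · exact ⟨S, TimeMesh.mem_split.2 (Or.inl ⟨hST, hS⟩), hS'⟩
    · rcases TimeStep.mem_children.1 c1 with rfl | rfl | rfl
      · rcases H.exists_left T hT with h0 | ⟨S, hS, hS'⟩
        · exact Or.inl h0
        · refine Or.inr ⟨S, TimeMesh.mem_split.2 (Or.inl ⟨?_, hS⟩), hS'⟩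
          rintro rfl
          have := H.lt hh hT
          linarith
      · exact Or.inr ⟨_, TimeMesh.mem_split.2 (Or.inr
            (TimeStep.mem_children.2 (Or.inl rfl))), rfl⟩
      · exact Or.inr ⟨_, TimeMesh.mem_split.2 (Or.inr
            (TimeStep.mem_children.2 (Or.inr (Or.inl rfl)))), rfl⟩
  · intro T' hT'
    rcases TimeMesh.mem_split.1 hT' with ⟨-, h1⟩ | h1
    · exact H.exists_sub T' h1
    · obtain ⟨i, hi, h2, h3⟩ := H.exists_sub T hT
      obtain ⟨a, b, c⟩ := TimeStep.child_bounds hp h1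
      exact ⟨i, hi, by linarith, by linarith⟩

theorem generated (hh : 0 < h) (H : IsTriadic h n 𝒯) (hg : TimeMesh.GeneratedFrom 𝒯 𝒯') :
    IsTriadic h n 𝒯' := by
  induction hg with
  | refl => exact H
  | split _ hT ih => exact ih.split hh hT

/-- Additive functions of the time steps have the same sum over all refinements. -/
theorem sum_generated (hh : 0 < h) (H : IsTriadic h n 𝒯) (hg : TimeMesh.GeneratedFrom 𝒯 𝒯')
    {F : TimeStep → ℝ}
    (hF : ∀ 𝒮, TimeMesh.GeneratedFrom 𝒯 𝒮 → ∀ T ∈ 𝒮, ∑ c ∈ T.children, F c = F T) :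
    ∑ T ∈ 𝒯', F T = ∑ T ∈ 𝒯, F T := by
  induction hg with
  | refl => rfl
  | @split 𝒮 T hg' hT ih =>
    rw [(H.generated hh hg').sum_split hh hT, hF _ hg' T hT, ih]; ring

/-- A function of the time steps that is reduced by the factor `1/81` when a time step is split
decreases at least by `80/81` of its sum over the time steps which do not survive. -/
theorem sum_generated_le (hh : 0 < h) (H : IsTriadic h n 𝒯) (hg : TimeMesh.GeneratedFrom 𝒯 𝒯')
    {F : TimeStep → ℝ} (h0 : ∀ T, 0 ≤ F T)
    (hF : ∀ 𝒮, TimeMesh.GeneratedFrom 𝒯 𝒮 → ∀ T ∈ 𝒮, ∑ c ∈ T.children, F c = F T / 81)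
    {M : Finset TimeStep} (hM : M ⊆ 𝒯) (hM' : ∀ T ∈ M, T ∉ 𝒯') :
    ∑ T ∈ 𝒯', F T ≤ ∑ T ∈ 𝒯, F T - 80 / 81 * ∑ T ∈ M, F T := by
  induction hg generalizing M with
  | refl =>
    have : M = ∅ := Finset.eq_empty_of_forall_notMem fun T hT => hM' T hT (hM hT)
    simp [this]
  | @split 𝒮 T hg' hT ih =>
    rw [(H.generated hh hg').sum_split hh hT, hF _ hg' T hT]
    have h1 := ih (M := M.erase T) ((Finset.erase_subset _ _).trans hM) (by
      intro S hS hS'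
      rw [Finset.mem_erase] at hS
      exact hM' S hS.2 (TimeMesh.mem_split.2 (Or.inl ⟨hS.1, hS'⟩)))
    have h2 : ∑ S ∈ M, F S ≤ ∑ S ∈ M.erase T, F S + F T := by
      by_cases hTM : T ∈ M
      · rw [← Finset.add_sum_erase M F hTM]; linarith
      · rw [Finset.erase_eq_of_notMem hTM]; linarith [h0 T]
    linarith

/-- The time step `T` has been split in the course of the generation of the mesh `𝒯`. -/
def _root_.AdaptiveRadau.WasSplit (T : TimeStep) (𝒯 : TimeMesh) : Prop :=
  ∃ S ∈ 𝒯, T.1 ≤ S.1 ∧ S.2 ≤ T.2 ∧ S.len < T.len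

/-- `WasSplit` records history through a shorter step inside `T`; such a step persists under
refinement and, by nonoverlap, rules out `T` itself. -/
theorem not_mem_of_wasSplit (hh : 0 < h) (H : IsTriadic h n 𝒯) {T : TimeStep}
    (hT : WasSplit T 𝒯) : T ∉ 𝒯 := by
  obtain ⟨S, hS, h1, h2, h3⟩ := hT
  intro hT
  have h4 := H.lt hh hS
  rcases H.nonoverlap T hT S hS (by rintro rfl; exact lt_irrefl _ h3) with h | h <;> linarith

theorem wasSplit_split (hh : 0 < h) (H : IsTriadic h n 𝒯) {T : TimeStep} (hT : T ∈ 𝒯) :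
    WasSplit T (𝒯.split T) := by
  have hp := H.len_pos hh hT
  have hc : (T.1, T.1 + T.len / 3) ∈ T.children := TimeStep.mem_children.2 (Or.inl rfl)
  obtain ⟨a, b, -⟩ := TimeStep.child_bounds hp hc
  exact ⟨_, TimeMesh.mem_split.2 (Or.inr hc), a, b, by rw [TimeStep.len_child hc]; linarith⟩

theorem wasSplit_mono (hh : 0 < h) (H : IsTriadic h n 𝒯) (hg : TimeMesh.GeneratedFrom 𝒯 𝒯')
    {T : TimeStep} (hT : WasSplit T 𝒯) : WasSplit T 𝒯' := by
  induction hg with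
  | refl => exact hT
  | @split 𝒮 T' hg' hT' ih =>
    obtain ⟨S, hS, h1, h2, h3⟩ := ih
    by_cases hST : S = T'
    · subst hST
      obtain ⟨c, hc, a, b, l⟩ := (H.generated hh hg').wasSplit_split hh hS
      exact ⟨c, hc, by linarith, by linarith, by linarith⟩
    · exact ⟨S, TimeMesh.mem_split.2 (Or.inl ⟨hST, hS⟩), h1, h2, h3⟩

theorem mem_or_wasSplit (hh : 0 < h) (H : IsTriadic h n 𝒯) (hg : TimeMesh.GeneratedFrom 𝒯 𝒯')
    {T : TimeStep} (hT : T ∈ 𝒯) : T ∈ 𝒯' ∨ WasSplit T 𝒯' := by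
  induction hg with
  | refl => exact Or.inl hT
  | @split 𝒮 T' hg' hT' ih =>
    by_cases hTT : T = T'
    · subst hTT
      exact Or.inr ((H.generated hh hg').wasSplit_split hh hT')
    · rcases ih with h1 | h1
      · exact Or.inl (TimeMesh.mem_split.2 (Or.inl ⟨hTT, h1⟩))
      · exact Or.inr ((H.generated hh hg').wasSplit_mono hh (.split .refl hT') h1)

end IsTriadic

theorem TimeMesh.GeneratedFrom.trans {𝒯₀ 𝒯₁ 𝒯₂ : TimeMesh} (h₁ : GeneratedFrom 𝒯₀ 𝒯₁)
    (h₂ : GeneratedFrom 𝒯₁ 𝒯₂) : GeneratedFrom 𝒯₀ 𝒯₂ := by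
  induction h₂ with
  | refl => exact h₁
  | split _ hT ih => exact .split ih hT

/-! ### The recursive trisection and its locality -/

section Trisect

variable {h : ℝ} {n G : ℕ} {𝒯 𝒯' : TimeMesh} {l : List TimeStep}

/-- Recursion only moves to steps at least three times as long, so nothing as short as `T` is ever
split. This is why a step is still present when its turn comes after the calls for its longer
neighbours. -/
theorem TrisectList.mem_of_lt (H : TimeMesh.TrisectList G 𝒯 l 𝒯') {T : TimeStep}
    (hT : T ∈ 𝒯) (hp : 0 < T.len) (hl : ∀ S ∈ l, T.len < S.len) : T ∈ 𝒯' := by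
  induction H with
  | nil => exact hT
  | skip _ _ ih => exact ih hT fun S hS => hl S (List.mem_cons_of_mem _ hS)
  | @refine 𝒯 𝒯₁ 𝒯' S l l₁ hS _ hl₁ _ _ ih₁ ih =>
    have hTS := hl S List.mem_cons_self
    refine ih (TimeMesh.mem_split.2 (Or.inl ⟨?_, ih₁ hT ?_⟩))
      fun S' hS' => hl S' (List.mem_cons_of_mem _ hS')
    · rintro rfl; exact lt_irrefl _ hTS
    · intro S' hS'
      have h3 := ((hl₁ S').1 hS').2.2
      rw [le_div_iff₀ (hp.trans hTS)] at h3
      linarith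

theorem TrisectList.generated (hh : 0 < h) (H : TimeMesh.TrisectList G 𝒯 l 𝒯')
    (h𝒯 : IsTriadic h n 𝒯) : TimeMesh.GeneratedFrom 𝒯 𝒯' := by
  induction H with
  | nil => exact .refl
  | skip _ _ ih => exact ih h𝒯
  | @refine 𝒯 𝒯₁ 𝒯' S l l₁ hS _ hl₁ H₁ _ ih₁ ih =>
    have g₁ := ih₁ h𝒯
    have hp := h𝒯.len_pos hh hS
    have hS₁ : S ∈ 𝒯₁ := by
      refine TrisectList.mem_of_lt H₁ hS hp ?_
      intro S' hS'
      have h3 := ((hl₁ S').1 hS').2.2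
      rw [le_div_iff₀ hp] at h3
      linarith
    have g₂ := TimeMesh.GeneratedFrom.split g₁ hS₁
    exact g₂.trans (ih (h𝒯.generated hh g₂))

/-- The alternative in `hT'` is needed for the induction: an earlier call in the list may already
have split `T` through the grading. -/
theorem TrisectList.wasSplit (hh : 0 < h) (H : TimeMesh.TrisectList G 𝒯 l 𝒯')
    (h𝒯 : IsTriadic h n 𝒯) {T : TimeStep} (hT : T ∈ l) (hT' : T ∈ 𝒯 ∨ WasSplit T 𝒯) :
    WasSplit T 𝒯' := by
  induction H with
  | nil => simp at hT
  | @skip 𝒯 𝒯' S l hS H ih =>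
    rcases List.mem_cons.1 hT with rfl | hT
    · exact h𝒯.wasSplit_mono hh (TrisectList.generated hh H h𝒯) (hT'.resolve_left hS)
    · exact ih h𝒯 hT hT'
  | @refine 𝒯 𝒯₁ 𝒯' S l l₁ hS _ hl₁ H₁ H₂ ih₁ ih =>
    have g₁ := TrisectList.generated hh H₁ h𝒯
    have hp := h𝒯.len_pos hh hS
    have hS₁ : S ∈ 𝒯₁ := by
      refine TrisectList.mem_of_lt H₁ hS hp ?_
      intro S' hS'
      have h3 := ((hl₁ S').1 hS').2.2
      rw [le_div_iff₀ hp] at h3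
      linarith
    have t₁ := h𝒯.generated hh g₁
    have g₂ := TimeMesh.GeneratedFrom.split g₁ hS₁
    have t₂ := h𝒯.generated hh g₂
    rcases List.mem_cons.1 hT with rfl | hT
    · exact t₂.wasSplit_mono hh (TrisectList.generated hh H₂ t₂) (t₁.wasSplit_split hh hS₁)
    · refine ih t₂ hT ?_
      rcases hT' with h1 | h1
      · exact h𝒯.mem_or_wasSplit hh g₂ h1
      · exact Or.inr (h𝒯.wasSplit_mono hh g₂ h1)

theorem TimeStep.dist_nonneg (T T' : TimeStep) : 0 ≤ T.dist T' := le_max_left _ _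

theorem TimeStep.dist_triangle {T T' T'' : TimeStep} (h' : 0 ≤ T'.len) :
    T.dist T'' ≤ T.dist T' + T'.len + T'.dist T'' := by
  have h1 := TimeStep.dist_nonneg T T'
  have h2 := TimeStep.dist_nonneg T' T''
  have a1 : T'.1 - T.2 ≤ T.dist T' := (le_max_left _ _).trans (le_max_right _ _)
  have a2 : T.1 - T'.2 ≤ T.dist T' := (le_max_right _ _).trans (le_max_right _ _)
  have b1 : T''.1 - T'.2 ≤ T'.dist T'' := (le_max_left _ _).trans (le_max_right _ _)
  have b2 : T'.1 - T''.2 ≤ T'.dist T'' := (le_max_right _ _).trans (le_max_right _ _)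
  have e : T'.len = T'.2 - T'.1 := rfl
  refine max_le (by linarith) (max_le (by linarith) (by linarith))

/-- Every time step created by a list of calls of the refinement procedure is close to one of the
time steps of the list, relative to its own length. -/
theorem TrisectList.exists_source (hh : 0 < h) (H : TimeMesh.TrisectList G 𝒯 l 𝒯')
    (h𝒯 : IsTriadic h n 𝒯) {T : TimeStep} (hT : T ∈ 𝒯') (hT' : T ∉ 𝒯) :
    ∃ S ∈ l, S.dist T + (G + 3) * S.len ≤ 3 * (G + 3) * T.len := by
  induction H with
  | nil => exact absurd hT hT'
  | skip _ _ ih =>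
    obtain ⟨S, hS, h1⟩ := ih h𝒯 hT hT'
    exact ⟨S, List.mem_cons_of_mem _ hS, h1⟩
  | @refine 𝒯 𝒯₁ 𝒯' S l l₁ hS _ hl₁ H₁ H₂ ih₁ ih =>
    have g₁ := TrisectList.generated hh H₁ h𝒯
    have hp := h𝒯.len_pos hh hS
    have hS₁ : S ∈ 𝒯₁ := by
      refine TrisectList.mem_of_lt H₁ hS hp ?_
      intro S' hS'
      have h3 := ((hl₁ S').1 hS').2.2
      rw [le_div_iff₀ hp] at h3
      linarith
    have t₂ := h𝒯.generated hh (TimeMesh.GeneratedFrom.split g₁ hS₁)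
    by_cases hT₂ : T ∈ 𝒯₁.split S
    · rcases TimeMesh.mem_split.1 hT₂ with ⟨-, h1⟩ | h1
      · obtain ⟨S', hS', h2⟩ := ih₁ h𝒯 h1 hT'
        obtain ⟨m', d', l'⟩ := (hl₁ S').1 hS'
        rw [le_div_iff₀ hp] at l'
        -- The term (G+3)|S| on the left is chosen to close the induction: dist(S,T) ≤ G|S| + |S'| +
        -- dist(S',T) and 3|S| ≤ |S'| give (2G+3)|S| + |S'| ≤ (G+3)|S'|.
        have := TimeStep.dist_triangle (T := S) (T'' := T) (h𝒯.len_pos hh m').le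
        refine ⟨S, List.mem_cons_self, ?_⟩
        have hG : (0 : ℝ) ≤ G := by positivity
        nlinarith
      · refine ⟨S, List.mem_cons_self, ?_⟩
        obtain ⟨a, b, c⟩ := TimeStep.child_bounds hp h1
        have e : S.dist T = 0 := by
          unfold TimeStep.dist
          refine max_eq_left (max_le ?_ ?_) <;> linarith
        rw [e, TimeStep.len_child h1]
        apply le_of_eq; ring
    · obtain ⟨S', hS', h1⟩ := ih t₂ hT hT₂
      exact ⟨S', List.mem_cons_of_mem _ hS', h1⟩

end Trisect

/-- The number of intervals in a triadic mesh that are at least as long as a third of the node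
`S` and close to it, relative to their length, grows at most linearly with the level of `S`. -/
theorem card_le_of_dist_le {h : ℝ} (hh : 0 < h) {n k i : ℕ} {𝒯 : TimeMesh} (H : IsTriadic h n 𝒯)
    {D : ℕ} {F : Finset TimeStep} (hF : F ⊆ 𝒯)
    (hlen : ∀ T ∈ F, (node h k i).len ≤ 3 * T.len)
    (hdist : ∀ T ∈ F, (node h k i).dist T ≤ D * T.len) :
    F.card ≤ (k + 2) * (2 * D + 5) := by
  classical
  choose! lev idx hnode using H.exists_node
  -- A length of at least |S|/3 leaves only the levels 0, …, k+1.
  have hlev : ∀ T ∈ F, lev T ∈ Finset.range (k + 2) := by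
    intro T hT
    have h1 := hlen T hT
    rw [hnode T (hF hT), len_node, len_node] at h1
    rw [Finset.mem_range]
    by_contra hcon
    have h2 : (3 : ℝ) ^ (k + 2) ≤ 3 ^ lev T := pow_le_pow_right₀ (by norm_num) (by omega)
    rw [div_le_iff₀ (by positivity)] at h1
    have h3 : 3 * (h / 3 ^ lev T) * 3 ^ k ≤ 3 * (h / 3 ^ (k + 2)) * 3 ^ k := by gcongr
    have h4 : 3 * (h / 3 ^ (k + 2)) * 3 ^ k = h / 3 := by field_simp; ring
    linarith
  -- Members of one level are determined by their index, and closeness to S puts the indices into a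
  -- window of width 2D+4.
  have key : ∀ m ∈ Finset.range (k + 2), (F.filter fun T => lev T = m).card ≤ 2 * D + 5 := by
    intro m _
    set x : ℝ := (node h k i).1 / (h / 3 ^ m) with hx
    have hm : 0 < h / 3 ^ m := by positivity
    have hsub : (F.filter fun T => lev T = m).image (fun T => (idx T : ℤ)) ⊆
        Finset.Icc ⌈x - D - 1⌉ ⌊x + D + 3⌋ := by
      intro j hj
      rw [Finset.mem_image] at hj
      obtain ⟨T, hT, rfl⟩ := hj
      rw [Finset.mem_filter] at hT
      obtain ⟨hTF, hTm⟩ := hT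
      have e := hnode T (hF hTF)
      rw [hTm] at e
      have l1 := hlen T hTF
      have d1 := hdist T hTF
      have a1 : T.1 - (node h k i).2 ≤ (node h k i).dist T :=
        (le_max_left _ _).trans (le_max_right _ _)
      have a2 : (node h k i).1 - T.2 ≤ (node h k i).dist T :=
        (le_max_right _ _).trans (le_max_right _ _)
      have lT : T.len = h / 3 ^ m := by rw [e, len_node]
      have lT' : T.len = T.2 - T.1 := rfl
      have lN : (node h k i).len = (node h k i).2 - (node h k i).1 := rfl
      have eT : T.1 = (h / 3 ^ m) * idx T := by
        exact (congrArg Prod.fst e).trans (mul_div_right_comm _ _ _)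
      have ex : (node h k i).1 = x * (h / 3 ^ m) := by rw [hx]; field_simp
      rw [lT] at d1 l1 lT'
      rw [Finset.mem_Icc]
      constructor
      · rw [Int.ceil_le]
        push_cast
        have : (x - D - 1) * (h / 3 ^ m) ≤ idx T * (h / 3 ^ m) := by nlinarith
        exact le_of_mul_le_mul_right this hm
      · rw [Int.le_floor]
        push_cast
        have : idx T * (h / 3 ^ m) ≤ (x + D + 3) * (h / 3 ^ m) := by nlinarith
        exact le_of_mul_le_mul_right this hm
    have hinj : Set.InjOn (fun T => (idx T : ℤ)) (F.filter fun T => lev T = m : Finset TimeStep) := by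
      intro T hT T' hT' he
      rw [Finset.mem_coe, Finset.mem_filter] at hT hT'
      have he' : idx T = idx T' := Int.ofNat_inj.1 he
      rw [hnode T (hF hT.1), hnode T' (hF hT'.1), hT.2, hT'.2, he']
    rw [← Finset.card_image_of_injOn hinj]
    refine (Finset.card_le_card hsub).trans ?_
    rw [Int.card_Icc]
    have h1 : (⌊x + D + 3⌋ : ℝ) ≤ x + D + 3 := Int.floor_le _
    have h2 : x - D - 1 ≤ (⌈x - D - 1⌉ : ℝ) := Int.le_ceil _
    have h3 : ((⌊x + D + 3⌋ + 1 - ⌈x - D - 1⌉ : ℤ) : ℝ) ≤ ((2 * D + 5 : ℕ) : ℤ) := by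
      push_cast; linarith
    have h4 : ⌊x + D + 3⌋ + 1 - ⌈x - D - 1⌉ ≤ ((2 * D + 5 : ℕ) : ℤ) := by exact_mod_cast h3
    omega
  calc F.card = ∑ m ∈ Finset.range (k + 2), (F.filter fun T => lev T = m).card :=
        Finset.card_eq_sum_card_fiberwise hlev
    _ ≤ ∑ m ∈ Finset.range (k + 2), (2 * D + 5) := Finset.sum_le_sum key
    _ = (k + 2) * (2 * D + 5) := by simp

theorem isTriadic_uniform {t : ℝ} (ht : 0 < t) {n : ℕ} (hn : 1 ≤ n) :
    IsTriadic (t / n) n (TimeMesh.uniform t n) := by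
  classical
  have hn' : (0 : ℝ) < n := by exact_mod_cast hn
  have hmem : ∀ T, T ∈ TimeMesh.uniform t n ↔
      ∃ i < n, T = (t / n * (i : ℝ), t / n * ((i : ℝ) + 1)) := by
    intro T
    simp only [TimeMesh.uniform, Finset.mem_image, Finset.mem_range]
    refine exists_congr fun i => and_congr_right fun _ => ?_
    rw [eq_comm, mul_div_right_comm, mul_div_right_comm]
  have hpos : 0 < t / n := by positivity
  refine ⟨?_, ?_, ?_, ?_⟩
  · intro T hT
    obtain ⟨i, -, rfl⟩ := (hmem T).1 hT
    exact ⟨0, i, by simp [node]⟩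
  · intro T hT T' hT' hne
    obtain ⟨i, -, rfl⟩ := (hmem T).1 hT
    obtain ⟨j, -, rfl⟩ := (hmem T').1 hT'
    rcases lt_trichotomy i j with hij | rfl | hij
    · left
      have : (i : ℝ) + 1 ≤ j := by exact_mod_cast hij
      exact mul_le_mul_of_nonneg_left this hpos.le
    · exact absurd rfl hne
    · right
      have : (j : ℝ) + 1 ≤ i := by exact_mod_cast hij
      exact mul_le_mul_of_nonneg_left this hpos.le
  · intro T hT
    obtain ⟨i, hi, rfl⟩ := (hmem T).1 hT
    rcases Nat.eq_zero_or_pos i with rfl | hi0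
    · left; simp
    · right
      refine ⟨_, (hmem _).2 ⟨i - 1, by omega, rfl⟩, ?_⟩
      have : ((i - 1 : ℕ) : ℝ) + 1 = i := by exact_mod_cast Nat.sub_add_cancel hi0
      simp only [this]
  · intro T hT
    obtain ⟨i, hi, rfl⟩ := (hmem T).1 hT
    exact ⟨i, hi, le_rfl, le_rfl⟩

theorem sum_uniform {t : ℝ} (ht : 0 < t) {n : ℕ} (hn : 1 ≤ n) (F : TimeStep → ℝ) :
    ∑ T ∈ TimeMesh.uniform t n, F T =
      ∑ i ∈ Finset.range n, F (t / n * (i : ℝ), t / n * ((i : ℝ) + 1)) := by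
  classical
  have hn' : (0 : ℝ) < n := by exact_mod_cast hn
  have e : TimeMesh.uniform t n =
      (Finset.range n).image fun i : ℕ => (t / n * (i : ℝ), t / n * ((i : ℝ) + 1)) := by
    ext T
    simp only [TimeMesh.uniform, Finset.mem_image, Finset.mem_range, mul_div_right_comm]
  rw [e, Finset.sum_image]
  intro i _ j _ hij
  simp only [Prod.mk.injEq] at hij
  have := mul_left_cancel₀ (by positivity : t / n ≠ 0) hij.1
  exact_mod_cast this

end AdaptiveRadau

end

/-! ### Dörfler marking and optimal complexity -/

noncomputable section

namespace AdaptiveRadau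

/-- In a set of minimal cardinality with the Dörfler property, all elements but one have a size
that is not much smaller than the fourth root of the total. -/
theorem marked_small_unique {ι : Type*} {𝒯 M : Finset ι} {σ η : ι → ℝ} {A c δ θ : ℝ}
    (hA : 0 < A) (hc : 0 < c) (hδ : 0 < δ) (hδ1 : δ ≤ 1) (hθ : θ ≤ 1 / 4)
    (hσ : ∀ T ∈ 𝒯, 0 ≤ σ T) (hσ1 : ∑ T ∈ 𝒯, σ T ≤ 1) (hη : ∀ T ∈ 𝒯, 0 ≤ η T)
    (hηA : ∀ T ∈ 𝒯, η T ≤ A * σ T ^ 5) (hηc : c * δ ^ 4 ≤ ∑ T ∈ 𝒯, η T) (hM : M ⊆ 𝒯)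
    (hmin : ∀ M' ⊆ 𝒯, θ * ∑ T ∈ 𝒯, η T ≤ ∑ T ∈ M', η T → M.card ≤ M'.card)
    (hθM : θ * ∑ T ∈ 𝒯, η T ≤ ∑ T ∈ M, η T)
    {c₄ c₃ : ℝ} (hc₄ : 0 < c₄) (hc₄' : A * c₄ ^ 4 ≤ c / 4) (hc₃ : 0 < c₃)
    (hc₃' : A * c₃ ^ 5 ≤ c / 4) (hc₃'' : 2 * A * c₃ ^ 5 < c * c₄ / 4)
    {T₁ T₂ : ι} (h₁ : T₁ ∈ M) (h₂ : T₂ ∈ M) (hs₁ : σ T₁ < c₃ * δ) (hs₂ : σ T₂ < c₃ * δ) :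
    T₁ = T₂ := by
  classical
  by_contra hne
  set S := ∑ T ∈ 𝒯, η T with hS
  have hS0 : 0 < S := lt_of_lt_of_le (by positivity) hηc
  have small : ∀ T ∈ M, σ T < c₃ * δ → η T ≤ A * c₃ ^ 5 * δ ^ 5 := by
    intro T hT hs
    refine (hηA T (hM hT)).trans ?_
    have := pow_le_pow_left₀ (hσ T (hM hT)) hs.le 5
    calc A * σ T ^ 5 ≤ A * (c₃ * δ) ^ 5 := by gcongr
      _ = _ := by ring
  have e₁ := small T₁ h₁ hs₁
  have e₂ := small T₂ h₂ hs₂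
  -- The steps below the size c₄δ contribute at most a quarter of the total, because ησ⁻¹ ≤ Aσ⁴ and
  -- the sizes sum to at most one.
  set B := 𝒯.filter fun T => c₄ * δ ≤ σ T with hB
  have hsmallsum : ∑ T ∈ 𝒯.filter (fun T => ¬ c₄ * δ ≤ σ T), η T ≤ S / 4 := by
    calc ∑ T ∈ 𝒯.filter (fun T => ¬ c₄ * δ ≤ σ T), η T
        ≤ ∑ T ∈ 𝒯.filter (fun T => ¬ c₄ * δ ≤ σ T), (c / 4 * δ ^ 4) * σ T := by
          refine Finset.sum_le_sum fun T hT => ?_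
          rw [Finset.mem_filter, not_le] at hT
          refine (hηA T hT.1).trans ?_
          have h4 := pow_le_pow_left₀ (hσ T hT.1) hT.2.le 4
          have h0 := hσ T hT.1
          calc A * σ T ^ 5 = A * σ T ^ 4 * σ T := by ring
            _ ≤ A * (c₄ * δ) ^ 4 * σ T := by gcongr
            _ = (A * c₄ ^ 4) * δ ^ 4 * σ T := by ring
            _ ≤ _ := by gcongr
      _ ≤ ∑ T ∈ 𝒯, (c / 4 * δ ^ 4) * σ T :=
          Finset.sum_le_sum_of_subset_of_nonneg (Finset.filter_subset _ _)
            fun T hT _ => mul_nonneg (by positivity) (hσ T hT)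
      _ = (c / 4 * δ ^ 4) * ∑ T ∈ 𝒯, σ T := by rw [Finset.mul_sum]
      _ ≤ (c / 4 * δ ^ 4) * 1 := by gcongr
      _ ≤ S / 4 := by linarith
  -- If the unmarked steps of B carry less than S/4, then M carries at least S/2. Dropping T₁ costs
  -- at most S/4, and what is left still satisfies the criterion because θ ≤ 1/4.
  by_cases hcase : ∑ T ∈ B \ M, η T < S / 4
  · have hsub : 𝒯 \ M ⊆ (B \ M) ∪ 𝒯.filter (fun T => ¬ c₄ * δ ≤ σ T) := by
      intro T hT
      rw [Finset.mem_sdiff] at hT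
      rw [Finset.mem_union, Finset.mem_sdiff, hB, Finset.mem_filter, Finset.mem_filter]
      tauto
    have h3 : ∑ T ∈ 𝒯 \ M, η T ≤ ∑ T ∈ B \ M, η T + S / 4 := by
      refine (Finset.sum_le_sum_of_subset_of_nonneg hsub ?_).trans ?_
      · intro T hT _
        rw [Finset.mem_union, Finset.mem_sdiff, hB, Finset.mem_filter, Finset.mem_filter] at hT
        exact hη T (by tauto)
      · refine le_trans ?_ (add_le_add_right hsmallsum _)
        rw [← Finset.sum_union_inter]
        refine le_add_of_nonneg_right (Finset.sum_nonneg fun T hT => ?_)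
        rw [Finset.mem_inter, Finset.mem_filter] at hT
        exact hη T hT.2.1
    have h4 : ∑ T ∈ 𝒯 \ M, η T + ∑ T ∈ M, η T = S := Finset.sum_sdiff hM
    have h5 : η T₁ + ∑ T ∈ M.erase T₁, η T = ∑ T ∈ M, η T := Finset.add_sum_erase _ _ h₁
    have h6 : A * c₃ ^ 5 * δ ^ 5 ≤ S / 4 := by
      have : δ ^ 5 ≤ δ ^ 4 := pow_le_pow_of_le_one hδ.le hδ1 (by norm_num)
      calc A * c₃ ^ 5 * δ ^ 5 ≤ c / 4 * δ ^ 4 := by gcongr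
        _ ≤ S / 4 := by linarith
    have h7 : θ * S ≤ 1 / 4 * S := by gcongr
    have := hmin (M.erase T₁) ((Finset.erase_subset _ _).trans hM) (by linarith)
    have := Finset.card_erase_lt_of_mem h₁
    omega
  · rw [not_lt] at hcase
    -- Otherwise S/4 is distributed over at most 1/(c₄δ) unmarked steps, so one of them has an
    -- indicator of order δ⁵ exceeding η(T₁) + η(T₂). Exchanging both for it makes the marked set
    -- smaller.
    obtain ⟨T₃, hT₃, hbig⟩ : ∃ T ∈ B \ M, η T₁ + η T₂ ≤ η T := by
      by_contra! hcon
      have hx : η T₁ + η T₂ ≤ 2 * A * c₃ ^ 5 * δ ^ 5 := by linarith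
      have h3 : ∑ T ∈ B \ M, η T * (c₄ * δ) ≤ ∑ T ∈ B \ M, (2 * A * c₃ ^ 5 * δ ^ 5) * σ T := by
        refine Finset.sum_le_sum fun T hT => ?_
        have hT' := hcon T hT
        rw [Finset.mem_sdiff, hB, Finset.mem_filter] at hT
        have := hη T hT.1.1
        have := hT.1.2
        exact mul_le_mul (by linarith) this (by positivity) (by positivity)
      rw [← Finset.sum_mul, ← Finset.mul_sum] at h3
      have h4 : ∑ T ∈ B \ M, σ T ≤ 1 := by
        refine (Finset.sum_le_sum_of_subset_of_nonneg
          (Finset.sdiff_subset.trans (Finset.filter_subset _ _)) fun T hT _ => hσ T hT).trans hσ1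
      have h5 : c * c₄ / 4 * δ ^ 5 ≤ 2 * A * c₃ ^ 5 * δ ^ 5 := by
        calc c * c₄ / 4 * δ ^ 5 = (c * δ ^ 4) / 4 * (c₄ * δ) := by ring
          _ ≤ S / 4 * (c₄ * δ) := by gcongr
          _ ≤ (∑ T ∈ B \ M, η T) * (c₄ * δ) := by gcongr
          _ ≤ _ := h3
          _ ≤ 2 * A * c₃ ^ 5 * δ ^ 5 * 1 := by gcongr
          _ = _ := by ring
      have := le_of_mul_le_mul_right h5 (by positivity)
      linarith
    rw [Finset.mem_sdiff, hB, Finset.mem_filter] at hT₃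
    have h₂' : T₂ ∈ M.erase T₁ := Finset.mem_erase.2 ⟨fun h => hne h.symm, h₂⟩
    have hT₃' : T₃ ∉ (M.erase T₁).erase T₂ := fun h =>
      hT₃.2 (Finset.mem_of_mem_erase (Finset.mem_of_mem_erase h))
    have := hmin (insert T₃ ((M.erase T₁).erase T₂)) (by
        intro T hT
        rcases Finset.mem_insert.1 hT with rfl | hT
        · exact hT₃.1.1
        · exact hM (Finset.mem_of_mem_erase (Finset.mem_of_mem_erase hT))) (by
        rw [Finset.sum_insert hT₃']
        have a := Finset.add_sum_erase _ η h₁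
        have b := Finset.add_sum_erase _ η h₂'
        linarith)
    rw [Finset.card_insert_of_notMem hT₃', Finset.card_erase_of_mem h₂',
      Finset.card_erase_of_mem h₁] at this
    have : 1 < M.card := Finset.one_lt_card.2 ⟨T₁, h₁, T₂, h₂, hne⟩
    omega

/-- A sequence of meshes produced by Dörfler marking for the indicators `η ℓ` and by the
refinement procedure. -/
structure IsDoerflerRun (θ : ℝ) (G : ℕ) (𝒯 : ℕ → TimeMesh) (η : ℕ → TimeStep → ℝ) : Prop where
  step : ∀ ℓ, ∃ (M : Finset TimeStep) (l : List TimeStep), M ⊆ 𝒯 ℓ ∧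
    θ * ∑ T ∈ 𝒯 ℓ, η ℓ T ≤ ∑ T ∈ M, η ℓ T ∧
    (∀ M' ⊆ 𝒯 ℓ, θ * ∑ T ∈ 𝒯 ℓ, η ℓ T ≤ ∑ T ∈ M', η ℓ T → M.card ≤ M'.card) ∧
    (∀ T, T ∈ l ↔ T ∈ M) ∧ TimeMesh.TrisectList G (𝒯 ℓ) l (𝒯 (ℓ + 1))

namespace IsDoerflerRun

variable {θ h : ℝ} {n G : ℕ} {𝒯 : ℕ → TimeMesh} {η : ℕ → TimeStep → ℝ}

theorem generated (H : IsDoerflerRun θ G 𝒯 η) (hh : 0 < h) (h0 : IsTriadic h n (𝒯 0)) (ℓ : ℕ) :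
    TimeMesh.GeneratedFrom (𝒯 0) (𝒯 ℓ) := by
  induction ℓ with
  | zero => exact .refl
  | succ ℓ ih =>
    obtain ⟨M, l, -, -, -, -, ht⟩ := H.step ℓ
    exact ih.trans (TrisectList.generated hh ht (h0.generated hh ih))

/-- By `TrisectList.exists_source` a new step is at least a third as long as some marked step, so an
iteration raises the maximal level by at most one. -/
theorem exists_node (H : IsDoerflerRun θ G 𝒯 η) (hh : 0 < h) (h0 : IsTriadic h n (𝒯 0))
    (h00 : ∀ T ∈ 𝒯 0, T.len = h) (ℓ : ℕ) :
    ∀ T ∈ 𝒯 ℓ, ∃ k ≤ ℓ, ∃ i, T = node h k i := by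
  induction ℓ with
  | zero =>
    intro T hT
    obtain ⟨k, i, rfl⟩ := h0.exists_node T hT
    have h1 := h00 _ hT
    rw [len_node, div_eq_iff (by positivity)] at h1
    refine ⟨k, ?_, i, rfl⟩
    by_contra hk
    have : (1 : ℝ) < 3 ^ k := one_lt_pow₀ (by norm_num) (by omega)
    nlinarith
  | succ ℓ ih =>
    intro T hT
    obtain ⟨M, l, hM, -, -, hl, ht⟩ := H.step ℓ
    by_cases hT' : T ∈ 𝒯 ℓ
    · obtain ⟨k, hk, i, e⟩ := ih T hT'
      exact ⟨k, by omega, i, e⟩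
    · have h𝒯 := h0.generated hh (H.generated hh h0 ℓ)
      obtain ⟨S, hS, hd⟩ := TrisectList.exists_source hh ht h𝒯 hT hT'
      obtain ⟨k, hk, i, rfl⟩ := ih S (hM ((hl S).1 hS))
      obtain ⟨k', i', rfl⟩ := (h𝒯.generated hh
        (TrisectList.generated hh ht h𝒯)).exists_node T hT
      refine ⟨k', ?_, i', rfl⟩
      have hd0 := TimeStep.dist_nonneg (node h k i) (node h k' i')
      rw [len_node, len_node] at hd
      by_contra hk'
      have h1 : (3 : ℝ) ^ (k + 2) ≤ 3 ^ k' := pow_le_pow_right₀ (by norm_num) (by omega)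
      have h2 : h / 3 ^ k' ≤ h / 3 ^ (k + 2) := by gcongr
      have h3 : h / 3 ^ (k + 2) = h / 3 ^ k / 9 := by field_simp; ring
      have h4 : 0 < h / 3 ^ k := by positivity
      have h5 : (0 : ℝ) < G + 3 := by positivity
      have h6 : ((G : ℝ) + 3) * (h / 3 ^ k) ≤ ((G : ℝ) + 3) * (3 * (h / 3 ^ k / 9)) := by
        nlinarith
      have := le_of_mul_le_mul_left h6 h5
      linarith

end IsDoerflerRun

set_option maxHeartbeats 1000000 in
/-- The optimal complexity of the algorithm for indicators that are locally bounded by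
`|T|⁵ (ω(T) + ν)`, where `ν` is the sum of `|T|⁵ ω(T)` and equivalent to the estimator. -/
theorem exists_card_pow_mul_le {n : ℕ} (hn : 1 ≤ n) (G : ℕ) {c C θ : ℝ} (hc : 0 < c) (hC : 0 < C)
    (hθ : 0 < θ) (hθ' : θ ≤ 1 / 4) :
    ∃ K > (0 : ℝ), ∀ (t : ℝ) (_ : 0 < t) (ω : TimeStep → ℝ) (_ : ∀ T, 0 ≤ ω T) (_ : ∀ T, ω T ≤ 1)
      (_ : ∀ 𝒮, TimeMesh.GeneratedFrom (TimeMesh.uniform t n) 𝒮 → ∀ T ∈ 𝒮, ∀ S ∈ T.children,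
        ω S = ω T)
      (𝒯 : ℕ → TimeMesh) (_ : 𝒯 0 = TimeMesh.uniform t n) (η : ℕ → TimeStep → ℝ)
      (_ : ∀ ℓ, ∀ T ∈ 𝒯 ℓ, 0 ≤ η ℓ T) (ν : ℕ → ℝ)
      (_ : ∀ ℓ, ν ℓ = ∑ T ∈ 𝒯 ℓ, (T.len / t) ^ 5 * ω T)
      (_ : ∀ ℓ, ∀ T ∈ 𝒯 ℓ, η ℓ T ≤ C * (T.len / t) ^ 5 * (ω T + ν ℓ))
      (_ : ∀ ℓ, c * ν ℓ ≤ ∑ T ∈ 𝒯 ℓ, η ℓ T) (_ : IsDoerflerRun θ G 𝒯 η) (ℓ : ℕ),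
      ν ℓ * ((𝒯 ℓ).card : ℝ) ^ 4 ≤ K := by
  classical
  -- c' is the share of ν that marking captures. The contraction factor is written as r⁴ because ν
  -- will be compared through its fourth root δ.
  obtain ⟨c', hc'0, hc'1, hc'⟩ : ∃ c' : ℝ, 0 < c' ∧ c' ≤ 1 ∧ C * c' ≤ θ * c := by
    refine ⟨min 1 (θ * c / C), lt_min one_pos (by positivity), min_le_left _ _, ?_⟩
    calc C * min 1 (θ * c / C) ≤ C * (θ * c / C) := by gcongr; exact min_le_right _ _
      _ = θ * c := by field_simp
  obtain ⟨r, hr0, hr1, hr⟩ : ∃ r : ℝ, 0 ≤ r ∧ r < 1 ∧ r ^ 4 = 1 - c' / 8 := by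
    have h0 : (0 : ℝ) ≤ 1 - c' / 8 := by linarith
    have e : √(√(1 - c' / 8)) ^ 4 = 1 - c' / 8 := by
      rw [show (4 : ℕ) = 2 * 2 by norm_num, pow_mul, Real.sq_sqrt (Real.sqrt_nonneg _),
        Real.sq_sqrt h0]
    refine ⟨√(√(1 - c' / 8)), Real.sqrt_nonneg _, ?_, e⟩
    by_contra hcon
    have := one_le_pow₀ (n := 4) (not_lt.1 hcon)
    rw [e] at this; linarith
  set A := 2 * C with hAdef
  have hA : 0 < A := by positivity
  obtain ⟨c₄, hc₄, hc₄'⟩ : ∃ c₄ : ℝ, 0 < c₄ ∧ A * c₄ ^ 4 ≤ c / 4 := by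
    have h0 : 0 < min 1 (c / (4 * A)) := lt_min one_pos (by positivity)
    refine ⟨min 1 (c / (4 * A)), h0, ?_⟩
    calc A * min 1 (c / (4 * A)) ^ 4 ≤ A * min 1 (c / (4 * A)) ^ 1 := by
          gcongr ?_ * ?_
          exact pow_le_pow_of_le_one h0.le (min_le_left _ _) (by norm_num)
      _ ≤ A * (c / (4 * A)) := by rw [pow_one]; gcongr; exact min_le_right _ _
      _ = c / 4 := by field_simp
  obtain ⟨c₃, hc₃, hc₃1, hc₃2⟩ : ∃ c₃ : ℝ, 0 < c₃ ∧ A * c₃ ^ 5 ≤ c / 4 ∧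
      2 * A * c₃ ^ 5 < c * c₄ / 4 := by
    set x := min 1 (min (c / (4 * A)) (c * c₄ / (16 * A))) with hx
    have h0 : 0 < x := lt_min one_pos (lt_min (by positivity) (by positivity))
    have h5 : x ^ 5 ≤ x := pow_le_of_le_one h0.le (min_le_left _ _) (by norm_num)
    have h1 : x ≤ c / (4 * A) := (min_le_right _ _).trans (min_le_left _ _)
    have h2 : x ≤ c * c₄ / (16 * A) := (min_le_right _ _).trans (min_le_right _ _)
    refine ⟨x, h0, ?_, ?_⟩
    · calc A * x ^ 5 ≤ A * (c / (4 * A)) := by gcongr; exact h5.trans h1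
        _ = c / 4 := by field_simp
    · calc 2 * A * x ^ 5 ≤ 2 * A * (c * c₄ / (16 * A)) := by gcongr; exact h5.trans h2
        _ = c * c₄ / 8 := by field_simp; norm_num
        _ < c * c₄ / 4 := by have : 0 < c * c₄ := by positivity
                             linarith
  obtain ⟨B, hB⟩ : ∃ B : ℝ, ∀ m : ℕ, (m : ℝ) ^ 2 * r ^ m ≤ B := by
    have := (tendsto_pow_const_mul_const_pow_of_abs_lt_one 2
      (by rwa [abs_of_nonneg hr0] : |r| < 1)).bddAbove_range
    obtain ⟨B, hB⟩ := this
    exact ⟨B, fun m => hB ⟨m, rfl⟩⟩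
  have hB0 : 0 ≤ B := by simpa using hB 0
  -- 3(G+3) is the distance factor in `TrisectList.exists_source`.
  set D : ℕ := 3 * G + 9 with hD
  set K₁ : ℝ := n + 2 * (2 * (2 * D + 5) * B) + 3 / c₃ with hK₁
  refine ⟨K₁ ^ 4, by positivity, ?_⟩
  intro t ht ω hω0 hω1 hωc 𝒯 h𝒯0 η hη0 ν hν hU hL H ℓ
  have hn' : (0 : ℝ) < n := by exact_mod_cast hn
  have hh : 0 < t / n := by positivity
  have tri0 : IsTriadic (t / n) n (𝒯 0) := h𝒯0 ▸ isTriadic_uniform ht hn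
  have gen := H.generated hh tri0
  have tri := fun j => tri0.generated hh (gen j)
  have lp : ∀ j, ∀ T ∈ 𝒯 j, 0 < T.len := fun j T hT => (tri j).len_pos hh hT
  have sumlen : ∀ j, ∑ T ∈ 𝒯 j, T.len / t = 1 := by
    intro j
    rw [tri0.sum_generated hh (gen j) (F := fun T => T.len / t), h𝒯0, sum_uniform ht hn]
    · simp only [TimeStep.len]
      have : ∀ i ∈ Finset.range n, (t / n * ((i : ℝ) + 1) - t / n * i) / t = 1 / n := by
        intro i _; field_simp; ring
      rw [Finset.sum_congr rfl this]; simp; field_simp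
    · intro 𝒮 hg T hT
      have := (tri0.generated hh hg).len_pos hh hT
      rw [IsTriadic.sum_children this]
      simp only [TimeStep.len]; ring
  have sc5 : ∀ 𝒮, TimeMesh.GeneratedFrom (𝒯 0) 𝒮 → ∀ T ∈ 𝒮, ∀ w : TimeStep → ℝ,
      (∀ S ∈ T.children, w S = w T) →
      ∑ S ∈ T.children, (S.len / t) ^ 5 * w S = (T.len / t) ^ 5 * w T / 81 := by
    intro 𝒮 hg T hT w hw
    have := (tri0.generated hh hg).len_pos hh hT
    have e : ∀ S ∈ T.children, (S.len / t) ^ 5 * w S = (T.len / 3 / t) ^ 5 * w T := by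
      intro S hS; rw [hw S hS, TimeStep.len_child hS]
    rw [Finset.sum_congr rfl e, IsTriadic.sum_children this]
    ring
  -- Companion of ν with weight one. The indicator bound contains ω + ν, so marking may reduce ν or
  -- only the mesh sizes; the product ν(1 + Dm) sees both effects.
  set Dm : ℕ → ℝ := fun j => ∑ T ∈ 𝒯 j, (T.len / t) ^ 5 * (1 : TimeStep → ℝ) T with hDm
  have σnn : ∀ j, ∀ T ∈ 𝒯 j, 0 ≤ T.len / t := fun j T hT => div_nonneg (lp j T hT).le ht.le
  have σ1 : ∀ j, ∀ T ∈ 𝒯 j, T.len / t ≤ 1 := fun j T hT => by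
    rw [← sumlen j]; exact Finset.single_le_sum (f := fun T => T.len / t) (σnn j) hT
  have σ5 : ∀ j, ∀ T ∈ 𝒯 j, (T.len / t) ^ 5 ≤ T.len / t := fun j T hT =>
    pow_le_of_le_one (σnn j T hT) (σ1 j T hT) (by norm_num)
  have Dm0 : ∀ j, 0 ≤ Dm j := fun j => Finset.sum_nonneg fun T hT => by
    have := σnn j T hT
    simp only [Pi.one_apply]; positivity
  have Dm1 : ∀ j, Dm j ≤ 1 := fun j => by
    rw [← sumlen j]
    exact Finset.sum_le_sum fun T hT => by simpa using σ5 j T hT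
  have ν0 : ∀ j, 0 ≤ ν j := fun j => by
    rw [hν]
    exact Finset.sum_nonneg fun T hT => mul_nonneg (pow_nonneg (σnn j T hT) _) (hω0 T)
  have ν1 : ∀ j, ν j ≤ 1 := fun j => by
    rw [hν, ← sumlen j]
    refine Finset.sum_le_sum fun T hT => ?_
    have h1 := σ5 j T hT
    have h2 := pow_nonneg (σnn j T hT) 5
    nlinarith [hω1 T, hω0 T]
  have step : ∀ j, ν (j + 1) ≤ ν j ∧
      ν (j + 1) * (1 + Dm (j + 1)) ≤ r ^ 4 * (ν j * (1 + Dm j)) := by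
    intro j
    obtain ⟨M, l, hM, hDo, -, hl, htri⟩ := H.step j
    have g := TrisectList.generated hh htri (tri j)
    have hM' : ∀ T ∈ M, T ∉ 𝒯 (j + 1) := fun T hT =>
      (tri (j + 1)).not_mem_of_wasSplit hh
        (TrisectList.wasSplit hh htri (tri j) ((hl T).2 hT) (Or.inl (hM hT)))
    -- The absolute value makes the function nonnegative on all pairs of reals, as
    -- `sum_generated_le` demands, without changing it on time steps.
    set F₁ : TimeStep → ℝ := fun T => (|T.len| / t) ^ 5 * ω T
    set F₂ : TimeStep → ℝ := fun T => (|T.len| / t) ^ 5 * (1 : TimeStep → ℝ) T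
    have abs_eq : ∀ 𝒮, TimeMesh.GeneratedFrom (𝒯 0) 𝒮 → ∀ T ∈ 𝒮, |T.len| = T.len :=
      fun 𝒮 hg T hT => abs_of_pos ((tri0.generated hh hg).len_pos hh hT)
    have abs_eq_child : ∀ 𝒮, TimeMesh.GeneratedFrom (𝒯 0) 𝒮 → ∀ T ∈ 𝒮, ∀ S ∈ T.children,
        |S.len| = S.len := fun 𝒮 hg T hT S hS => by
      rw [TimeStep.len_child hS]
      have := (tri0.generated hh hg).len_pos hh hT
      exact abs_of_pos (by positivity)
    have sumabs : ∀ i, ∀ w : TimeStep → ℝ, ∀ N ⊆ 𝒯 i,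
        ∑ T ∈ N, (|T.len| / t) ^ 5 * w T = ∑ T ∈ N, (T.len / t) ^ 5 * w T := fun i w N hN =>
      Finset.sum_congr rfl fun T hT => by rw [abs_eq _ (gen i) T (hN hT)]
    have gen_le : ∀ w : TimeStep → ℝ, (∀ T, 0 ≤ w T) →
        (∀ 𝒮, TimeMesh.GeneratedFrom (𝒯 0) 𝒮 → ∀ T ∈ 𝒮, ∀ S ∈ T.children, w S = w T) →
        ∑ T ∈ 𝒯 (j + 1), (T.len / t) ^ 5 * w T ≤
          ∑ T ∈ 𝒯 j, (T.len / t) ^ 5 * w T - 80 / 81 * ∑ T ∈ M, (T.len / t) ^ 5 * w T := by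
      intro w hw0 hw
      have := (tri j).sum_generated_le hh g (F := fun T => (|T.len| / t) ^ 5 * w T)
        (fun T => mul_nonneg (by positivity) (hw0 T)) (fun 𝒮 hg T hT => by
          have hg' := (gen j).trans hg
          rw [abs_eq 𝒮 hg' T hT, ← sc5 𝒮 hg' T hT w (hw 𝒮 hg' T hT)]
          exact Finset.sum_congr rfl fun S hS => by rw [abs_eq_child 𝒮 hg' T hT S hS]) hM hM'
      rwa [sumabs j w _ subset_rfl, sumabs (j + 1) w _ subset_rfl, sumabs j w _ hM] at this
    have i1 := gen_le ω hω0 (fun 𝒮 hg => hωc 𝒮 (h𝒯0 ▸ hg))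
    have i2 := gen_le 1 (fun _ => zero_le_one) (fun _ _ _ _ _ _ => rfl)
    rw [← hν, ← hν] at i1
    set a := ∑ T ∈ M, (T.len / t) ^ 5 * ω T with ha
    set b := ∑ T ∈ M, (T.len / t) ^ 5 * (1 : TimeStep → ℝ) T with hb
    change Dm (j + 1) ≤ Dm j - 80 / 81 * b at i2
    have ha0 : 0 ≤ a := Finset.sum_nonneg fun T hT =>
      mul_nonneg (pow_nonneg (σnn j T (hM hT)) _) (hω0 T)
    have hb0 : 0 ≤ b := Finset.sum_nonneg fun T hT =>
      mul_nonneg (pow_nonneg (σnn j T (hM hT)) _) zero_le_one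
    have haν : a ≤ ν j := by
      rw [hν]
      exact Finset.sum_le_sum_of_subset_of_nonneg hM fun T hT _ =>
        mul_nonneg (pow_nonneg (σnn j T hT) _) (hω0 T)
    -- Dörfler's criterion, with the lower bound of the total and the upper bound of the marked
    -- indicators inserted.
    have hab : c' * ν j ≤ a + ν j * b := by
      have h1 : ∑ T ∈ M, η j T ≤ C * (a + ν j * b) := by
        rw [ha, hb, Finset.mul_sum, ← Finset.sum_add_distrib, Finset.mul_sum]
        refine Finset.sum_le_sum fun T hT => (hU j T (hM hT)).trans (le_of_eq ?_)
        simp only [Pi.one_apply]; ring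
      have h2 : θ * (c * ν j) ≤ θ * ∑ T ∈ 𝒯 j, η j T := by gcongr; exact hL j
      have h3 : C * c' * ν j ≤ θ * c * ν j := mul_le_mul_of_nonneg_right hc' (ν0 j)
      have h4 : C * (c' * ν j) ≤ C * (a + ν j * b) := by linarith
      exact le_of_mul_le_mul_left h4 hC
    have d0 := Dm0 j
    have d1 := Dm1 j
    have d0' := Dm0 (j + 1)
    refine ⟨by linarith, ?_⟩
    rw [hr]
    have hbD : b ≤ Dm j := by
      refine Finset.sum_le_sum_of_subset_of_nonneg hM fun T hT _ =>
        mul_nonneg (pow_nonneg (σnn j T hT) _) zero_le_one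
    -- Splitting removes 80/81 of the marked fifth powers; a half suffices. The mixed term ab/4 is
    -- absorbed by νb/2, and Dm ≤ 1 turns the gain c'ν/4 into the factor 1 - c'/8.
    have e1 : ν (j + 1) * (1 + Dm (j + 1)) ≤ (ν j - a / 2) * (1 + Dm j - b / 2) :=
      mul_le_mul (by linarith) (by linarith) (by linarith) (by linarith)
    have e2 : a * b ≤ ν j * b := mul_le_mul_of_nonneg_right haν hb0
    have e3 : 0 ≤ a * Dm j := mul_nonneg ha0 d0
    have e4 : c' * ν j * Dm j ≤ c' * ν j * 1 :=
      mul_le_mul_of_nonneg_left d1 (mul_nonneg hc'0.le (ν0 j))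
    nlinarith
  have anti : Antitone ν := antitone_nat_of_succ_le fun j => (step j).1
  have geo : ν ℓ * (1 + Dm ℓ) ≤ (r ^ 4) ^ ℓ * (ν 0 * (1 + Dm 0)) := by
    have : ∀ m, ν m * (1 + Dm m) ≤ (r ^ 4) ^ m * (ν 0 * (1 + Dm 0)) := by
      intro m
      induction m with
      | zero => simp
      | succ m ih =>
        refine (step m).2.trans ?_
        rw [pow_succ' (r ^ 4), mul_assoc]
        exact mul_le_mul_of_nonneg_left ih (by positivity)
    exact this ℓ
  rcases (ν0 ℓ).eq_or_lt with hz | hνpos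
  · rw [← hz, zero_mul]; positivity
  -- δ = ν_ℓ^{1/4} is the size scale of the final mesh and stays fixed while all earlier iterations
  -- are inspected.
  set δ := √(√(ν ℓ)) with hδ
  have hδ0 : 0 < δ := Real.sqrt_pos.2 (Real.sqrt_pos.2 hνpos)
  have hδ4 : δ ^ 4 = ν ℓ := by
    rw [hδ, show (4 : ℕ) = 2 * 2 by norm_num, pow_mul, Real.sq_sqrt (Real.sqrt_nonneg _),
      Real.sq_sqrt (ν0 ℓ)]
  have hδ1 : δ ≤ 1 := by
    rw [hδ]; exact Real.sqrt_le_one.2 (Real.sqrt_le_one.2 (ν1 ℓ))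
  have hδr : δ ≤ 2 * r ^ ℓ := by
    refine le_of_pow_le_pow_left₀ (n := 4) (by norm_num) (by positivity) ?_
    have h1 : ν ℓ ≤ (r ^ 4) ^ ℓ * 2 := by
      calc ν ℓ ≤ ν ℓ * (1 + Dm ℓ) := le_mul_of_one_le_right (ν0 ℓ) (by linarith [Dm0 ℓ])
        _ ≤ (r ^ 4) ^ ℓ * (ν 0 * (1 + Dm 0)) := geo
        _ ≤ (r ^ 4) ^ ℓ * 2 := by
          gcongr
          nlinarith [ν1 0, ν0 0, Dm1 0, Dm0 0]
    have h2 : (2 * r ^ ℓ) ^ 4 = (r ^ 4) ^ ℓ * 16 := by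
      rw [mul_pow, ← pow_mul, ← pow_mul, mul_comm ℓ 4]; ring
    rw [hδ4, h2]
    have : (0 : ℝ) ≤ (r ^ 4) ^ ℓ := by positivity
    linarith
  -- A step created in the run is at least a third as long as its source, so one shorter than ε t
  -- comes from a marked step shorter than c₃δ t.
  set ε := c₃ * δ / 3 with hε
  have hε0 : 0 < ε := by positivity
  have h00 : ∀ T ∈ 𝒯 0, T.len = t / n := by
    intro T hT
    rw [h𝒯0] at hT
    simp only [TimeMesh.uniform, Finset.mem_image] at hT
    obtain ⟨i, -, rfl⟩ := hT
    simp only [TimeStep.len]; ring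
  -- Steps below the threshold can only be added near the single short marked step of each
  -- iteration. Iteration j has levels at most j, so it adds at most (j+2)(2D+5) of them.
  have small : ∀ j ≤ ℓ, (((𝒯 j).filter fun T => T.len / t < ε).card : ℕ) ≤
      n + j * ((j + 1) * (2 * D + 5)) := by
    intro j
    induction j with
    | zero =>
      intro _
      refine (Finset.card_filter_le _ _).trans ?_
      rw [h𝒯0]
      refine Finset.card_image_le.trans ?_
      simp
    | succ j ih =>
      intro hj
      have ih := ih (by omega)
      obtain ⟨M, l, hM, hDo, hmin, hl, htri⟩ := H.step j
      set N := (𝒯 (j + 1) \ 𝒯 j).filter fun T => T.len / t < ε with hN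
      have hsub : ((𝒯 (j + 1)).filter fun T => T.len / t < ε) ⊆
          ((𝒯 j).filter fun T => T.len / t < ε) ∪ N := by
        intro T
        simp only [hN, Finset.mem_union, Finset.mem_filter, Finset.mem_sdiff]
        tauto
      have src : ∀ T ∈ N, ∃ S ∈ M, S.dist T + (G + 3) * S.len ≤ 3 * (G + 3) * T.len ∧
          S.len / t < c₃ * δ ∧ S.len ≤ 3 * T.len := by
        intro T hT
        rw [hN, Finset.mem_filter, Finset.mem_sdiff] at hT
        obtain ⟨S, hS, hd⟩ := TrisectList.exists_source hh htri (tri j) hT.1.1 hT.1.2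
        have hG : (0 : ℝ) < G + 3 := by positivity
        have h1 : S.len ≤ 3 * T.len := by
          have : ((G : ℝ) + 3) * S.len ≤ (G + 3) * (3 * T.len) := by
            linarith [TimeStep.dist_nonneg S T]
          exact le_of_mul_le_mul_left this hG
        refine ⟨S, (hl S).1 hS, hd, ?_, h1⟩
        have h2 := hT.2
        rw [div_lt_iff₀ ht] at h2 ⊢
        rw [hε] at h2
        linarith
      have hNcard : N.card ≤ (j + 2) * (2 * D + 5) := by
        rcases N.eq_empty_or_nonempty with hNe | ⟨T₀, hT₀⟩
        · rw [hNe]; simp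
        obtain ⟨S, hS, -, hs, -⟩ := src T₀ hT₀
        -- The scale δ of iteration ℓ is legitimate at the earlier iteration j because ν is
        -- decreasing.
        have uniq : ∀ S' ∈ M, S'.len / t < c₃ * δ → S' = S := fun S' hS' hs' =>
          marked_small_unique (σ := fun T => T.len / t) hA hc hδ0 hδ1 hθ' (σnn j) (sumlen j).le
            (hη0 j) (fun T hT => by
              refine (hU j T hT).trans ?_
              have := pow_nonneg (σnn j T hT) 5
              calc C * (T.len / t) ^ 5 * (ω T + ν j) ≤ C * (T.len / t) ^ 5 * 2 := by
                    gcongr; linarith [hω1 T, ν1 j]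
                _ = _ := by rw [hAdef]; ring)
            (le_trans (by rw [hδ4]; gcongr; exact anti (by omega)) (hL j)) hM hmin hDo hc₄ hc₄'
            hc₃ hc₃1 hc₃2 hS' hS hs' hs
        obtain ⟨k, hk, i, rfl⟩ := H.exists_node hh tri0 h00 j S (hM hS)
        refine (card_le_of_dist_le hh (tri (j + 1)) (D := D) (k := k) (i := i)
          (F := N) ?_ ?_ ?_).trans ?_
        · exact (Finset.filter_subset _ _).trans Finset.sdiff_subset
        · intro T hT
          obtain ⟨S', hS', -, hs', h3⟩ := src T hT
          rwa [uniq S' hS' hs'] at h3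
        · intro T hT
          obtain ⟨S', hS', hd, hs', -⟩ := src T hT
          rw [uniq S' hS' hs'] at hd
          have := lp j _ (hM hS)
          have : ((D : ℕ) : ℝ) = 3 * (G + 3) := by rw [hD]; push_cast; ring
          rw [this]
          have : (0 : ℝ) ≤ (G + 3) * (node (t / n) k i).len := by positivity
          linarith
        · gcongr
      calc _ ≤ _ := Finset.card_le_card hsub
        _ ≤ _ := Finset.card_union_le _ _
        _ ≤ n + j * ((j + 1) * (2 * D + 5)) + (j + 2) * (2 * D + 5) := by omega
        _ ≤ n + (j + 1) * ((j + 1 + 1) * (2 * D + 5)) := by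
          have : j * ((j + 1) * (2 * D + 5)) ≤ j * ((j + 2) * (2 * D + 5)) := by gcongr; omega
          linarith [this, (by ring : n + (j + 1) * ((j + 1 + 1) * (2 * D + 5)) =
            n + j * ((j + 2) * (2 * D + 5)) + (j + 2) * (2 * D + 5))]
  have big : (((𝒯 ℓ).filter fun T => ¬ T.len / t < ε).card : ℝ) * ε ≤ 1 := by
    rw [← sumlen ℓ]
    calc (((𝒯 ℓ).filter fun T => ¬ T.len / t < ε).card : ℝ) * ε
        = ∑ T ∈ (𝒯 ℓ).filter (fun T => ¬ T.len / t < ε), ε := by simp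
      _ ≤ ∑ T ∈ (𝒯 ℓ).filter (fun T => ¬ T.len / t < ε), T.len / t :=
          Finset.sum_le_sum fun T hT => not_lt.1 (Finset.mem_filter.1 hT).2
      _ ≤ _ := Finset.sum_le_sum_of_subset_of_nonneg (Finset.filter_subset _ _)
          fun T hT _ => σnn ℓ T hT
  have split := Finset.card_filter_add_card_filter_not (s := 𝒯 ℓ) fun T => T.len / t < ε
  -- Long steps: at most 1/ε, a multiple of 1/δ. Short steps: δ ≤ 2rˡ with l = ℓ, and ℓ² times this
  -- power of r is bounded by `B`.
  have hcard : δ * ((𝒯 ℓ).card : ℝ) ≤ K₁ := by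
    have s1 := small ℓ le_rfl
    have s1' : (((𝒯 ℓ).filter fun T => T.len / t < ε).card : ℝ) ≤
        n + ℓ * ((ℓ + 1) * (2 * D + 5)) := by exact_mod_cast s1
    have s2 : ((𝒯 ℓ).card : ℝ) = ((𝒯 ℓ).filter fun T => T.len / t < ε).card +
        ((𝒯 ℓ).filter fun T => ¬ T.len / t < ε).card := by exact_mod_cast split.symm
    rw [s2, mul_add]
    have b1 : δ * ((𝒯 ℓ).filter fun T => ¬ T.len / t < ε).card ≤ 3 / c₃ := by
      rw [le_div_iff₀ hc₃]
      rw [hε] at big ⊢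
      linarith
    have b2 : (ℓ : ℝ) * (ℓ + 1) ≤ 2 * ℓ ^ 2 := by
      rcases Nat.eq_zero_or_pos ℓ with h | h
      · rw [h]; norm_num
      · have : (1 : ℝ) ≤ ℓ := by exact_mod_cast h
        nlinarith
    have b3 : δ * (((𝒯 ℓ).filter fun T => T.len / t < ε).card : ℝ) ≤
        n + 2 * (2 * (2 * D + 5) * B) := by
      calc δ * (((𝒯 ℓ).filter fun T => T.len / t < ε).card : ℝ)
          ≤ δ * (n + ℓ * ((ℓ + 1) * (2 * D + 5))) := by gcongr
        _ = δ * n + δ * (2 * D + 5) * (ℓ * (ℓ + 1)) := by ring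
        _ ≤ 1 * n + (2 * r ^ ℓ) * (2 * D + 5) * (2 * ℓ ^ 2) := by gcongr
        _ = n + 2 * (2 * (2 * D + 5) * (ℓ ^ 2 * r ^ ℓ)) := by ring
        _ ≤ _ := by gcongr; exact hB ℓ
    rw [hK₁]; linarith
  calc ν ℓ * ((𝒯 ℓ).card : ℝ) ^ 4 = (δ * ((𝒯 ℓ).card : ℝ)) ^ 4 := by rw [mul_pow, hδ4]
    _ ≤ K₁ ^ 4 := by gcongr

end AdaptiveRadau

end

/-! ### The Galerkin problem as an equation in the dual space -/

noncomputable section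

namespace AdaptiveRadau

/-- Definiteness gives injectivity, and the Riesz isomorphism identifies the dual with W, where
finite dimension gives surjectivity. It is applied to both the H-inner product and A. -/
theorem bijective_of_definite {W : Type*} [NormedAddCommGroup W] [InnerProductSpace ℝ W]
    [FiniteDimensional ℝ W] (J : W →ₗ[ℝ] (W →L[ℝ] ℝ)) (hJ : ∀ v, J v v = 0 → v = 0) :
    Function.Bijective J := by
  have := FiniteDimensional.complete ℝ W
  set R := (InnerProductSpace.toDual ℝ W).toLinearEquiv
  have hinj : Function.Injective J := by
    rw [injective_iff_map_eq_zero]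
    intro v hv
    exact hJ v (by rw [hv]; rfl)
  refine ⟨hinj, ?_⟩
  have h1 : Function.Injective (R.symm.toLinearMap ∘ₗ J) := R.symm.injective.comp hinj
  have h2 : Function.Surjective (R.symm.toLinearMap ∘ₗ J) := LinearMap.injective_iff_surjective.1 h1
  intro x
  obtain ⟨v, hv⟩ := h2 (R.symm x)
  exact ⟨v, R.symm.injective hv⟩

variable {V H : Type*} [NormedAddCommGroup V] [InnerProductSpace ℝ V]
  [NormedAddCommGroup H] [InnerProductSpace ℝ H]

/-- The dual space of a subspace `W` of `V`, with the dual norm. -/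
def SubDual (W : Submodule ℝ V) : Type _ := W →L[ℝ] ℝ

instance (W : Submodule ℝ V) : NormedAddCommGroup (SubDual W) :=
  inferInstanceAs (NormedAddCommGroup (W →L[ℝ] ℝ))

instance (W : Submodule ℝ V) : NormedSpace ℝ (SubDual W) :=
  inferInstanceAs (NormedSpace ℝ (W →L[ℝ] ℝ))

instance [FiniteDimensional ℝ V] (W : Submodule ℝ V) : FiniteDimensional ℝ (SubDual W) :=
  inferInstanceAs (FiniteDimensional ℝ (W →L[ℝ] ℝ))

/-- Evaluation of a functional on `W`. -/
def SubDual.eval {W : Submodule ℝ V} (v : W) : SubDual W →ₗ[ℝ] ℝ where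
  toFun x := (show W →L[ℝ] ℝ from x) v
  map_add' _ _ := rfl
  map_smul' _ _ := rfl

theorem SubDual.ext {W : Submodule ℝ V} {x y : SubDual W}
    (h : ∀ v : W, SubDual.eval v x = SubDual.eval v y) : x = y :=
  ContinuousLinearMap.ext (f := (show W →L[ℝ] ℝ from x)) (g := (show W →L[ℝ] ℝ from y)) h

theorem SubDual.eval_le {W : Submodule ℝ V} (v : W) (x : SubDual W) :
    SubDual.eval v x ≤ ‖x‖ * ‖(v : V)‖ :=
  (le_abs_self _).trans (ContinuousLinearMap.le_opNorm (show W →L[ℝ] ℝ from x) v)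

theorem SubDual.norm_le {W : Submodule ℝ V} {x : SubDual W} {M : ℝ} (hM : 0 ≤ M)
    (h : ∀ v : W, |SubDual.eval v x| ≤ M * ‖(v : V)‖) : ‖x‖ ≤ M :=
  ContinuousLinearMap.opNorm_le_bound (show W →L[ℝ] ℝ from x) hM h

/-- Restriction of functionals on `V` to a subspace. -/
def restr (W : Submodule ℝ V) : (V →L[ℝ] ℝ) →L[ℝ] SubDual W :=
  (ContinuousLinearMap.compL ℝ W V ℝ).flip W.subtypeL

@[simp] theorem eval_restr (W : Submodule ℝ V) (φ : V →L[ℝ] ℝ) (v : W) :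
    SubDual.eval v (restr W φ) = φ v := rfl

theorem dualNorm_eq (W : Submodule ℝ V) (φ : V →L[ℝ] ℝ) :
    ParabolicProblem.dualNorm W φ = ‖restr W φ‖ := rfl

namespace ParabolicProblem

variable (P : ParabolicProblem V H)

/-- The embedding `V → V*` of the Gelfand triple as a continuous linear map. -/
def toDualL : V →L[ℝ] (V →L[ℝ] ℝ) :=
  (((ContinuousLinearMap.compL ℝ V H ℝ).flip P.ι).comp (innerSL ℝ)).comp P.ι

theorem toDual_eq (v : V) : P.toDual v = P.toDualL v := rfl

theorem toDualL_apply (v w : V) : P.toDualL v w = inner ℝ (P.ι v) (P.ι w) := rfl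

theorem toDualL_self (v : V) : P.toDualL v v = ‖P.ι v‖ ^ 2 := by
  rw [toDualL_apply, real_inner_self_eq_norm_sq]

theorem toDualL_comm (v w : V) : P.toDualL v w = P.toDualL w v := by
  rw [toDualL_apply, toDualL_apply, real_inner_comm]

theorem eq_zero_of_toDualL_self {v : V} (hv : P.toDualL v v = 0) : v = 0 := by
  rw [toDualL_self, sq_eq_zero_iff, norm_eq_zero] at hv
  exact P.ι_injective (by rw [hv, map_zero])

theorem norm_restr_A_le {α β : ℝ} (hP : P.IsElliptic α β) (hβ : 0 ≤ β) (W : Submodule ℝ V)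
    (v : V) : ‖restr W (P.A v)‖ ≤ β * ‖v‖ :=
  SubDual.norm_le (by positivity) fun w => hP.2 v w

section

variable [FiniteDimensional ℝ V]

/-- The operator `A` of the Galerkin problem on `W`, as an operator in `W*`. -/
theorem exists_operator {α β L : ℝ} (hα : 0 < α) (hβ : 0 < β) (hP : P.IsElliptic α β) (hL : 0 ≤ L)
    (W : Submodule ℝ V) (hW : ∀ v ∈ W, P.tEnd * ‖v‖ ^ 2 ≤ L * ‖P.ι v‖ ^ 2) :
    ∃ B : SubDual W →L[ℝ] SubDual W,
      (∀ v ∈ W, B (restr W (P.toDualL v)) = restr W (P.A v)) ∧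
      (∀ x, ‖B x‖ ≤ β * L / P.tEnd * ‖x‖) ∧
      ∀ x, ∀ h : ℝ, 0 ≤ h → ‖x‖ ≤ β / α * ‖x + (2 / 3 * h) • B x + (h ^ 2 / 6) • B (B x)‖ := by
  have ht := P.tEnd_pos
  set J : W →ₗ[ℝ] SubDual W := ((restr W).comp (P.toDualL.comp W.subtypeL)).toLinearMap with hJ
  set a : W →ₗ[ℝ] SubDual W := ((restr W).comp (P.A.comp W.subtypeL)).toLinearMap with ha
  have hJapp : ∀ v w : W, SubDual.eval w (J v) = P.toDualL v w := fun _ _ => rfl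
  have haapp : ∀ v w : W, SubDual.eval w (a v) = P.A v w := fun _ _ => rfl
  have hJb : Function.Bijective J := bijective_of_definite J fun v hv =>
    Subtype.ext (P.eq_zero_of_toDualL_self hv)
  have hab : Function.Bijective a := bijective_of_definite a fun v hv => by
    have h1 := hP.1 v
    change P.A v v = 0 at hv
    rw [hv] at h1
    have : ‖(v : V)‖ ^ 2 ≤ 0 := by nlinarith [sq_nonneg ‖(v : V)‖]
    have h2 : ‖(v : V)‖ = 0 := by nlinarith [norm_nonneg (v : V)]
    exact Subtype.ext (norm_eq_zero.1 h2)
  -- B = A J⁻¹, where J embeds W into W* through H. Thus the equation for u becomes one for y = J u.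
  set Je := LinearEquiv.ofBijective J hJb with hJe
  set B := LinearMap.toContinuousLinearMap (a ∘ₗ Je.symm.toLinearMap) with hB
  have hBJ : ∀ v : W, B (J v) = a v := by
    intro v
    have : Je.symm (J v) = v := Je.symm_apply_apply v
    change a (Je.symm (J v)) = a v
    rw [this]
  -- The inverse inequality `hW` bounds J⁻¹, and this is the only place where it enters.
  have normJ : ∀ v : W, ‖(v : V)‖ ≤ L / P.tEnd * ‖J v‖ := by
    intro v
    have h1 : ‖P.ι v‖ ^ 2 ≤ ‖J v‖ * ‖(v : V)‖ := by
      rw [← P.toDualL_self, ← hJapp]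
      exact SubDual.eval_le v (J v)
    have h2 := hW v v.2
    rcases (norm_nonneg (v : V)).eq_or_lt with h0 | h0
    · rw [← h0]; positivity
    · rw [div_mul_eq_mul_div, le_div_iff₀ ht]
      have : (‖(v : V)‖ * P.tEnd) * ‖(v : V)‖ ≤ (L * ‖J v‖) * ‖(v : V)‖ := by nlinarith
      exact le_of_mul_le_mul_right this h0
  have norma : ∀ v : W, ‖a v‖ ≤ β * ‖(v : V)‖ := fun v => P.norm_restr_A_le hP hβ.le W v
  refine ⟨B, fun v hv => hBJ ⟨v, hv⟩, ?_, ?_⟩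
  · intro x
    obtain ⟨v, rfl⟩ := hJb.2 x
    rw [hBJ]
    calc ‖a v‖ ≤ β * ‖(v : V)‖ := norma v
      _ ≤ β * (L / P.tEnd * ‖J v‖) := by gcongr; exact normJ v
      _ = _ := by ring
  · intro x h hh
    -- Test with p = A⁻¹x: the first term is coercive, and Bx and B²x contribute ‖J⁻¹x‖²_H and ⟨A
    -- J⁻¹x, J⁻¹x⟩, both nonnegative. The polynomial 1 + 2z/3 + z²/6 is the denominator of the
    -- two-stage Radau IIA stability function at -z.
    obtain ⟨p, hp⟩ := hab.2 x
    obtain ⟨v, hv⟩ := hJb.2 x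
    obtain ⟨q, hq⟩ := hJb.2 (a v)
    have e1 : B x = a v := by rw [← hv, hBJ]
    have e2 : B (B x) = a q := by rw [e1, ← hq, hBJ]
    set y := x + (2 / 3 * h) • B x + (h ^ 2 / 6) • B (B x) with hy
    have p1 : α * ‖(p : V)‖ ^ 2 ≤ SubDual.eval p x := by rw [← hp]; exact hP.1 p
    have p2 : 0 ≤ SubDual.eval p (B x) := by
      rw [e1, haapp, P.A_symm, ← haapp, hp, ← hv, hJapp, P.toDualL_self]; positivity
    have p3 : 0 ≤ SubDual.eval p (B (B x)) := by
      rw [e2, haapp, P.A_symm, ← haapp, hp, ← hv, hJapp, P.toDualL_comm, ← hJapp, hq, haapp]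
      exact le_trans (by positivity) (hP.1 v)
    have p4 : α * ‖(p : V)‖ ^ 2 ≤ ‖y‖ * ‖(p : V)‖ := by
      refine le_trans ?_ (SubDual.eval_le p y)
      rw [hy]
      simp only [map_add, map_smul, smul_eq_mul]
      have : 0 ≤ 2 / 3 * h * SubDual.eval p (B x) := by positivity
      have : 0 ≤ h ^ 2 / 6 * SubDual.eval p (B (B x)) := by positivity
      linarith
    have p5 : α * ‖(p : V)‖ ≤ ‖y‖ := by
      rcases (norm_nonneg (p : V)).eq_or_lt with h0 | h0
      · rw [← h0, mul_zero]; exact norm_nonneg y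
      · refine le_of_mul_le_mul_right ?_ h0
        rw [pow_two] at p4; linarith
    calc ‖x‖ ≤ β * ‖(p : V)‖ := by rw [← hp]; exact norma p
      _ = β / α * (α * ‖(p : V)‖) := by field_simp
      _ ≤ β / α * ‖y‖ := by gcongr

/-- Solutions are continuously differentiable and satisfy the equation everywhere. -/
theorem IsSolution.exists_deriv {P : ParabolicProblem V H} {W : Submodule ℝ V} {u : ℝ → V}
    (hu : P.IsSolution W u) (hf : ContinuousOn P.f (Icc 0 P.tEnd)) :
    ∃ u' : ℝ → V, ContinuousOn u (Icc 0 P.tEnd) ∧ ContinuousOn u' (Icc 0 P.tEnd) ∧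
      (∀ s ∈ Ioo 0 P.tEnd, HasDerivAt u (u' s) s) ∧ (∀ s, u' s ∈ W) ∧
      ∀ s, ∀ v ∈ W, P.toDualL (u' s) v + P.A (u s) v = P.f s v := by
  have := FiniteDimensional.complete ℝ V
  have ht := P.tEnd_pos
  set J : W →ₗ[ℝ] SubDual W := ((restr W).comp (P.toDualL.comp W.subtypeL)).toLinearMap with hJ
  have hJapp : ∀ v w : W, SubDual.eval w (J v) = P.toDualL v w := fun _ _ => rfl
  have hJb : Function.Bijective J := bijective_of_definite J fun v hv =>
    Subtype.ext (P.eq_zero_of_toDualL_self hv)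
  set Je := LinearEquiv.ofBijective J hJb with hJe
  set S : (V →L[ℝ] ℝ) →L[ℝ] V := W.subtypeL.comp
    ((LinearMap.toContinuousLinearMap Je.symm.toLinearMap).comp (restr W)) with hS
  have hSW : ∀ φ, S φ ∈ W := fun φ => (Je.symm (restr W φ)).2
  have hSφ : ∀ φ, ∀ v ∈ W, P.toDualL (S φ) v = φ v := by
    intro φ v hv
    have : J (Je.symm (restr W φ)) = restr W φ := Je.apply_symm_apply _
    exact congrArg (SubDual.eval ⟨v, hv⟩) this
  have hint : IntegrableOn (deriv u) (Icc 0 P.tEnd) := hu.memH1.1.integrable (by norm_num)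
  have hint' : IntervalIntegrable (deriv u) volume 0 P.tEnd := by
    rw [intervalIntegrable_iff_integrableOn_Icc_of_le ht.le]; exact hint
  have hcu : ContinuousOn u (Icc 0 P.tEnd) := by
    have h1 : ContinuousOn (fun r => u 0 + ∫ q in 0..r, deriv u q) (Icc 0 P.tEnd) := by
      refine continuousOn_const.add ?_
      have := intervalIntegral.continuousOn_primitive_interval (a := 0) (b := P.tEnd)
        (f := deriv u) (μ := volume) (by rwa [uIcc_of_le ht.le])
      rwa [uIcc_of_le ht.le] at this
    exact h1.congr hu.memH1.2
  -- The equation itself defines a continuous candidate for the derivative; it remains to see that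
  -- `deriv u` agrees with it almost everywhere.
  set u' : ℝ → V := fun s => S (P.f s - P.A (u s)) with hu'
  have hcu' : ContinuousOn u' (Icc 0 P.tEnd) :=
    S.continuous.comp_continuousOn (hf.sub (P.A.continuous.comp_continuousOn hcu))
  have heq : ∀ s, ∀ v ∈ W, P.toDualL (u' s) v + P.A (u s) v = P.f s v := by
    intro s v hv
    rw [hu', hSφ _ v hv]; simp
  have hae : ∀ᵐ s ∂(volume.restrict (Icc 0 P.tEnd)), deriv u s = u' s := by
    have hne : ∀ᵐ s ∂(volume.restrict (Icc 0 P.tEnd)), s ≠ 0 ∧ s ≠ P.tEnd := by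
      refine ae_restrict_of_ae ?_
      exact (Measure.ae_ne volume 0).and (Measure.ae_ne volume _)
    filter_upwards [hu.eqn, hne, ae_restrict_mem measurableSet_Icc] with s h1 h2 h3
    have hs : s ∈ Ioo 0 P.tEnd := ⟨lt_of_le_of_ne h3.1 h2.1.symm, lt_of_le_of_ne h3.2 h2.2⟩
    -- The equation determines the derivative only when tested in W, so its membership in W is
    -- needed. It is a limit of difference quotients, or zero by convention.
    have hmem : deriv u s ∈ W := by
      by_cases hd : DifferentiableAt ℝ u s
      · have hcl : IsClosed (W : Set V) := W.closed_of_finiteDimensional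
        have h4 := hd.hasDerivAt.tendsto_slope
        refine hcl.mem_of_tendsto h4 ?_
        have h5 : ∀ᶠ r in nhdsWithin s {s}ᶜ, r ∈ Icc 0 P.tEnd :=
          nhdsWithin_le_nhds (Icc_mem_nhds hs.1 hs.2)
        filter_upwards [h5] with r hr
        rw [slope_def_module]
        exact W.smul_mem _ (W.sub_mem (hu.mem r hr) (hu.mem s h3))
      · rw [deriv_zero_of_not_differentiableAt hd]; exact W.zero_mem
    have hdiff : deriv u s - u' s ∈ W := W.sub_mem hmem (hSW _)
    have h6 : P.toDualL (deriv u s - u' s) (deriv u s - u' s) = 0 := by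
      have a1 := h1 _ hdiff
      have a2 := heq s _ hdiff
      rw [toDual_eq] at a1
      have : P.toDualL (deriv u s - u' s) (deriv u s - u' s) =
          P.toDualL (deriv u s) (deriv u s - u' s) - P.toDualL (u' s) (deriv u s - u' s) := by
        rw [P.toDualL.map_sub]; rfl
      rw [this]; linarith
    exact sub_eq_zero.1 (P.eq_zero_of_toDualL_self h6)
  refine ⟨u', hcu, hcu', ?_, fun s => hSW _, heq⟩
  intro s hs
  -- Constant extension beyond the interval provides a globally continuous integrand for the
  -- fundamental theorem.
  set g : ℝ → V := IccExtend ht.le ((Icc 0 P.tEnd).domRestrict u') with hg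
  have hgc : Continuous g := (continuousOn_iff_continuous_domRestrict.1 hcu').Icc_extend'
  have hgu : ∀ r ∈ Icc 0 P.tEnd, g r = u' r := fun r hr => by
    rw [hg, IccExtend_of_mem ht.le _ hr]; rfl
  have hd : HasDerivAt (fun r => u 0 + ∫ q in 0..r, g q) (g s) s :=
    (intervalIntegral.integral_hasDerivAt_right (hgc.intervalIntegrable _ _)
      hgc.stronglyMeasurable.stronglyMeasurableAtFilter hgc.continuousAt).const_add _
  rw [hgu s ⟨hs.1.le, hs.2.le⟩] at hd
  refine hd.congr_of_eventuallyEq ?_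
  filter_upwards [Ioo_mem_nhds hs.1 hs.2] with r hr
  rw [hu.memH1.2 r ⟨hr.1.le, hr.2.le⟩]
  congr 1
  refine intervalIntegral.integral_congr_ae_restrict ?_
  rw [uIoc_of_le hr.1.le]
  have hsub : Ioc 0 r ⊆ Icc 0 P.tEnd := fun q hq => ⟨hq.1.le, hq.2.trans hr.2.le⟩
  filter_upwards [ae_restrict_of_ae_restrict_of_subset hsub hae,
    ae_restrict_mem measurableSet_Ioc] with q h1 h2
  rw [h1, hgu q (hsub h2)]

end

end ParabolicProblem

end AdaptiveRadau

end

/-! ### Grönwall estimates, quadratic polynomials and affine approximation -/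

noncomputable section

namespace AdaptiveRadau

section Calculus

variable {E : Type*} [NormedAddCommGroup E] [NormedSpace ℝ E]

/-- This is e^z - 1 ≤ z e^z with z = Kx. The resulting form has no division by K and composes well
over consecutive time steps. -/
theorem gronwallBound_le {δ K ε x : ℝ} (hK : 0 ≤ K) (hε : 0 ≤ ε) :
    gronwallBound δ K ε x ≤ Real.exp (K * x) * (δ + ε * x) := by
  rcases hK.eq_or_lt with rfl | hK
  · rw [gronwallBound_K0]; simp
  · rw [gronwallBound_of_K_ne_0 hK.ne']
    have h1 : Real.exp (K * x) - 1 ≤ K * x * Real.exp (K * x) := by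
      have := Real.add_one_le_exp (-(K * x))
      have h2 : Real.exp (-(K * x)) * Real.exp (K * x) = 1 := by
        rw [← Real.exp_add]; simp
      nlinarith [Real.exp_pos (K * x)]
    have h3 : ε / K * (Real.exp (K * x) - 1) ≤ ε / K * (K * x * Real.exp (K * x)) := by gcongr
    have h4 : ε / K * (K * x * Real.exp (K * x)) = ε * x * Real.exp (K * x) := by field_simp
    linarith

/-- Grönwall's inequality for functions that are differentiable in the interior. -/
theorem norm_le_exp_mul {e e' : ℝ → E} {a b K ε : ℝ} (hab : a ≤ b) (hK : 0 ≤ K) (hε : 0 ≤ ε)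
    (hc : ContinuousOn e (Icc a b)) (hd : ∀ s ∈ Ioo a b, HasDerivAt e (e' s) s)
    (hb : ∀ s ∈ Ioo a b, ‖e' s‖ ≤ K * ‖e s‖ + ε) :
    ‖e b‖ ≤ Real.exp (K * (b - a)) * (‖e a‖ + ε * (b - a)) := by
  rcases hab.eq_or_lt with rfl | hab
  · simp
  -- No derivative is available at the left end, so the estimate starts at r > a and then r tends to
  -- a.
  have key : ∀ r ∈ Ioo a b, ‖e b‖ ≤ Real.exp (K * (b - r)) * (‖e r‖ + ε * (b - r)) := by
    intro r hr
    refine (norm_le_gronwallBound_of_norm_deriv_right_le (f := e) (f' := e') (δ := ‖e r‖) (K := K)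
      (ε := ε) (a := r) (b := b) (hc.mono (Icc_subset_Icc_left hr.1.le)) ?_ le_rfl ?_ b
      (right_mem_Icc.2 hr.2.le)).trans (gronwallBound_le hK hε)
    · exact fun s hs => (hd s ⟨hr.1.trans_le hs.1, hs.2⟩).hasDerivWithinAt
    · exact fun s hs => hb s ⟨hr.1.trans_le hs.1, hs.2⟩
  have hcont : ContinuousWithinAt (fun r => Real.exp (K * (b - r)) * (‖e r‖ + ε * (b - r)))
      (Ioo a b) a := by
    have h1 : ContinuousWithinAt e (Ioo a b) a :=
      (hc a (left_mem_Icc.2 hab.le)).mono Ioo_subset_Icc_self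
    have h2 : Continuous fun r => Real.exp (K * (b - r)) := by fun_prop
    have h3 : Continuous fun r => ε * (b - r) := by fun_prop
    exact h2.continuousWithinAt.mul (h1.norm.add h3.continuousWithinAt)
  have hne : (nhdsWithin a (Ioo a b)).NeBot := by
    rw [← mem_closure_iff_nhdsWithin_neBot, closure_Ioo hab.ne]
    exact left_mem_Icc.2 hab.le
  exact ge_of_tendsto hcont.tendsto (by filter_upwards [self_mem_nhdsWithin] with r hr using key r hr)

/-- Solutions of a linear homogeneous equation grow and decay at most exponentially. -/
theorem norm_le_exp_abs_mul {w w' : ℝ → E} {a b K : ℝ} (hK : 0 ≤ K)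
    (hc : ContinuousOn w (Icc a b)) (hd : ∀ s ∈ Ioo a b, HasDerivAt w (w' s) s)
    (hb : ∀ s ∈ Ioo a b, ‖w' s‖ ≤ K * ‖w s‖) {s r : ℝ} (hs : s ∈ Icc a b) (hr : r ∈ Icc a b) :
    ‖w s‖ ≤ Real.exp (K * |s - r|) * ‖w r‖ := by
  rcases le_total r s with h | h
  · have h1 : Ioo r s ⊆ Ioo a b := Ioo_subset_Ioo hr.1 hs.2
    have := norm_le_exp_mul (ε := 0) h hK le_rfl (hc.mono (Icc_subset_Icc hr.1 hs.2))
      (fun x hx => hd x (h1 hx)) (fun x hx => by simpa using hb x (h1 hx))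
    rwa [zero_mul, add_zero, ← abs_of_nonneg (sub_nonneg.2 h)] at this
  · have h1 : ∀ x ∈ Ioo (-r) (-s), -x ∈ Ioo a b := fun x hx =>
      ⟨hs.1.trans_lt (by linarith [hx.2]), lt_of_lt_of_le (by linarith [hx.1]) hr.2⟩
    have := norm_le_exp_mul (e := fun x => w (-x)) (e' := fun x => -w' (-x)) (a := -r) (b := -s)
      (ε := 0) (by linarith) hK le_rfl ?_ ?_ ?_
    · simp only [neg_neg, zero_mul, add_zero] at this
      rw [abs_of_nonpos (by linarith)]
      convert this using 3; ring
    · refine hc.comp continuous_neg.continuousOn fun x hx => ?_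
      exact ⟨by linarith [hx.2, hs.1], by linarith [hx.1, hr.2]⟩
    · intro x hx
      have := (hd (-x) (h1 x hx)).scomp x (hasDerivAt_neg x)
      rw [neg_one_smul] at this
      exact this
    · intro x hx
      simpa using hb (-x) (h1 x hx)

theorem integral_congr_Ioo {f g : ℝ → E} {a b : ℝ} (hab : a ≤ b)
    (hfg : ∀ x ∈ Ioo a b, f x = g x) : ∫ x in a..b, f x = ∫ x in a..b, g x := by
  refine intervalIntegral.integral_congr_ae ?_
  filter_upwards [Measure.ae_ne volume b] with x hx hx'
  rw [uIoc_of_le hab] at hx'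
  exact hfg x ⟨hx'.1, lt_of_le_of_ne hx'.2 hx⟩

theorem intervalIntegrable_congr_Ioo {F : Type*} [NormedAddCommGroup F] {f g : ℝ → F} {a b : ℝ} (hab : a ≤ b)
    (hg : ContinuousOn g (Icc a b)) (hfg : ∀ x ∈ Ioo a b, f x = g x) :
    IntervalIntegrable f volume a b := by
  have h1 : IntervalIntegrable g volume a b :=
    ContinuousOn.intervalIntegrable (by rwa [uIcc_of_le hab])
  refine h1.congr_ae ?_
  have h2 : ∀ᵐ x ∂(volume.restrict (uIoc a b)), x ≠ b := ae_restrict_of_ae (Measure.ae_ne volume b)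
  filter_upwards [h2, ae_restrict_mem measurableSet_uIoc] with x hx hx'
  rw [uIoc_of_le hab] at hx'
  exact (hfg x ⟨hx'.1, lt_of_le_of_ne hx'.2 hx⟩).symm

theorem integral_quadratic (a b α β γ : ℝ) :
    ∫ s in a..b, (α + s * β + s ^ 2 * γ) =
      (b - a) * α + (b ^ 2 - a ^ 2) / 2 * β + (b ^ 3 - a ^ 3) / 3 * γ := by
  rw [intervalIntegral.integral_add, intervalIntegral.integral_add]
  · simp only [intervalIntegral.integral_const, intervalIntegral.integral_mul_const, integral_id,
      integral_pow, smul_eq_mul]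
    norm_num
  all_goals exact Continuous.intervalIntegrable (by fun_prop) _ _

/-- A quadratic polynomial that vanishes in the right end point of an interval and in the mean is
determined by its leading coefficient. -/
theorem quadratic_eq_of_mean_zero {r₀ r₁ r₂ : E} {a b : ℝ} (hab : a < b)
    (h₁ : r₀ + b • r₁ + b ^ 2 • r₂ = 0)
    (h₂ : (b - a) • r₀ + ((b ^ 2 - a ^ 2) / 2) • r₁ + ((b ^ 3 - a ^ 3) / 3) • r₂ = 0) :
    r₁ = (-(2 * a + 4 * b) / 3) • r₂ ∧
      ∀ s : ℝ, r₀ + s • r₁ + s ^ 2 • r₂ = ((s - b) * (s - a - (b - a) / 3)) • r₂ := by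
  have h3 : r₁ = (-(2 * a + 4 * b) / 3) • r₂ := by
    -- Subtracting the mean condition from (b - a) times the end point condition eliminates r₀.
    have h4 : ((b - a) ^ 2 / 2) • r₁ = ((b - a) ^ 2 / 2) • (-(2 * a + 4 * b) / 3) • r₂ := by
      linear_combination (norm := module) (b - a) • h₁ - h₂
    have h5 : (b - a) ^ 2 / 2 ≠ 0 := by
      have : 0 < b - a := sub_pos.2 hab
      positivity
    exact smul_right_injective E h5 h4
  refine ⟨h3, fun s => ?_⟩
  rw [h3] at h₁ ⊢
  linear_combination (norm := module) h₁

/-- The coefficients of a quadratic polynomial with values in a subspace belong to the subspace. -/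
theorem quadratic_coeff_mem {W : Submodule ℝ E} {c₀ c₁ c₂ : E} {a b : ℝ} (hab : a < b)
    (h : ∀ s ∈ Icc a b, c₀ + s • c₁ + s ^ 2 • c₂ ∈ W) : c₀ ∈ W ∧ c₁ ∈ W ∧ c₂ ∈ W := by
  have h1 := h a (left_mem_Icc.2 hab.le)
  have h2 := h b (right_mem_Icc.2 hab.le)
  have h3 := h ((a + b) / 2) ⟨by linarith, by linarith⟩
  have h0 : 0 < b - a := sub_pos.2 hab
  have e2 : c₂ ∈ W := by
    have h4 : ((b - a) ^ 2 / 2) • c₂ ∈ W := by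
      convert W.sub_mem (W.add_mem h1 h2) (W.smul_mem 2 h3) using 1
      module
    exact (W.smul_mem_iff (by positivity)).1 h4
  have e1 : c₁ ∈ W := by
    have h4 : (b - a) • c₁ ∈ W := by
      convert W.sub_mem (W.sub_mem h2 h1) (W.smul_mem (b ^ 2 - a ^ 2) e2) using 1
      module
    exact (W.smul_mem_iff h0.ne').1 h4
  refine ⟨?_, e1, e2⟩
  convert W.sub_mem (W.sub_mem h1 (W.smul_mem a e1)) (W.smul_mem (a ^ 2) e2) using 1
  module

theorem hasDerivAt_quadratic (c₀ c₁ c₂ : E) (s : ℝ) :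
    HasDerivAt (fun r : ℝ => c₀ + r • c₁ + r ^ 2 • c₂) (c₁ + (2 * s) • c₂) s := by
  have h1 : HasDerivAt (fun r : ℝ => r • c₁) ((1 : ℝ) • c₁) s := (hasDerivAt_id s).smul_const c₁
  have h2 : HasDerivAt (fun r : ℝ => r ^ 2 • c₂) ((2 * s) • c₂) s := by
    simpa using (hasDerivAt_pow 2 s).smul_const c₂
  rw [one_smul] at h1
  exact (h1.const_add c₀).add h2

/-- Lower bound for the distance of a function with almost constant second derivative to the
affine functions. -/
theorem le_integral_norm_sub_affine_sq {g₁ g₂ w : ℝ → E} {a b k m : ℝ} (hk : 0 < k)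
    (hkb : a + 3 * k ≤ b) (hm : 0 ≤ m) (hc : ContinuousOn g₁ (Icc a b))
    (hd₁ : ∀ s ∈ Ioo a b, HasDerivAt g₁ (g₂ s) s) (hd₂ : ∀ s ∈ Ioo a b, HasDerivAt g₂ (w s) s)
    (hw : ∀ x ∈ Ioo a b, ∀ s ∈ Ioo a b, |s - x| ≤ 2 * k → ‖w s - w x‖ ≤ ‖w x‖ / 2)
    (hwm : ∀ x ∈ Ioo a b, m ≤ ‖w x‖) (p₀ p₁ : E) :
    k ^ 5 * m ^ 2 / 24 ≤ ∫ s in a..b, ‖g₁ s - (p₀ + s • p₁)‖ ^ 2 := by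
  set d : ℝ → E := fun s => g₁ s - (p₀ + s • p₁) with hdd
  have hdc : ContinuousOn d (Icc a b) := hc.sub (by fun_prop)
  -- Second differences annihilate affine functions. After subtracting (s-x)²w(x)/2, the mean value
  -- inequality used twice shows that the second difference is k²w(x) up to half its norm.
  have second : ∀ x ∈ Ioo a (a + k), k ^ 2 * m / 2 ≤ ‖d x - (2 : ℝ) • d (x + k) + d (x + 2 * k)‖ := by
    intro x hx
    have hxI : ∀ r ∈ Icc 0 (2 * k), x + r ∈ Ioo a b := fun r hr =>
      ⟨by linarith [hx.1, hr.1], by linarith [hx.2, hr.2]⟩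
    set F₁ : ℝ → E := fun s => g₂ s - (s - x) • w x
    set F : ℝ → E := fun s => g₁ s - ((s - x) ^ 2 / 2) • w x with hF
    have hF₁ : ∀ s ∈ Ioo a b, HasDerivAt F₁ (w s - w x) s := by
      intro s hs
      have h1 : HasDerivAt (fun s : ℝ => (s - x) • w x) ((1 : ℝ) • w x) s :=
        ((hasDerivAt_id s).sub_const x).smul_const (w x)
      rw [one_smul] at h1
      exact (hd₂ s hs).sub h1
    have hF' : ∀ s ∈ Ioo a b, HasDerivAt F (F₁ s) s := by
      intro s hs
      have h1 : HasDerivAt (fun s : ℝ => (s - x) ^ 2 / 2) (s - x) s := by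
        have := (((hasDerivAt_id s).sub_const x).pow 2).div_const 2
        simpa using this
      exact (hd₁ s hs).sub (h1.smul_const (w x))
    have q1 : ∀ r ∈ Icc 0 k, ‖F₁ (x + k + r) - F₁ (x + r)‖ ≤ ‖w x‖ / 2 * k := by
      intro r hr
      have := Convex.norm_image_sub_le_of_norm_hasDerivWithin_le (f := F₁)
        (f' := fun s => w s - w x) (s := Icc x (x + 2 * k)) (C := ‖w x‖ / 2)
        (x := x + r) (y := x + k + r) (fun s hs => ?_) (fun s hs => ?_) (convex_Icc _ _)
        ⟨by linarith [hr.1], by linarith [hr.2]⟩ ⟨by linarith [hr.1], by linarith [hr.2]⟩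
      · refine this.trans (le_of_eq ?_)
        rw [show x + k + r - (x + r) = k by ring, Real.norm_of_nonneg hk.le]
      · have hs' := hxI (s - x) ⟨by linarith [hs.1], by linarith [hs.2]⟩
        rw [add_sub_cancel] at hs'
        exact (hF₁ s hs').hasDerivWithinAt
      · have hs' := hxI (s - x) ⟨by linarith [hs.1], by linarith [hs.2]⟩
        rw [add_sub_cancel] at hs'
        have hx' := hxI 0 ⟨le_rfl, by linarith⟩
        rw [add_zero] at hx'
        exact hw x hx' s hs' (by rw [abs_of_nonneg (by linarith [hs.1])]; linarith [hs.2])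
    have q2 := Convex.norm_image_sub_le_of_norm_hasDerivWithin_le
      (f := fun r => F (x + k + r) - F (x + r))
      (f' := fun r => F₁ (x + k + r) - F₁ (x + r)) (s := Icc 0 k) (C := ‖w x‖ / 2 * k)
      (x := 0) (y := k) (fun r hr => by
        have a1 := hF' (x + k + r) (by
          have := hxI (k + r) ⟨by linarith [hr.1], by linarith [hr.2]⟩
          rwa [← add_assoc] at this)
        have a2 := hF' (x + r) (hxI r ⟨hr.1, by linarith [hr.2]⟩)
        exact ((a1.comp_const_add (x + k) r).sub (a2.comp_const_add x r)).hasDerivWithinAt)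
      q1 (convex_Icc _ _) ⟨le_rfl, hk.le⟩ ⟨hk.le, le_rfl⟩
    rw [sub_zero, Real.norm_of_nonneg hk.le] at q2
    have e : F (x + k + k) - F (x + k) - (F (x + k + 0) - F (x + 0)) =
        (d x - (2 : ℝ) • d (x + k) + d (x + 2 * k)) - k ^ 2 • w x := by
      simp only [hF, hdd, add_zero]
      rw [show x + k + k = x + 2 * k by ring]
      module
    rw [e] at q2
    have hx' := hwm x (by simpa using hxI 0 ⟨le_rfl, by linarith⟩)
    have q3 := norm_sub_norm_le (k ^ 2 • w x) (d x - (2 : ℝ) • d (x + k) + d (x + 2 * k))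
    rw [norm_sub_rev, norm_smul, Real.norm_of_nonneg (by positivity)] at q3
    have : k ^ 2 * m / 2 ≤ k ^ 2 * ‖w x‖ / 2 := by gcongr
    linarith
  set D : ℝ → ℝ := fun s => ‖d s‖ ^ 2 with hD
  have hDc : ContinuousOn D (Icc a b) := hdc.norm.pow 2
  have Dint : ∀ x y, a ≤ x → x ≤ y → y ≤ b → IntervalIntegrable D volume x y := fun x y h1 h2 h3 =>
    ContinuousOn.intervalIntegrable (by rw [uIcc_of_le h2]; exact hDc.mono (Icc_subset_Icc h1 h3))
  have Dnn : ∀ s, 0 ≤ D s := fun s => by positivity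
  have shift : ∀ r, 0 ≤ r → r ≤ 2 * k → IntervalIntegrable (fun s => D (s + r)) volume a (a + k) := by
    intro r h1 h2
    refine ContinuousOn.intervalIntegrable ?_
    rw [uIcc_of_le (by linarith)]
    refine hDc.comp (by fun_prop) fun s hs => ⟨by linarith [hs.1], by linarith [hs.2]⟩
  have i0 := shift 0 le_rfl (by linarith)
  have i1 := shift k hk.le (by linarith)
  have i2 := shift (2 * k) (by linarith) le_rfl
  simp only [add_zero] at i0
  -- The factor 6 = 1 + 4 + 1 comes from Cauchy–Schwarz for the second difference. The three
  -- translates of [a, a+k] then tile [a, a+3k].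
  have lower : ∫ s in a..(a + k), k ^ 4 * m ^ 2 / 4 ≤
      ∫ s in a..(a + k), 6 * (D s + D (s + k) + D (s + 2 * k)) := by
    refine intervalIntegral.integral_mono_on_of_le_Ioo (by linarith) (by simp)
      (((i0.add i1).add i2).const_mul 6) fun x hx => ?_
    have h1 := second x hx
    have h2 : ‖d x - (2 : ℝ) • d (x + k) + d (x + 2 * k)‖ ≤
        ‖d x‖ + 2 * ‖d (x + k)‖ + ‖d (x + 2 * k)‖ := by
      refine (norm_add_le _ _).trans ?_
      gcongr
      refine (norm_sub_le _ _).trans ?_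
      rw [norm_smul]; norm_num
    have h3 := pow_le_pow_left₀ (by positivity) (h1.trans h2) 2
    simp only [hD]
    nlinarith [sq_nonneg (2 * ‖d x‖ - ‖d (x + k)‖), sq_nonneg (‖d x‖ - ‖d (x + 2 * k)‖),
      sq_nonneg (2 * ‖d (x + 2 * k)‖ - ‖d (x + k)‖)]
  rw [intervalIntegral.integral_const, intervalIntegral.integral_const_mul,
    intervalIntegral.integral_add (i0.add i1) i2, intervalIntegral.integral_add i0 i1,
    intervalIntegral.integral_comp_add_right D k,
    intervalIntegral.integral_comp_add_right D (2 * k),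
    intervalIntegral.integral_add_adjacent_intervals (Dint _ _ le_rfl (by linarith) (by linarith))
      (Dint _ _ (by linarith) (by linarith) (by linarith)),
    show a + 2 * k = a + k + k by ring, show a + k + 2 * k = a + k + k + k by ring,
    intervalIntegral.integral_add_adjacent_intervals (Dint _ _ le_rfl (by linarith) (by linarith))
      (Dint _ _ (by linarith) (by linarith) (by linarith))] at lower
  have whole : ∫ s in a..(a + k + k + k), D s ≤ ∫ s in a..b, D s :=
    intervalIntegral.integral_mono_interval le_rfl (by linarith) (by linarith)
      (Filter.Eventually.of_forall Dnn) (Dint _ _ le_rfl (by linarith) le_rfl)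
  simp only [smul_eq_mul, add_sub_cancel_left] at lower
  change _ ≤ ∫ s in a..b, D s
  have : k ^ 5 * m ^ 2 / 24 = k * (k ^ 4 * m ^ 2 / 4) / 6 := by ring
  linarith

end Calculus

end AdaptiveRadau

end

/-! ### The residual of the scheme and reliability of the estimator -/

noncomputable section

namespace AdaptiveRadau

variable {V H : Type*} [NormedAddCommGroup V] [InnerProductSpace ℝ V]
  [NormedAddCommGroup H] [InnerProductSpace ℝ H] {P : ParabolicProblem V H}

/-- On a time step, the residual of the time stepping scheme is a fixed quadratic polynomial times
a functional which determines the error indicator. -/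
theorem exists_residual {W : Submodule ℝ V} {u : ℝ → V} {T : TimeStep} (hT : T.1 < T.2)
    {c₀ c₁ c₂ : V →L[ℝ] ℝ} (hf : ∀ r ∈ Icc T.1 T.2, P.f r = c₀ + r • c₁ + r ^ 2 • c₂)
    (hq : ∃ a₀ a₁ a₂ : V, ∀ r ∈ Icc T.1 T.2, u r = a₀ + r • a₁ + r ^ 2 • a₂)
    (hW : ∀ r ∈ Icc T.1 T.2, u r ∈ W)
    (hmean : ∀ v ∈ W, ∫ t in T.1..T.2, (P.toDual (deriv u t) v + P.A (u t) v) =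
      ∫ t in T.1..T.2, P.f t v)
    (hpoint : ∀ v ∈ W, P.toDual (derivWithin u (Icc T.1 T.2) T.2) v + P.A (u T.2) v =
      P.f T.2 v) :
    ∃ a₁ ∈ W, ∃ a₂ ∈ W, ∃ ρ : SubDual W,
      (∀ s ∈ Ioo T.1 T.2, HasDerivAt u (a₁ + (2 * s) • a₂) s) ∧
      (∀ s ∈ Icc T.1 T.2, restr W (P.f s - P.toDualL (a₁ + (2 * s) • a₂) - P.A (u s)) =
        ((s - T.2) * (s - T.1 - T.len / 3)) • ρ) ∧
      P.indicatorSq W u T = 4 / 9 * T.len ^ 5 * ‖ρ‖ ^ 2 ∧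
      (∀ s : ℝ, restr W (c₁ + (2 * s) • c₂ - P.toDualL ((2 : ℝ) • a₂) -
        P.A (a₁ + (2 * s) • a₂)) = (2 * s - (2 * T.1 + 4 * T.2) / 3) • ρ) ∧
      restr W ((2 : ℝ) • c₂ - P.A ((2 : ℝ) • a₂)) = (2 : ℝ) • ρ := by
  obtain ⟨a₀, a₁, a₂, ha⟩ := hq
  obtain ⟨-, m₁, m₂⟩ := quadratic_coeff_mem hT fun s hs => ha s hs ▸ hW s hs
  have hder : ∀ s ∈ Ioo T.1 T.2, HasDerivAt u (a₁ + (2 * s) • a₂) s := by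
    intro s hs
    refine (hasDerivAt_quadratic a₀ a₁ a₂ s).congr_of_eventuallyEq ?_
    filter_upwards [Icc_mem_nhds hs.1 hs.2] with r hr using ha r hr
  have hder₂ : ∀ s ∈ Ioo T.1 T.2, HasDerivAt (deriv u) ((2 : ℝ) • a₂) s := by
    intro s hs
    have h1 : HasDerivAt (fun r : ℝ => a₁ + (2 * r) • a₂) ((2 : ℝ) • a₂) s := by
      have h2 : HasDerivAt (fun r : ℝ => 2 * r) 2 s := by
        simpa using (hasDerivAt_id s).const_mul (2 : ℝ)
      exact (h2.smul_const a₂).const_add a₁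
    refine h1.congr_of_eventuallyEq ?_
    filter_upwards [Ioo_mem_nhds hs.1 hs.2] with r hr using (hder r hr).deriv
  have hderf : ∀ s ∈ Ioo T.1 T.2, deriv P.f s = c₁ + (2 * s) • c₂ := by
    intro s hs
    refine ((hasDerivAt_quadratic c₀ c₁ c₂ s).congr_of_eventuallyEq ?_).deriv
    filter_upwards [Icc_mem_nhds hs.1 hs.2] with r hr using hf r hr
  have hend : derivWithin u (Icc T.1 T.2) T.2 = a₁ + (2 * T.2) • a₂ := by
    have hmem := right_mem_Icc.2 hT.le
    exact ((hasDerivAt_quadratic a₀ a₁ a₂ T.2).hasDerivWithinAt.congr ha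
      (ha _ hmem)).derivWithin (uniqueDiffOn_Icc hT _ hmem)
  set r₀ := restr W (c₀ - P.toDualL a₁ - P.A a₀) with hr₀
  set r₁ := restr W (c₁ - (2 : ℝ) • P.toDualL a₂ - P.A a₁) with hr₁
  set r₂ := restr W (c₂ - P.A a₂) with hr₂
  have hres : ∀ s ∈ Icc T.1 T.2,
      restr W (P.f s - P.toDualL (a₁ + (2 * s) • a₂) - P.A (u s)) =
        r₀ + s • r₁ + s ^ 2 • r₂ := by
    intro s hs
    rw [hf s hs, ha s hs, hr₀, hr₁, hr₂]
    simp only [map_add, map_sub, map_smul]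
    module
  have h₁ : r₀ + T.2 • r₁ + T.2 ^ 2 • r₂ = 0 := by
    rw [← hres T.2 (right_mem_Icc.2 hT.le)]
    refine SubDual.ext fun v => ?_
    have := hpoint v v.2
    rw [hend, P.toDual_eq] at this
    simp only [eval_restr, _root_.sub_apply, map_zero]
    linarith
  have h₂ : (T.2 - T.1) • r₀ + ((T.2 ^ 2 - T.1 ^ 2) / 2) • r₁ +
      ((T.2 ^ 3 - T.1 ^ 3) / 3) • r₂ = 0 := by
    refine SubDual.ext fun v => ?_
    have e1 : ∫ t in T.1..T.2, (P.toDual (deriv u t) v + P.A (u t) v) =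
        ∫ t in T.1..T.2, ((P.toDualL a₁ v + P.A a₀ v) +
          t * (2 * P.toDualL a₂ v + P.A a₁ v) + t ^ 2 * P.A a₂ v) := by
      refine integral_congr_Ioo hT.le fun s hs => ?_
      rw [(hder s hs).deriv, ha s ⟨hs.1.le, hs.2.le⟩, P.toDual_eq]
      simp only [map_add, map_smul, _root_.add_apply, _root_.smul_apply, smul_eq_mul]
      ring
    have e2 : ∫ t in T.1..T.2, P.f t v = ∫ t in T.1..T.2, (c₀ v + t * c₁ v + t ^ 2 * c₂ v) := by
      refine integral_congr_Ioo hT.le fun s hs => ?_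
      rw [hf s ⟨hs.1.le, hs.2.le⟩]
      simp only [_root_.add_apply, _root_.smul_apply, smul_eq_mul]
    have := hmean v v.2
    rw [e1, e2, integral_quadratic, integral_quadratic] at this
    simp only [hr₀, hr₁, hr₂, map_add, map_smul, map_zero, eval_restr, _root_.sub_apply,
      _root_.smul_apply, smul_eq_mul]
    linarith
  -- The two scheme conditions leave one free coefficient; the zeros are the Radau nodes at 1/3 and
  -- 1 of the step.
  obtain ⟨hr₁', hr⟩ := quadratic_eq_of_mean_zero hT h₁ h₂
  have hD : ∀ s : ℝ, restr W (c₁ + (2 * s) • c₂ - P.toDualL ((2 : ℝ) • a₂) -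
        P.A (a₁ + (2 * s) • a₂)) = (2 * s - (2 * T.1 + 4 * T.2) / 3) • r₂ := by
    intro s
    have : restr W (c₁ + (2 * s) • c₂ - P.toDualL ((2 : ℝ) • a₂) -
        P.A (a₁ + (2 * s) • a₂)) = r₁ + (2 * s) • r₂ := by
      rw [hr₁, hr₂]
      simp only [map_add, map_sub, map_smul]
      module
    rw [this, hr₁']
    module
  refine ⟨a₁, m₁, a₂, m₂, r₂, hder, fun s hs => (hres s hs).trans (hr s), ?_, hD, ?_⟩
  -- The residual has the derivative 2(s - (a+2b)/3)ρ, whose squared norm integrates to 4/9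
  -- |T|³‖ρ‖².
  · unfold ParabolicProblem.indicatorSq
    have e : ∫ t in T.1..T.2, ParabolicProblem.dualNorm W
        (deriv P.f t - P.toDual (deriv (deriv u) t) - P.A (deriv u t)) ^ 2 =
        ∫ t in T.1..T.2, (((2 * T.1 + 4 * T.2) / 3) ^ 2 * ‖r₂‖ ^ 2 +
          t * (-(4 * (2 * T.1 + 4 * T.2) / 3) * ‖r₂‖ ^ 2) + t ^ 2 * (4 * ‖r₂‖ ^ 2)) := by
      refine integral_congr_Ioo hT.le fun s hs => ?_
      rw [hderf s hs, (hder₂ s hs).deriv, (hder s hs).deriv, dualNorm_eq, P.toDual_eq, hD,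
        norm_smul, mul_pow, Real.norm_eq_abs, sq_abs]
      ring
    rw [e, integral_quadratic]
    simp only [TimeStep.len]
    ring
  · rw [hr₂]
    simp only [map_sub, map_smul]
    module

theorem exists_quadratic_on {E : Type*} [NormedAddCommGroup E] [NormedSpace ℝ E] {t : ℝ} {n : ℕ}
    {f : ℝ → E} (hf : IsSpline t (TimeMesh.uniform t n) f) {T : TimeStep}
    (hT : ∃ i < n, t / n * i ≤ T.1 ∧ T.2 ≤ t / n * (i + 1)) :
    ∃ c₀ c₁ c₂ : E, ∀ r ∈ Icc T.1 T.2, f r = c₀ + r • c₁ + r ^ 2 • c₂ := by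
  classical
  obtain ⟨i, hi, h1, h2⟩ := hT
  have hmem : (t * (i : ℝ) / n, t * ((i : ℝ) + 1) / n) ∈ TimeMesh.uniform t n := by
    simp only [TimeMesh.uniform, Finset.mem_image, Finset.mem_range]
    exact ⟨i, hi, rfl⟩
  obtain ⟨c₀, c₁, c₂, h⟩ := hf.2 _ hmem
  refine ⟨c₀, c₁, c₂, fun r hr => h r ⟨?_, ?_⟩⟩
  · dsimp only; rw [mul_div_right_comm]; exact h1.trans hr.1
  · dsimp only; rw [mul_div_right_comm]; exact hr.2.trans h2

section Mesh

variable {t : ℝ} {n : ℕ} {𝒯 : TimeMesh}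

theorem sum_sub_generated (ht : 0 < t) (hn : 1 ≤ n)
    (hg : TimeMesh.GeneratedFrom (TimeMesh.uniform t n) 𝒯) (G : ℝ → ℝ) :
    ∑ T ∈ 𝒯, (G T.2 - G T.1) = G t - G 0 := by
  have hn' : (0 : ℝ) < n := by exact_mod_cast hn
  have hh : 0 < t / n := by positivity
  have tri := isTriadic_uniform ht hn
  rw [tri.sum_generated hh hg (F := fun T => G T.2 - G T.1), sum_uniform ht hn]
  · have := Finset.sum_range_sub (fun i : ℕ => G (t / n * i)) n
    push_cast at this
    rw [this]
    congr 2
    · field_simp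
    · simp
  · intro 𝒮 hg' T hT
    rw [IsTriadic.sum_children ((tri.generated hh hg').len_pos hh hT)]
    ring

theorem sum_len_generated (ht : 0 < t) (hn : 1 ≤ n)
    (hg : TimeMesh.GeneratedFrom (TimeMesh.uniform t n) 𝒯) : ∑ T ∈ 𝒯, T.len = t :=
  (sum_sub_generated ht hn hg id).trans (sub_zero t)

/-- Integrability is assumed on each step only, since spline derivatives jump at the nodes; for a
split step it is recovered from its children. -/
theorem integral_eq_sum_generated (ht : 0 < t) (hn : 1 ≤ n)
    (hg : TimeMesh.GeneratedFrom (TimeMesh.uniform t n) 𝒯) {F : ℝ → ℝ}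
    (hF : ∀ T ∈ 𝒯, IntervalIntegrable F volume T.1 T.2) :
    IntervalIntegrable F volume 0 t ∧ ∫ s in 0..t, F s = ∑ T ∈ 𝒯, ∫ s in T.1..T.2, F s := by
  have hn' : (0 : ℝ) < n := by exact_mod_cast hn
  have hh : 0 < t / n := by positivity
  have tri := isTriadic_uniform ht hn
  induction hg with
  | refl =>
    rw [sum_uniform ht hn]
    have h1 : ∀ k < n, IntervalIntegrable F volume (t / n * (k : ℕ)) (t / n * ((k + 1 : ℕ) : ℝ)) := by
      intro k hk
      have := hF (t * (k : ℝ) / n, t * ((k : ℝ) + 1) / n) (by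
        simp only [TimeMesh.uniform, Finset.mem_image, Finset.mem_range]
        exact ⟨k, hk, rfl⟩)
      dsimp only at this
      rw [mul_div_right_comm, mul_div_right_comm] at this
      push_cast
      exact this
    have h2 := IntervalIntegrable.trans_iterate h1
    have h3 := intervalIntegral.sum_integral_adjacent_intervals h1
    have e : t / n * (n : ℝ) = t := by field_simp
    rw [Nat.cast_zero, mul_zero, e] at h2 h3
    push_cast at h3
    exact ⟨h2, h3.symm⟩
  | @split 𝒮 T hg' hT ih =>
    have tri' := tri.generated hh hg'
    have hp := tri'.len_pos hh hT
    have hc : ∀ c ∈ T.children, IntervalIntegrable F volume c.1 c.2 := fun c hc =>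
      hF c (TimeMesh.mem_split.2 (Or.inr hc))
    have i1 := hc _ (TimeStep.mem_children.2 (Or.inl rfl))
    have i2 := hc _ (TimeStep.mem_children.2 (Or.inr (Or.inl rfl)))
    have i3 := hc _ (TimeStep.mem_children.2 (Or.inr (Or.inr rfl)))
    obtain ⟨h1, h2⟩ := ih (fun S hS => by
      by_cases hST : S = T
      · subst hST; exact (i1.trans i2).trans i3
      · exact hF S (TimeMesh.mem_split.2 (Or.inl ⟨hST, hS⟩)))
    refine ⟨h1, ?_⟩
    rw [tri'.sum_split hh hT, h2, IsTriadic.sum_children hp]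
    have e1 := intervalIntegral.integral_add_adjacent_intervals i1 i2
    have e2 := intervalIntegral.integral_add_adjacent_intervals (i1.trans i2) i3
    dsimp only at e1 e2
    linarith

end Mesh

theorem xNorm_sq (W : Submodule ℝ V) (w : ℝ → V) :
    P.xNorm W w ^ 2 =
      ∫ t in 0..P.tEnd, (‖w t‖ ^ 2 + ‖restr W (P.toDualL (deriv w t))‖ ^ 2) := by
  unfold ParabolicProblem.xNorm
  rw [Real.sq_sqrt (intervalIntegral.integral_nonneg P.tEnd_pos.le fun t _ => by positivity)]
  rfl

theorem indicatorSq_nonneg (W : Submodule ℝ V) (u : ℝ → V) {T : TimeStep} (hT : T.1 ≤ T.2) :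
    0 ≤ P.indicatorSq W u T :=
  mul_nonneg (sq_nonneg _) (intervalIntegral.integral_nonneg hT fun t _ => by positivity)

/-- The integrand of the `𝒳`-norm of a function that is continuously differentiable on a closed
time interval. -/
theorem xNorm_integrand {W : Submodule ℝ V} {w w' : ℝ → V} {a b : ℝ} (hab : a ≤ b)
    (hc : ContinuousOn w (Icc a b)) (hc' : ContinuousOn w' (Icc a b))
    (hd : ∀ s ∈ Ioo a b, HasDerivAt w (w' s) s) :
    IntervalIntegrable (fun t => ‖w t‖ ^ 2 + ‖restr W (P.toDualL (deriv w t))‖ ^ 2) volume a b ∧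
    IntervalIntegrable (fun t => ‖w t‖ ^ 2 + ‖restr W (P.toDualL (w' t))‖ ^ 2) volume a b ∧
    ∫ t in a..b, (‖w t‖ ^ 2 + ‖restr W (P.toDualL (deriv w t))‖ ^ 2) =
      ∫ t in a..b, (‖w t‖ ^ 2 + ‖restr W (P.toDualL (w' t))‖ ^ 2) := by
  have hcont : ContinuousOn (fun t => ‖w t‖ ^ 2 + ‖restr W (P.toDualL (w' t))‖ ^ 2) (Icc a b) :=
    (hc.norm.pow 2).add ((((restr W).comp P.toDualL).continuous.comp_continuousOn hc').norm.pow 2)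
  have heq : ∀ s ∈ Ioo a b, ‖w s‖ ^ 2 + ‖restr W (P.toDualL (deriv w s))‖ ^ 2 =
      ‖w s‖ ^ 2 + ‖restr W (P.toDualL (w' s))‖ ^ 2 := fun s hs => by rw [(hd s hs).deriv]
  exact ⟨intervalIntegrable_congr_Ioo hab hcont heq,
    ContinuousOn.intervalIntegrable (by rwa [uIcc_of_le hab]), integral_congr_Ioo hab heq⟩

/-- The pointwise energy estimate behind the reliability of the estimator. -/
theorem energy_estimate {α β a x y D₁ D₂ R g e z ψ : ℝ} (hα : 0 < α)
    (hx0 : 0 ≤ x) (hx : x ≤ D₁ + e) (hy0 : 0 ≤ y) (hy : y ≤ D₂ + z) (hz : z ≤ g + β * e)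
    (hg0 : 0 ≤ g) (hg : g ≤ D₂ + β * D₁ + R) (he : α * e ^ 2 + ψ / 2 ≤ g * e)
    (ha : a = 3 + (2 + 3 * β ^ 2) / α ^ 2) :
    x ^ 2 + y ^ 2 ≤ (3 + 3 * a * (1 + β ^ 2)) * (D₁ ^ 2 + D₂ ^ 2) +
      (3 + 3 * a * (1 + β ^ 2)) * R ^ 2 - (2 + 3 * β ^ 2) / α * ψ := by
  have hx2 : x ^ 2 ≤ 2 * D₁ ^ 2 + 2 * e ^ 2 := by
    have := pow_le_pow_left₀ hx0 hx 2
    nlinarith [sq_nonneg (D₁ - e)]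
  have hy2 : y ^ 2 ≤ 3 * D₂ ^ 2 + 3 * g ^ 2 + 3 * β ^ 2 * e ^ 2 := by
    have := pow_le_pow_left₀ hy0 (hy.trans (add_le_add_right hz D₂)) 2
    nlinarith [sq_nonneg (D₂ - g), sq_nonneg (g - β * e), sq_nonneg (D₂ - β * e)]
  have hg2 : g ^ 2 ≤ 3 * D₂ ^ 2 + 3 * β ^ 2 * D₁ ^ 2 + 3 * R ^ 2 := by
    have := pow_le_pow_left₀ hg0 hg 2
    nlinarith [sq_nonneg (D₂ - R), sq_nonneg (R - β * D₁), sq_nonneg (D₂ - β * D₁)]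
  have he2 : e ^ 2 ≤ g ^ 2 / α ^ 2 - ψ / α := by
    have h1 : g * e ≤ g ^ 2 / (2 * α) + α * e ^ 2 / 2 := by
      rw [div_add_div _ _ (by positivity) (by positivity), le_div_iff₀ (by positivity)]
      nlinarith [sq_nonneg (g - α * e)]
    have h2 : α * e ^ 2 ≤ g ^ 2 / α - ψ := by
      have : g ^ 2 / (2 * α) = g ^ 2 / α / 2 := by field_simp
      linarith
    have h3 : e ^ 2 ≤ (g ^ 2 / α - ψ) / α := by
      rw [le_div_iff₀ hα]; linarith
    calc e ^ 2 ≤ (g ^ 2 / α - ψ) / α := h3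
      _ = _ := by field_simp
  -- 2 + 3β² is the total weight of e² in the bounds of x² and y². Trading e² for g² raises the
  -- weight of g² from 3 to a.
  have hs : (2 + 3 * β ^ 2) * e ^ 2 ≤ (2 + 3 * β ^ 2) * (g ^ 2 / α ^ 2 - ψ / α) := by gcongr
  have hs' : (2 + 3 * β ^ 2) * (g ^ 2 / α ^ 2 - ψ / α) =
      (a - 3) * g ^ 2 - (2 + 3 * β ^ 2) / α * ψ := by rw [ha]; field_simp; ring
  have ha0 : 0 ≤ a := by rw [ha]; positivity
  have h5 : a * g ^ 2 ≤ a * (3 * D₂ ^ 2 + 3 * β ^ 2 * D₁ ^ 2 + 3 * R ^ 2) := by gcongr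
  have h6 : 0 ≤ a * β ^ 2 * D₂ ^ 2 := by positivity
  have h7 : 0 ≤ a * D₁ ^ 2 := by positivity
  have h8 : 0 ≤ a * β ^ 2 * R ^ 2 := by positivity
  nlinarith [sq_nonneg D₁, sq_nonneg R]

variable [FiniteDimensional ℝ V]

/-- Reliability of the error estimator, up to the projection error. -/
theorem xNorm_sq_le {α β : ℝ} (hα : 0 < α) (hβ : 0 ≤ β) (hP : P.IsElliptic α β) {n : ℕ}
    (hn : 1 ≤ n) (hf : IsSpline P.tEnd (TimeMesh.uniform P.tEnd n) P.f) {W W' : Submodule ℝ V}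
    (hWW : W ≤ W') {U : ℝ → V} (hU : P.IsSolution W' U) {𝒯 : TimeMesh}
    (hg : TimeMesh.GeneratedFrom (TimeMesh.uniform P.tEnd n) 𝒯) {u : ℝ → V}
    (hu : P.IsDiscreteSolution W 𝒯 u) :
    P.xNorm W (fun t => U t - u t) ^ 2 ≤
      (3 + 3 * (3 + (2 + 3 * β ^ 2) / α ^ 2) * (1 + β ^ 2)) *
        (P.xNorm W (fun t => U t - W.starProjection (U t)) ^ 2 + ∑ T ∈ 𝒯, P.indicatorSq W u T) := by
  have ht := P.tEnd_pos
  have hn' : (0 : ℝ) < n := by exact_mod_cast hn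
  have hh : 0 < P.tEnd / n := by positivity
  have tri := (isTriadic_uniform ht hn).generated hh hg
  obtain ⟨U', hUc, hUc', hUd, -, hUe⟩ := hU.exists_deriv hf.1
  set π : V →L[ℝ] V := W.starProjection with hπ
  have hπW : ∀ v, π v ∈ W := fun v => W.starProjection_apply_mem v
  set C := 3 + 3 * (3 + (2 + 3 * β ^ 2) / α ^ 2) * (1 + β ^ 2) with hC
  set F₁ : ℝ → ℝ := fun s => ‖U s - u s‖ ^ 2 +
    ‖restr W (P.toDualL (deriv (fun t => U t - u t) s))‖ ^ 2 with hF₁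
  set F₂ : ℝ → ℝ := fun s => ‖U s - π (U s)‖ ^ 2 +
    ‖restr W (P.toDualL (deriv (fun t => U t - π (U t)) s))‖ ^ 2 with hF₂
  set ψ : ℝ → ℝ := fun s => ‖P.ι (π (U s) - u s)‖ ^ 2 with hψ
  have key : ∀ T ∈ 𝒯, IntervalIntegrable F₁ volume T.1 T.2 ∧
      IntervalIntegrable F₂ volume T.1 T.2 ∧
      ∫ s in T.1..T.2, F₁ s ≤ C * (∫ s in T.1..T.2, F₂ s) + C * P.indicatorSq W u T -
        (2 + 3 * β ^ 2) / α * (ψ T.2 - ψ T.1) := by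
    intro T hT
    have hlt := tri.lt hh hT
    have hlen := tri.len_pos hh hT
    have hbd := tri.bounds hh hT
    rw [div_mul_cancel₀ _ hn'.ne'] at hbd
    have hsub : Icc T.1 T.2 ⊆ Icc 0 P.tEnd := Icc_subset_Icc hbd.1 hbd.2
    have hsub' : Ioo T.1 T.2 ⊆ Ioo 0 P.tEnd := Ioo_subset_Ioo hbd.1 hbd.2
    obtain ⟨c₀, c₁, c₂, hc⟩ := exists_quadratic_on hf (tri.exists_sub T hT)
    obtain ⟨a₁, m₁, a₂, m₂, ρ, hud, hres, hind, -, -⟩ := exists_residual hlt hc (hu.mem.1.2 T hT)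
      (fun r hr => hu.mem.2 r (hsub hr)) (hu.mean T hT) (hu.point T hT)
    have huc : ContinuousOn u (Icc T.1 T.2) := hu.mem.1.1.mono hsub
    have hUcT := hUc.mono hsub
    have hUcT' := hUc'.mono hsub
    set u' : ℝ → V := fun s => a₁ + (2 * s) • a₂ with hu'
    have hu'c : Continuous u' := by fun_prop
    have hu'W : ∀ s, u' s ∈ W := fun s => W.add_mem m₁ (W.smul_mem _ m₂)
    obtain ⟨i₁, j₁, e₁⟩ := xNorm_integrand (P := P) (W := W) (w := fun s => U s - u s)
      (w' := fun s => U' s - u' s) hlt.le (hUcT.sub huc) (hUcT'.sub hu'c.continuousOn)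
      fun s hs => (hUd s (hsub' hs)).sub (hud s hs)
    obtain ⟨i₂, j₂, e₂⟩ := xNorm_integrand (P := P) (W := W) (w := fun s => U s - π (U s))
      (w' := fun s => U' s - π (U' s)) hlt.le
      (hUcT.sub (π.continuous.comp_continuousOn hUcT))
      (hUcT'.sub (π.continuous.comp_continuousOn hUcT'))
      fun s hs => (hUd s (hsub' hs)).sub (π.hasFDerivAt.comp_hasDerivAt s (hUd s (hsub' hs)))
    refine ⟨i₁, i₂, ?_⟩
    -- The error is split into the projection error and e = πU - u. The latter is in W and hence an
    -- admissible test function.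
    set e : ℝ → V := fun s => π (U s) - u s with he
    set e' : ℝ → V := fun s => π (U' s) - u' s with he'
    have hec : ContinuousOn e (Icc T.1 T.2) := (π.continuous.comp_continuousOn hUcT).sub huc
    have hec' : ContinuousOn e' (Icc T.1 T.2) :=
      (π.continuous.comp_continuousOn hUcT').sub hu'c.continuousOn
    set ψ' : ℝ → ℝ := fun s => 2 * P.toDualL (e' s) (e s) with hψ'
    have hψc : ContinuousOn ψ (Icc T.1 T.2) :=
      ((P.ι.continuous.comp_continuousOn hec).norm).pow 2
    have hψc' : ContinuousOn ψ' (Icc T.1 T.2) :=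
      continuousOn_const.mul ((P.toDualL.continuous.comp_continuousOn hec').clm_apply hec)
    have hψi' : IntervalIntegrable ψ' volume T.1 T.2 :=
      ContinuousOn.intervalIntegrable (by rwa [uIcc_of_le hlt.le])
    have hψd : ∀ s ∈ Ioo T.1 T.2, HasDerivAt ψ (ψ' s) s := by
      intro s hs
      have h1 : HasDerivAt e (e' s) s :=
        (π.hasFDerivAt.comp_hasDerivAt s (hUd s (hsub' hs))).sub (hud s hs)
      have h2 : HasDerivAt (fun r => P.ι (e r)) (P.ι (e' s)) s :=
        P.ι.hasFDerivAt.comp_hasDerivAt s h1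
      have h3 := h2.norm_sq
      rw [real_inner_comm] at h3
      exact h3
    have hftc := intervalIntegral.integral_eq_sub_of_hasDerivAt_of_le hlt.le hψc hψd hψi'
    -- On the step the Radau polynomial is at most 2/3 |T|², and |T|R² is exactly the squared
    -- indicator.
    set R : ℝ := T.len ^ 2 * (2 / 3) * ‖ρ‖ with hR
    have hmono : ∫ s in T.1..T.2, (‖U s - u s‖ ^ 2 + ‖restr W (P.toDualL (U' s - u' s))‖ ^ 2) ≤
        ∫ s in T.1..T.2, (C * (‖U s - π (U s)‖ ^ 2 +
          ‖restr W (P.toDualL (U' s - π (U' s)))‖ ^ 2) + C * R ^ 2 -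
            (2 + 3 * β ^ 2) / α * ψ' s) := by
      refine intervalIntegral.integral_mono_on_of_le_Ioo hlt.le j₁
        (((j₂.const_mul C).add (by simp)).sub (hψi'.const_mul _)) fun s hs => ?_
      have hsI : s ∈ Icc T.1 T.2 := ⟨hs.1.le, hs.2.le⟩
      have heW : e s ∈ W := W.sub_mem (hπW _) (hu.mem.2 s (hsub hsI))
      set g := restr W (P.toDualL (e' s) + P.A (e s)) with hgdef
      have hgeq : g = restr W (P.f s - P.toDualL (u' s) - P.A (u s)) -
          restr W (P.toDualL (U' s - π (U' s))) - restr W (P.A (U s - π (U s))) := by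
        refine SubDual.ext fun v => ?_
        have h1 := hUe s v (hWW v.2)
        simp only [hgdef, he, he', map_sub, map_add, eval_restr]
        linarith
      have hgn : ‖g‖ ≤ ‖restr W (P.toDualL (U' s - π (U' s)))‖ + β * ‖U s - π (U s)‖ + R := by
        have h1 : ‖restr W (P.f s - P.toDualL (u' s) - P.A (u s))‖ ≤ R := by
          rw [hres s hsI, norm_smul, hR, Real.norm_eq_abs, abs_mul]
          have hl : T.len = T.2 - T.1 := rfl
          have b1 : |s - T.2| ≤ T.len := by
            rw [abs_le]; constructor <;> linarith [hs.1, hs.2]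
          have b2 : |s - T.1 - T.len / 3| ≤ 2 / 3 * T.len := by
            rw [abs_le]; constructor <;> linarith [hs.1, hs.2]
          refine mul_le_mul_of_nonneg_right ?_ (norm_nonneg ρ)
          refine (mul_le_mul b1 b2 (abs_nonneg _) hlen.le).trans (le_of_eq ?_)
          ring
        have h2 := P.norm_restr_A_le hP hβ W (U s - π (U s))
        rw [hgeq]
        refine (norm_sub_le _ _).trans ?_
        have h3 := norm_sub_le (restr W (P.f s - P.toDualL (u' s) - P.A (u s)))
          (restr W (P.toDualL (U' s - π (U' s))))
        linarith
      refine energy_estimate (e := ‖e s‖) (z := ‖restr W (P.toDualL (e' s))‖) (g := ‖g‖)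
        hα (norm_nonneg _) ?_ (norm_nonneg _) ?_ ?_ (norm_nonneg _) hgn ?_ rfl
      · have : U s - u s = (U s - π (U s)) + e s := by simp only [he]; abel
        rw [this]; exact norm_add_le _ _
      · have : U' s - u' s = (U' s - π (U' s)) + e' s := by simp only [he']; abel
        rw [this, map_add, map_add]; exact norm_add_le _ _
      · have : restr W (P.toDualL (e' s)) = g - restr W (P.A (e s)) := by
          rw [hgdef, map_add]; abel
        rw [this]
        exact (norm_sub_le _ _).trans (add_le_add_right (P.norm_restr_A_le hP hβ W _) _)
      · have h1 := hP.1 (e s)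
        have h2 := SubDual.eval_le ⟨e s, heW⟩ g
        have h3 : SubDual.eval ⟨e s, heW⟩ g = P.toDualL (e' s) (e s) + P.A (e s) (e s) := rfl
        simp only [hψ']
        linarith
    rw [intervalIntegral.integral_sub ((j₂.const_mul C).add (by simp)) (hψi'.const_mul _),
      intervalIntegral.integral_add (j₂.const_mul C) (by simp),
      intervalIntegral.integral_const_mul, intervalIntegral.integral_const_mul (r := (2 + 3 * β ^ 2) / α), hftc,
      intervalIntegral.integral_const] at hmono
    rw [hF₁, hF₂]
    dsimp only
    rw [e₁, e₂]
    have h4 : (T.2 - T.1) • (C * R ^ 2) = C * P.indicatorSq W u T := by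
      rw [hind, hR, smul_eq_mul]; simp only [TimeStep.len]; ring
    rw [h4] at hmono
    exact hmono
  obtain ⟨-, s₁⟩ := integral_eq_sum_generated ht hn hg fun T hT => (key T hT).1
  obtain ⟨-, s₂⟩ := integral_eq_sum_generated ht hn hg fun T hT => (key T hT).2.1
  rw [xNorm_sq, xNorm_sq]
  change ∫ s in 0..P.tEnd, F₁ s ≤ C * ((∫ s in 0..P.tEnd, F₂ s) + _)
  rw [s₁, s₂]
  refine (Finset.sum_le_sum fun T hT => (key T hT).2.2).trans ?_
  rw [Finset.sum_sub_distrib, Finset.sum_add_distrib, ← Finset.mul_sum, ← Finset.mul_sum,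
    ← Finset.mul_sum, sum_sub_generated ht hn hg]
  -- Projecting the initial value first onto W' and then onto W equals projecting onto W. The
  -- telescoping energy thus starts at zero, and its nonnegative final value is dropped.
  have h0 : ψ 0 = 0 := by
    have : π (U 0) = u 0 := by
      rw [hU.init, hu.init, hπ]
      exact congrArg (fun L : V →L[ℝ] V => L P.u₀)
        (Submodule.starProjection_comp_starProjection_of_le hWW)
    simp only [hψ, this, sub_self, map_zero, norm_zero]; norm_num
  rw [h0]
  have : 0 ≤ (2 + 3 * β ^ 2) / α * (ψ P.tEnd - 0) := by
    rw [sub_zero]; simp only [hψ]; positivity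
  linarith

end AdaptiveRadau

end

/-! ### Linear equations with quadratic right-hand side -/

noncomputable section

namespace AdaptiveRadau

section LinearODE

variable {E : Type*} [NormedAddCommGroup E] [NormedSpace ℝ E]

/-- The right-hand side of `y' = q - B y` with a quadratic polynomial `q`. -/
def odeRhs (B : E →L[ℝ] E) (q₀ q₁ q₂ : E) (s : ℝ) (x : E) : E :=
  q₀ + s • q₁ + s ^ 2 • q₂ - B x

/-- The second derivative of a solution of `y' = q - B y` in terms of its value. -/
def odeSecond (B : E →L[ℝ] E) (q₀ q₁ q₂ : E) (s : ℝ) (x : E) : E :=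
  q₁ + (2 * s) • q₂ - B (odeRhs B q₀ q₁ q₂ s x)

/-- The third derivative of a solution of `y' = q - B y` in terms of its value. -/
def odeThird (B : E →L[ℝ] E) (q₀ q₁ q₂ : E) (s : ℝ) (x : E) : E :=
  (2 : ℝ) • q₂ - B (odeSecond B q₀ q₁ q₂ s x)

variable {B : E →L[ℝ] E} {q₀ q₁ q₂ : E} {y : ℝ → E} {a b : ℝ}

/-- As a function of the state the third derivative is affine with linear part -B³, so an error in
the state enters with the factor K³. -/
theorem odeThird_sub (s : ℝ) (x x' : E) :
    odeThird B q₀ q₁ q₂ s x - odeThird B q₀ q₁ q₂ s x' = -B (B (B (x - x'))) := by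
  simp only [odeThird, odeSecond, odeRhs, map_sub, map_add, map_smul]
  abel

theorem hasDerivAt_odeRhs {s : ℝ} (hd : HasDerivAt y (odeRhs B q₀ q₁ q₂ s (y s)) s) :
    HasDerivAt (fun r => odeRhs B q₀ q₁ q₂ r (y r)) (odeSecond B q₀ q₁ q₂ s (y s)) s :=
  (hasDerivAt_quadratic q₀ q₁ q₂ s).sub (B.hasFDerivAt.comp_hasDerivAt s hd)

theorem hasDerivAt_odeSecond {s : ℝ} (hd : HasDerivAt y (odeRhs B q₀ q₁ q₂ s (y s)) s) :
    HasDerivAt (fun r => odeSecond B q₀ q₁ q₂ r (y r)) (odeThird B q₀ q₁ q₂ s (y s)) s := by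
  have h2 : HasDerivAt (fun r : ℝ => 2 * r) 2 s := by
    simpa using (hasDerivAt_id s).const_mul (2 : ℝ)
  exact ((h2.smul_const q₂).const_add q₁).sub
    (B.hasFDerivAt.comp_hasDerivAt s (hasDerivAt_odeRhs hd))

/-- Three differentiations remove the quadratic data: the third derivative solves the homogeneous
equation. -/
theorem hasDerivAt_odeThird {s : ℝ} (hd : HasDerivAt y (odeRhs B q₀ q₁ q₂ s (y s)) s) :
    HasDerivAt (fun r => odeThird B q₀ q₁ q₂ r (y r)) (-B (odeThird B q₀ q₁ q₂ s (y s))) s :=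
  (B.hasFDerivAt.comp_hasDerivAt s (hasDerivAt_odeSecond hd)).const_sub _

theorem continuousOn_odeRhs {I : Set ℝ} (hc : ContinuousOn y I) :
    ContinuousOn (fun r => odeRhs B q₀ q₁ q₂ r (y r)) I :=
  ContinuousOn.sub (by fun_prop) (B.continuous.comp_continuousOn hc)

theorem continuousOn_odeSecond {I : Set ℝ} (hc : ContinuousOn y I) :
    ContinuousOn (fun r => odeSecond B q₀ q₁ q₂ r (y r)) I :=
  ContinuousOn.sub (by fun_prop) (B.continuous.comp_continuousOn (continuousOn_odeRhs hc))

theorem continuousOn_odeThird {I : Set ℝ} (hc : ContinuousOn y I) :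
    ContinuousOn (fun r => odeThird B q₀ q₁ q₂ r (y r)) I :=
  ContinuousOn.sub (by fun_prop) (B.continuous.comp_continuousOn (continuousOn_odeSecond hc))

/-- Grönwall forwards and backwards for the homogeneous equation: on one initial step the third
derivative is either nowhere zero, with comparable norms throughout, or identically zero. -/
theorem norm_odeThird_le {K : ℝ} (hK : 0 ≤ K) (hB : ∀ x, ‖B x‖ ≤ K * ‖x‖)
    (hc : ContinuousOn y (Icc a b))
    (hd : ∀ s ∈ Ioo a b, HasDerivAt y (odeRhs B q₀ q₁ q₂ s (y s)) s) {s r : ℝ}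
    (hs : s ∈ Icc a b) (hr : r ∈ Icc a b) :
    ‖odeThird B q₀ q₁ q₂ s (y s)‖ ≤
      Real.exp (K * (b - a)) * ‖odeThird B q₀ q₁ q₂ r (y r)‖ := by
  refine (norm_le_exp_abs_mul hK (continuousOn_odeThird hc)
    (fun x hx => hasDerivAt_odeThird (hd x hx)) (fun x _ => ?_) hs hr).trans ?_
  · rw [norm_neg]; exact hB _
  · gcongr
    rw [abs_le]; constructor <;> linarith [hs.1, hs.2, hr.1, hr.2]

/-- The leading coefficient of the residual on a time step is controlled by the third derivative of
the exact solution and by the error in the left end point. -/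
theorem norm_residual_coeff_le {K Cs h ε : ℝ} (hK : 0 ≤ K) (hB : ∀ x, ‖B x‖ ≤ K * ‖x‖)
    (hCs : 0 ≤ Cs)
    (hS : ∀ x, ‖x‖ ≤ Cs * ‖x + (2 / 3 * h) • B x + (h ^ 2 / 6) • B (B x)‖)
    {Y₀ Y₁ Y₂ ρ x : E} {s : ℝ}
    (h₀ : q₀ + s • q₁ + s ^ 2 • q₂ - Y₁ - B Y₀ = (h ^ 2 / 3) • ρ)
    (h₁ : q₁ + (2 * s) • q₂ - Y₂ - B Y₁ = (-(4 / 3 * h)) • ρ)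
    (h₂ : (2 : ℝ) • q₂ - B Y₂ = (2 : ℝ) • ρ) (hε : ‖x - Y₀‖ ≤ ε) :
    ‖ρ‖ ≤ Cs / 2 * (‖odeThird B q₀ q₁ q₂ s x‖ + K ^ 3 * ε) := by
  have e₀ : q₀ + s • q₁ + s ^ 2 • q₂ - B Y₀ = Y₁ + (h ^ 2 / 3) • ρ := by rw [← h₀]; abel
  have e₁ : q₁ + (2 * s) • q₂ - B Y₁ = Y₂ + (-(4 / 3 * h)) • ρ := by rw [← h₁]; abel
  -- Inserting the residual and its two derivatives at the left end successively produces the Radau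
  -- denominator applied to ρ, which `hS` inverts stably.
  have e : odeThird B q₀ q₁ q₂ s Y₀ = (2 : ℝ) • (ρ + (2 / 3 * h) • B ρ + (h ^ 2 / 6) • B (B ρ)) := by
    have a1 : odeRhs B q₀ q₁ q₂ s Y₀ = Y₁ + (h ^ 2 / 3) • ρ := e₀
    have a2 : odeSecond B q₀ q₁ q₂ s Y₀ = Y₂ + (-(4 / 3 * h)) • ρ - (h ^ 2 / 3) • B ρ := by
      rw [odeSecond, a1, map_add, map_smul, ← e₁]; abel
    rw [odeThird, a2]
    simp only [map_sub, map_add, map_smul]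
    have a3 : (2 : ℝ) • q₂ = (2 : ℝ) • ρ + B Y₂ := by rw [← h₂]; abel
    rw [a3]
    module
  have hρ := hS ρ
  have n1 : ‖odeThird B q₀ q₁ q₂ s Y₀‖ =
      2 * ‖ρ + (2 / 3 * h) • B ρ + (h ^ 2 / 6) • B (B ρ)‖ := by
    rw [e, norm_smul]; norm_num
  have n2 : ‖odeThird B q₀ q₁ q₂ s Y₀‖ ≤ ‖odeThird B q₀ q₁ q₂ s x‖ + K ^ 3 * ε := by
    have h3 := odeThird_sub (B := B) (q₀ := q₀) (q₁ := q₁) (q₂ := q₂) s x Y₀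
    have h4 : odeThird B q₀ q₁ q₂ s Y₀ = odeThird B q₀ q₁ q₂ s x + B (B (B (x - Y₀))) := by
      rw [← sub_eq_iff_eq_add', ← neg_sub, h3, neg_neg]
    rw [h4]
    refine (norm_add_le _ _).trans ?_
    gcongr
    calc ‖B (B (B (x - Y₀)))‖ ≤ K * (K * (K * ε)) := by
          refine (hB _).trans ?_
          gcongr
          refine (hB _).trans ?_
          gcongr
          exact (hB _).trans (by gcongr)
      _ = K ^ 3 * ε := by ring
  calc ‖ρ‖ ≤ Cs * ‖ρ + (2 / 3 * h) • B ρ + (h ^ 2 / 6) • B (B ρ)‖ := hρ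
    _ = Cs / 2 * ‖odeThird B q₀ q₁ q₂ s Y₀‖ := by rw [n1]; ring
    _ ≤ _ := by gcongr

/-- Lower bound for the error of the best approximation of the derivative of a solution by affine
functions on a part of the interval. -/
theorem le_integral_odeRhs_sub_affine {K Λ m a' b' : ℝ} (hK : 0 ≤ K)
    (hB : ∀ x, ‖B x‖ ≤ K * ‖x‖) (hΛ : K * (b - a) ≤ Λ) (hm : 0 ≤ m)
    (hc : ContinuousOn y (Icc a b))
    (hd : ∀ s ∈ Ioo a b, HasDerivAt y (odeRhs B q₀ q₁ q₂ s (y s)) s)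
    (ha : a ≤ a') (hab : a' < b') (hb : b' ≤ b)
    (hmw : m ≤ ‖odeThird B q₀ q₁ q₂ a (y a)‖) (p₀ p₁ : E) :
    (b' - a') ^ 5 * m ^ 2 * ((4 * Λ * Real.exp Λ + 3)⁻¹ ^ 5 * Real.exp (-Λ) ^ 2 / 24) ≤
      ∫ s in a'..b', ‖odeRhs B q₀ q₁ q₂ s (y s) - (p₀ + s • p₁)‖ ^ 2 := by
  have hΛ0 : 0 ≤ Λ := le_trans (mul_nonneg hK (by linarith)) hΛ
  -- The choice gives 3κ ≤ 1, so three shifts fit, and 2κΛe^Λ ≤ 1/2, so over two shifts the third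
  -- derivative varies by at most half its norm.
  set κ := (4 * Λ * Real.exp Λ + 3)⁻¹ with hκ
  have hκ0 : 0 < κ := by positivity
  have hκ' : κ * (4 * Λ * Real.exp Λ + 3) = 1 := inv_mul_cancel₀ (by positivity)
  have hκ3 : 3 * κ ≤ 1 := by
    have : 0 ≤ κ * (4 * Λ * Real.exp Λ) := by positivity
    linarith
  have hκΛ : 2 * κ * Λ * Real.exp Λ ≤ 1 / 2 := by linarith
  have hl : 0 < b' - a' := sub_pos.2 hab
  have hIcc : Icc a' b' ⊆ Icc a b := Icc_subset_Icc ha hb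
  have hIoo : Ioo a' b' ⊆ Ioo a b := Ioo_subset_Ioo ha hb
  set w : ℝ → E := fun s => odeThird B q₀ q₁ q₂ s (y s) with hw
  have hbound : ∀ s ∈ Icc a b, ∀ r ∈ Icc a b, ‖w s‖ ≤ Real.exp Λ * ‖w r‖ := fun s hs r hr =>
    (norm_odeThird_le hK hB hc hd hs hr).trans (by gcongr)
  have ha_mem : a ∈ Icc a b := ⟨le_rfl, by linarith⟩
  have main := le_integral_norm_sub_affine_sq (g₁ := fun s => odeRhs B q₀ q₁ q₂ s (y s))
    (g₂ := fun s => odeSecond B q₀ q₁ q₂ s (y s)) (w := w) (a := a') (b := b')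
    (k := κ * (b' - a')) (m := Real.exp (-Λ) * m) (by positivity) (by nlinarith) (by positivity)
    (continuousOn_odeRhs (hc.mono hIcc)) (fun s hs => hasDerivAt_odeRhs (hd s (hIoo hs)))
    (fun s hs => hasDerivAt_odeSecond (hd s (hIoo hs))) ?_ ?_ p₀ p₁
  · refine le_trans (le_of_eq ?_) main
    ring
  · intro x hx s hs hsx
    have h1 := Convex.norm_image_sub_le_of_norm_hasDerivWithin_le (f := w)
      (f' := fun s => -B (w s)) (s := Ioo a' b') (C := K * (Real.exp Λ * ‖w x‖))
      (x := x) (y := s) (fun r hr => (hasDerivAt_odeThird (hd r (hIoo hr))).hasDerivWithinAt)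
      (fun r hr => ?_) (convex_Ioo _ _) hx hs
    · refine h1.trans ?_
      rw [Real.norm_eq_abs]
      have h2 : K * (b' - a') ≤ Λ := (mul_le_mul_of_nonneg_left (by linarith) hK).trans hΛ
      calc K * (Real.exp Λ * ‖w x‖) * |s - x|
          ≤ K * (Real.exp Λ * ‖w x‖) * (2 * (κ * (b' - a'))) := by gcongr
        _ = (K * (b' - a')) * (2 * κ * Real.exp Λ * ‖w x‖) := by ring
        _ ≤ Λ * (2 * κ * Real.exp Λ * ‖w x‖) := by gcongr
        _ = (2 * κ * Λ * Real.exp Λ) * ‖w x‖ := by ring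
        _ ≤ 1 / 2 * ‖w x‖ := by gcongr
        _ = ‖w x‖ / 2 := by ring
    · rw [norm_neg]
      refine (hB _).trans ?_
      gcongr
      exact hbound r (Ioo_subset_Icc_self (hIoo hr)) x (Ioo_subset_Icc_self (hIoo hx))
  · intro x hx
    have h1 := hbound a ha_mem x (Ioo_subset_Icc_self (hIoo hx))
    calc Real.exp (-Λ) * m ≤ Real.exp (-Λ) * (Real.exp Λ * ‖w x‖) := by
          gcongr; exact hmw.trans h1
      _ = ‖w x‖ := by rw [← mul_assoc, ← Real.exp_add]; simp

end LinearODE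

/-- A discrete Grönwall inequality along a time mesh. -/
theorem IsTriadic.gronwall {h : ℝ} (hh : 0 < h) {n : ℕ} {𝒯 : TimeMesh} (H : IsTriadic h n 𝒯)
    {ε : ℝ → ℝ} {κ : ℝ} (hκ : 0 ≤ κ) {d : TimeStep → ℝ} (hd : ∀ T ∈ 𝒯, 0 ≤ d T) (h0 : ε 0 = 0)
    (hstep : ∀ T ∈ 𝒯, ε T.2 ≤ Real.exp (κ * T.len) * (ε T.1 + d T)) {T : TimeStep} (hT : T ∈ 𝒯) :
    ε T.1 ≤ Real.exp (κ * T.1) * ∑ S ∈ 𝒯 with S.2 ≤ T.1, d S := by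
  classical
  have hnn : ∀ (T : TimeStep), 0 ≤ ∑ S ∈ 𝒯 with S.2 ≤ T.1, d S := fun T =>
    Finset.sum_nonneg fun S hS => hd S (Finset.mem_filter.1 hS).1
  -- Induction on the number of steps to the left; `exists_left` supplies the predecessor.
  suffices hmain : ∀ m : ℕ, ∀ T ∈ 𝒯, (𝒯.filter fun S => S.1 < T.1).card ≤ m →
      ε T.1 ≤ Real.exp (κ * T.1) * ∑ S ∈ 𝒯 with S.2 ≤ T.1, d S from hmain _ T hT le_rfl
  intro m
  induction m with
  | zero =>
    intro T hT hcard
    rcases H.exists_left T hT with h1 | ⟨S, hS, hS'⟩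
    · have := hnn T
      rw [h1, h0] at *; positivity
    · exfalso
      have : S ∈ 𝒯.filter fun S => S.1 < T.1 :=
        Finset.mem_filter.2 ⟨hS, hS' ▸ H.lt hh hS⟩
      rw [Nat.le_zero, Finset.card_eq_zero] at hcard
      rw [hcard] at this
      simp at this
  | succ m ih =>
    intro T hT hcard
    rcases H.exists_left T hT with h1 | ⟨S, hS, hS'⟩
    · have := hnn T
      rw [h1, h0] at *; positivity
    · have hlt := H.lt hh hS
      have hi := ih S hS (by
        have hss : (𝒯.filter fun R => R.1 < S.1) ⊂ 𝒯.filter fun R => R.1 < T.1 := by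
          rw [Finset.ssubset_iff_of_subset]
          · exact ⟨S, Finset.mem_filter.2 ⟨hS, hS' ▸ hlt⟩, by simp⟩
          · intro R hR
            rw [Finset.mem_filter] at hR ⊢
            exact ⟨hR.1, by linarith [hR.2]⟩
        have := Finset.card_lt_card hss
        omega)
      rw [← hS']
      refine (hstep S hS).trans ?_
      have hsum : ∑ R ∈ 𝒯 with R.2 ≤ S.1, d R + d S ≤ ∑ R ∈ 𝒯 with R.2 ≤ S.2, d R := by
        have hnot : S ∉ 𝒯.filter fun R => R.2 ≤ S.1 := by
          rw [Finset.mem_filter]; intro h; linarith [h.2]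
        rw [add_comm, ← Finset.sum_insert hnot]
        refine Finset.sum_le_sum_of_subset_of_nonneg ?_ fun R hR _ => hd R (Finset.mem_filter.1 hR).1
        intro R hR
        rcases Finset.mem_insert.1 hR with rfl | hR
        · exact Finset.mem_filter.2 ⟨hS, le_rfl⟩
        · rw [Finset.mem_filter] at hR ⊢
          exact ⟨hR.1, by linarith [hR.2]⟩
      have hS1 := (H.bounds hh hS).1
      have hexp : Real.exp (κ * S.2) = Real.exp (κ * S.len) * Real.exp (κ * S.1) := by
        rw [← Real.exp_add]; congr 1; simp only [TimeStep.len]; ring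
      have h1e : 1 ≤ Real.exp (κ * S.1) := Real.one_le_exp (by positivity)
      have hdS := hd S hS
      calc Real.exp (κ * S.len) * (ε S.1 + d S)
          ≤ Real.exp (κ * S.len) * (Real.exp (κ * S.1) * (∑ R ∈ 𝒯 with R.2 ≤ S.1, d R) +
              Real.exp (κ * S.1) * d S) := by
            gcongr
            exact le_mul_of_one_le_left hdS h1e
        _ = Real.exp (κ * S.2) * (∑ R ∈ 𝒯 with R.2 ≤ S.1, d R + d S) := by rw [hexp]; ring
        _ ≤ _ := by gcongr

/-- A bound uniform in the position of the step, which then feeds into every local indicator bound.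
-/
theorem IsTriadic.gronwall_sum {h : ℝ} (hh : 0 < h) {n : ℕ} {𝒯 : TimeMesh} (H : IsTriadic h n 𝒯)
    {ε : ℝ → ℝ} {κ : ℝ} (hκ : 0 ≤ κ) {d : TimeStep → ℝ} (hd : ∀ T ∈ 𝒯, 0 ≤ d T) (h0 : ε 0 = 0)
    (hstep : ∀ T ∈ 𝒯, ε T.2 ≤ Real.exp (κ * T.len) * (ε T.1 + d T)) {T : TimeStep} (hT : T ∈ 𝒯) :
    ε T.1 ≤ Real.exp (κ * (h * n)) * ∑ S ∈ 𝒯, d S := by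
  refine (H.gronwall hh hκ hd h0 hstep hT).trans ?_
  have h1 := (H.lt hh hT).le.trans (H.bounds hh hT).2
  exact mul_le_mul (Real.exp_le_exp.2 (mul_le_mul_of_nonneg_left h1 hκ))
    (Finset.sum_le_sum_of_subset_of_nonneg (Finset.filter_subset _ _) fun S hS _ => hd S hS)
    (Finset.sum_nonneg fun S hS => hd S (Finset.mem_filter.1 hS).1) (Real.exp_pos _).le

end AdaptiveRadau

end

/-! ### Two-sided bounds by weights on the initial mesh -/

noncomputable section

namespace AdaptiveRadau

/-- The index of the time step of the uniform mesh with step size `h` that contains `T`. -/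
def stepIndex (h : ℝ) (T : TimeStep) : ℕ := ⌊T.1 / h⌋₊

theorem stepIndex_eq {h : ℝ} (hh : 0 < h) {T : TimeStep} {i : ℕ} (h1 : h * i ≤ T.1)
    (h2 : T.1 < h * (i + 1)) : stepIndex h T = i := by
  have h0 : 0 ≤ T.1 / h := div_nonneg (le_trans (by positivity) h1) hh.le
  rw [stepIndex, Nat.floor_eq_iff h0, le_div_iff₀ hh, div_lt_iff₀ hh]
  constructor <;> linarith

theorem IsTriadic.stepIndex_spec {h : ℝ} (hh : 0 < h) {n : ℕ} {𝒯 : TimeMesh}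
    (H : IsTriadic h n 𝒯) {T : TimeStep} (hT : T ∈ 𝒯) :
    stepIndex h T < n ∧ h * stepIndex h T ≤ T.1 ∧ T.2 ≤ h * (stepIndex h T + 1) := by
  obtain ⟨i, hi, h1, h2⟩ := H.exists_sub T hT
  rw [stepIndex_eq hh h1 ((H.lt hh hT).trans_le h2)]
  exact ⟨hi, h1, h2⟩

theorem IsTriadic.stepIndex_child {h : ℝ} (hh : 0 < h) {n : ℕ} {𝒯 : TimeMesh}
    (H : IsTriadic h n 𝒯) {T S : TimeStep} (hT : T ∈ 𝒯) (hS : S ∈ T.children) :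
    stepIndex h S = stepIndex h T := by
  obtain ⟨-, h1, h2⟩ := H.stepIndex_spec hh hT
  obtain ⟨a, b, c⟩ := TimeStep.child_bounds (H.len_pos hh hT) hS
  exact stepIndex_eq hh (h1.trans a) (by linarith)

/-- The constant in the local upper bound of the error indicators. -/
def upperConst (Λ Cs : ℝ) : ℝ :=
  2 / 9 * Cs ^ 2 * (Real.exp Λ ^ 2 +
    Λ ^ 6 * (Real.exp (Λ + Λ ^ 3 * Cs / 3) * (Cs * Real.exp Λ / 3)) ^ 2)

/-- The constant in the lower bound of the best approximation error. -/
def lowerConst (Λ : ℝ) : ℝ := (4 * Λ * Real.exp Λ + 3)⁻¹ ^ 5 * Real.exp (-Λ) ^ 2 / 24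

variable {V H : Type*} [NormedAddCommGroup V] [InnerProductSpace ℝ V]
  [NormedAddCommGroup H] [InnerProductSpace ℝ H] {P : ParabolicProblem V H}
  [FiniteDimensional ℝ V]

set_option maxHeartbeats 1000000 in
/-- Weights on the initial mesh, given by the third derivative of the solution, that describe the
size of the error indicators and of the best approximation errors. -/
theorem exists_weight {α β L : ℝ} (hα : 0 < α) (hβ : 0 < β) (hP : P.IsElliptic α β) (hL : 0 ≤ L)
    {n : ℕ} (hn : 1 ≤ n) (hf : IsSpline P.tEnd (TimeMesh.uniform P.tEnd n) P.f)
    {W : Submodule ℝ V} (hW : ∀ v ∈ W, P.tEnd * ‖v‖ ^ 2 ≤ L * ‖P.ι v‖ ^ 2) {U : ℝ → V}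
    (hU : P.IsSolution W U) :
    ∃ ω : ℕ → ℝ, (∀ i, 0 ≤ ω i) ∧
      (∀ 𝒯, TimeMesh.GeneratedFrom (TimeMesh.uniform P.tEnd n) 𝒯 → ∀ u,
        P.IsDiscreteSolution W 𝒯 u → ∀ T ∈ 𝒯,
        P.indicatorSq W u T ≤ upperConst (β * L) (β / α) * T.len ^ 5 *
          (ω (stepIndex (P.tEnd / n) T) ^ 2 +
            (∑ S ∈ 𝒯, S.len ^ 5 * ω (stepIndex (P.tEnd / n) S) ^ 2) / P.tEnd ^ 5)) ∧
      ∀ 𝒯, TimeMesh.GeneratedFrom (TimeMesh.uniform P.tEnd n) 𝒯 → ∀ v ∈ P.ansatz W 𝒯,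
        lowerConst (β * L) * ∑ S ∈ 𝒯, S.len ^ 5 * ω (stepIndex (P.tEnd / n) S) ^ 2 ≤
          P.xNorm W (fun t => U t - v t) ^ 2 := by
  have ht := P.tEnd_pos
  have hn' : (0 : ℝ) < n := by exact_mod_cast hn
  set h₀ : ℝ := P.tEnd / n with hh₀
  have hh : 0 < h₀ := by positivity
  have hh₀n : h₀ * n = P.tEnd := by rw [hh₀]; field_simp
  have hh₀t : h₀ ≤ P.tEnd := div_le_self ht.le (by exact_mod_cast hn)
  have tri0 := isTriadic_uniform ht hn
  set Λ := β * L with hΛ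
  have hΛ0 : 0 ≤ Λ := by positivity
  set Cs := β / α with hCs
  have hCs0 : 0 ≤ Cs := by positivity
  set K := Λ / P.tEnd with hK
  have hK0 : 0 ≤ K := by positivity
  have hKt : K * P.tEnd = Λ := by rw [hK]; field_simp
  obtain ⟨B, hBA, hB, hS⟩ := P.exists_operator hα hβ hP hL W hW
  obtain ⟨U', hUc, hUc', hUd, hU'W, hUe⟩ := hU.exists_deriv hf.1
  -- The guard i < n sits inside, so that coefficients can be chosen for all natural numbers; beyond
  -- the mesh they are irrelevant.
  have hquad : ∀ i : ℕ, ∃ c : (V →L[ℝ] ℝ) × (V →L[ℝ] ℝ) × (V →L[ℝ] ℝ), i < n →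
      ∀ r ∈ Icc (h₀ * i) (h₀ * (i + 1)), P.f r = c.1 + r • c.2.1 + r ^ 2 • c.2.2 := by
    intro i
    by_cases hi : i < n
    · obtain ⟨c₀, c₁, c₂, hc⟩ := exists_quadratic_on hf (T := (h₀ * i, h₀ * (i + 1)))
        ⟨i, hi, le_rfl, le_rfl⟩
      exact ⟨(c₀, c₁, c₂), fun _ => hc⟩
    · exact ⟨0, fun h => absurd h hi⟩
  choose c hc using hquad
  set y : ℝ → SubDual W := fun s => restr W (P.toDualL (U s)) with hy
  have hyc : ContinuousOn y (Icc 0 P.tEnd) :=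
    ((restr W).comp P.toDualL).continuous.comp_continuousOn hUc
  have hIcc : ∀ i < n, Icc (h₀ * i) (h₀ * ((i : ℝ) + 1)) ⊆ Icc 0 P.tEnd := by
    intro i hi
    have : (i : ℝ) + 1 ≤ n := by exact_mod_cast hi
    refine Icc_subset_Icc (by positivity) ?_
    rw [← hh₀n]; gcongr
  have hIoo : ∀ i < n, Ioo (h₀ * i) (h₀ * ((i : ℝ) + 1)) ⊆ Ioo 0 P.tEnd := by
    intro i hi
    have : (i : ℝ) + 1 ≤ n := by exact_mod_cast hi
    refine Ioo_subset_Ioo (by positivity) ?_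
    rw [← hh₀n]; gcongr
  set q₀ : ℕ → SubDual W := fun i => restr W (c i).1 with hq₀
  set q₁ : ℕ → SubDual W := fun i => restr W (c i).2.1 with hq₁
  set q₂ : ℕ → SubDual W := fun i => restr W (c i).2.2 with hq₂
  have hU'eq : ∀ i < n, ∀ s ∈ Icc (h₀ * i) (h₀ * ((i : ℝ) + 1)),
      restr W (P.toDualL (U' s)) = odeRhs B (q₀ i) (q₁ i) (q₂ i) s (y s) := by
    intro i hi s hs
    have h1 : restr W (P.toDualL (U' s)) = restr W (P.f s) - restr W (P.A (U s)) := by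
      refine SubDual.ext fun v => ?_
      have := hUe s v v.2
      simp only [map_sub, eval_restr]; linarith
    rw [h1, hc i hi s hs, ← hBA (U s) (hU.mem s (hIcc i hi hs))]
    simp only [odeRhs, hq₀, hq₁, hq₂, hy, map_add, map_smul]
  have hyd : ∀ i < n, ∀ s ∈ Ioo (h₀ * i) (h₀ * ((i : ℝ) + 1)),
      HasDerivAt y (odeRhs B (q₀ i) (q₁ i) (q₂ i) s (y s)) s := by
    intro i hi s hs
    rw [← hU'eq i hi s ⟨hs.1.le, hs.2.le⟩]
    exact ((restr W).comp P.toDualL).hasFDerivAt.comp_hasDerivAt s (hUd s (hIoo i hi hs))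
  set ω : ℕ → ℝ := fun i => ‖odeThird B (q₀ i) (q₁ i) (q₂ i) (h₀ * i) (y (h₀ * i))‖ with hω
  have hKh : ∀ i : ℕ, K * (h₀ * ((i : ℝ) + 1) - h₀ * i) ≤ Λ := by
    intro i
    have : h₀ * ((i : ℝ) + 1) - h₀ * i = h₀ := by ring
    rw [this, ← hKt]; gcongr
  refine ⟨ω, fun i => norm_nonneg _, ?_, ?_⟩
  · intro 𝒯 hg u hu
    have tri := tri0.generated hh hg
    set e : ℝ → SubDual W := fun s => restr W (P.toDualL (U s - u s)) with he
    have hec : ContinuousOn e (Icc 0 P.tEnd) :=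
      ((restr W).comp P.toDualL).continuous.comp_continuousOn (hUc.sub hu.mem.1.1)
    have he0 : ‖e 0‖ = 0 := by
      simp only [he, hU.init, hu.init, sub_self, map_zero, norm_zero]
    -- The second summand accounts for the feedback of the current error into ρ: it contributes
    -- (K|T|)³Cs/3 to the growth factor, at most Λ²Cs/3 · K|T|.
    set κ := K + K * (Λ ^ 2 * Cs / 3) with hκ
    have hκ0 : 0 ≤ κ := by positivity
    set d : TimeStep → ℝ := fun T => T.len ^ 3 * (Cs * Real.exp Λ / 3 * ω (stepIndex h₀ T)) with hd
    have hωnn : ∀ i, 0 ≤ ω i := fun i => norm_nonneg _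
    have hdnn : ∀ T ∈ 𝒯, 0 ≤ d T := fun T hT => by
      have := (tri.len_pos hh hT).le
      have := hωnn (stepIndex h₀ T)
      positivity
    have local_bound : ∀ T ∈ 𝒯, ∃ r : ℝ, 0 ≤ r ∧ P.indicatorSq W u T = 4 / 9 * T.len ^ 5 * r ^ 2 ∧
        r ≤ Cs / 2 * (Real.exp Λ * ω (stepIndex h₀ T) + K ^ 3 * ‖e T.1‖) ∧
        ‖e T.2‖ ≤ Real.exp (K * T.len) * (‖e T.1‖ + T.len ^ 2 * (2 / 3) * r * T.len) := by
      intro T hT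
      obtain ⟨hi, hi1, hi2⟩ := tri.stepIndex_spec hh hT
      set i := stepIndex h₀ T with hidx
      have hlt := tri.lt hh hT
      have hlen := tri.len_pos hh hT
      have hsubI : Icc T.1 T.2 ⊆ Icc (h₀ * i) (h₀ * ((i : ℝ) + 1)) := Icc_subset_Icc hi1 hi2
      have hsub := hsubI.trans (hIcc i hi)
      have hsub' : Ioo T.1 T.2 ⊆ Ioo 0 P.tEnd :=
        (Ioo_subset_Ioo hi1 hi2).trans (hIoo i hi)
      obtain ⟨a₁, m₁, a₂, m₂, ρ, hud, hres, hind, hres₁, hres₂⟩ := exists_residual hlt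
        (fun r hr => hc i hi r (hsubI hr)) (hu.mem.1.2 T hT)
        (fun r hr => hu.mem.2 r (hsub hr)) (hu.mean T hT) (hu.point T hT)
      refine ⟨‖ρ‖, norm_nonneg _, hind, ?_, ?_⟩
      · have hT1 : T.1 ∈ Icc T.1 T.2 := left_mem_Icc.2 hlt.le
        have hB₂ : ∀ v ∈ W, restr W (P.A v) = B (restr W (P.toDualL v)) := fun v hv =>
          (hBA v hv).symm
        have key := norm_residual_coeff_le (q₀ := q₀ i) (q₁ := q₁ i) (q₂ := q₂ i) (s := T.1)
          (x := y T.1) (Y₀ := restr W (P.toDualL (u T.1)))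
          (Y₁ := restr W (P.toDualL (a₁ + (2 * T.1) • a₂)))
          (Y₂ := restr W (P.toDualL ((2 : ℝ) • a₂))) (ρ := ρ) (ε := ‖e T.1‖)
          hK0 (fun x => (hB x)) hCs0 (fun x => hS x T.len hlen.le) ?_ ?_ ?_ ?_
        · refine key.trans ?_
          gcongr
          refine (norm_odeThird_le hK0 hB (hyc.mono (hIcc i hi)) (hyd i hi) (hsubI hT1)
            (left_mem_Icc.2 (by nlinarith))).trans ?_
          gcongr
          exact hKh i
        · rw [← hB₂ _ (hu.mem.2 _ (hsub hT1))]
          have := hres T.1 hT1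
          rw [hc i hi _ (hsubI hT1)] at this
          simp only [map_sub, map_add, map_smul] at this ⊢
          simp only [hq₀, hq₁, hq₂]
          rw [this]
          congr 1
          simp only [TimeStep.len]; ring
        · rw [← hB₂ _ (W.add_mem m₁ (W.smul_mem _ m₂))]
          have := hres₁ T.1
          simp only [map_sub, map_add, map_smul] at this ⊢
          simp only [hq₁, hq₂]
          rw [this]
          congr 1
          simp only [TimeStep.len]; ring
        · rw [← hB₂ _ (W.smul_mem _ m₂), ← hres₂]
          simp only [hq₂, map_sub, map_smul]
        · simp only [he, map_sub]; exact le_rfl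
      · have hge := norm_le_exp_mul (e := e)
          (e' := fun s => restr W (P.toDualL (U' s - (a₁ + (2 * s) • a₂)))) (K := K)
          (ε := T.len ^ 2 * (2 / 3) * ‖ρ‖) hlt.le hK0 (by positivity) (hec.mono hsub) ?_ ?_
        · exact hge
        · intro s hs
          exact ((restr W).comp P.toDualL).hasFDerivAt.comp_hasDerivAt s
            ((hUd s (hsub' hs)).sub (hud s hs))
        · intro s hs
          have hsI : s ∈ Icc T.1 T.2 := ⟨hs.1.le, hs.2.le⟩
          have hsW : U s - u s ∈ W := W.sub_mem (hU.mem s (hsub hsI)) (hu.mem.2 s (hsub hsI))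
          have h1 : restr W (P.toDualL (U' s - (a₁ + (2 * s) • a₂))) =
              restr W (P.f s - P.toDualL (a₁ + (2 * s) • a₂) - P.A (u s)) - B (e s) := by
            simp only [he]
            rw [hBA _ hsW]
            refine SubDual.ext fun v => ?_
            have := hUe s v v.2
            simp only [map_sub, eval_restr]
            linarith
          rw [h1, hres s hsI]
          have hl : T.len = T.2 - T.1 := rfl
          have b1 : |s - T.2| ≤ T.len := by
            rw [abs_le]; constructor <;> linarith [hs.1, hs.2]
          have b2 : |s - T.1 - T.len / 3| ≤ 2 / 3 * T.len := by
            rw [abs_le]; constructor <;> linarith [hs.1, hs.2]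
          have b3 : ‖((s - T.2) * (s - T.1 - T.len / 3)) • ρ‖ ≤ T.len ^ 2 * (2 / 3) * ‖ρ‖ := by
            rw [norm_smul, Real.norm_eq_abs, abs_mul]
            refine mul_le_mul_of_nonneg_right ?_ (norm_nonneg ρ)
            refine (mul_le_mul b1 b2 (abs_nonneg _) hlen.le).trans (le_of_eq ?_)
            ring
          refine (norm_sub_le _ _).trans ?_
          have := hB (e s)
          linarith
    have hstep : ∀ T ∈ 𝒯, ‖e T.2‖ ≤ Real.exp (κ * T.len) * (‖e T.1‖ + d T) := by
      intro T hT
      obtain ⟨r, hr0, -, hr, hT2⟩ := local_bound T hT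
      have hlen := tri.len_pos hh hT
      have hlt : T.len ≤ P.tEnd := by
        have := tri.bounds hh hT
        rw [hh₀n] at this
        simp only [TimeStep.len]; linarith
      have hKl : K * T.len ≤ Λ := by rw [← hKt]; gcongr
      have hKl0 : 0 ≤ K * T.len := by positivity
      set x := K * (Λ ^ 2 * Cs / 3) * T.len with hx
      have hx0 : 0 ≤ x := by positivity
      have h3 : (K * T.len) ^ 3 * Cs / 3 ≤ x := by
        calc (K * T.len) ^ 3 * Cs / 3 = (K * T.len) ^ 2 * (K * T.len) * Cs / 3 := by ring
          _ ≤ Λ ^ 2 * (K * T.len) * Cs / 3 := by gcongr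
          _ = x := by rw [hx]; ring
      have h4 : ‖e T.1‖ + T.len ^ 2 * (2 / 3) * r * T.len ≤ Real.exp x * (‖e T.1‖ + d T) := by
        have e1 := Real.add_one_le_exp x
        have hdT := hdnn T hT
        calc ‖e T.1‖ + T.len ^ 2 * (2 / 3) * r * T.len
            ≤ ‖e T.1‖ + T.len ^ 2 * (2 / 3) *
                (Cs / 2 * (Real.exp Λ * ω (stepIndex h₀ T) + K ^ 3 * ‖e T.1‖)) * T.len := by gcongr
          _ = (1 + (K * T.len) ^ 3 * Cs / 3) * ‖e T.1‖ + d T := by rw [hd]; ring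
          _ ≤ Real.exp x * ‖e T.1‖ + Real.exp x * d T := by
            gcongr
            · linarith
            · exact le_mul_of_one_le_left hdT (by linarith)
          _ = _ := by ring
      have h5 : Real.exp (κ * T.len) = Real.exp (K * T.len) * Real.exp x := by
        rw [← Real.exp_add, hκ, hx]; congr 1; ring
      rw [h5, mul_assoc]
      exact hT2.trans (by gcongr)
    intro T hT
    obtain ⟨r, hr0, hind, hr, -⟩ := local_bound T hT
    have hlen := tri.len_pos hh hT
    have hG := tri.gronwall_sum hh (ε := fun s => ‖e s‖) hκ0 hdnn he0 hstep hT
    rw [hh₀n] at hG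
    have hκt : κ * P.tEnd = Λ + Λ ^ 3 * Cs / 3 := by
      rw [hκ, add_mul, hKt, show K * (Λ ^ 2 * Cs / 3) * P.tEnd = K * P.tEnd * (Λ ^ 2 * Cs / 3) by ring,
        hKt]
      ring
    rw [hκt] at hG
    set Q := ∑ S ∈ 𝒯, S.len ^ 5 * ω (stepIndex h₀ S) ^ 2 with hQ
    -- Cauchy–Schwarz with |S|³ω = |S|^{1/2} · |S|^{5/2}ω turns the accumulated local errors into
    -- t_end Q.
    have hcs : (∑ S ∈ 𝒯, d S) ^ 2 ≤ (Cs * Real.exp Λ / 3) ^ 2 * (P.tEnd * Q) := by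
      have h1 := Finset.sum_sq_le_sum_mul_sum_of_sq_le_mul 𝒯
        (r := fun S => S.len ^ 3 * ω (stepIndex h₀ S)) (f := fun S => S.len)
        (g := fun S => S.len ^ 5 * ω (stepIndex h₀ S) ^ 2)
        (fun S hS => (tri.len_pos hh hS).le)
        (fun S hS => mul_nonneg (pow_nonneg (tri.len_pos hh hS).le _) (sq_nonneg _))
        (fun S _ => le_of_eq (by ring))
      rw [sum_len_generated ht hn hg] at h1
      have h2 : ∑ S ∈ 𝒯, d S = Cs * Real.exp Λ / 3 * ∑ S ∈ 𝒯, S.len ^ 3 * ω (stepIndex h₀ S) := by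
        rw [Finset.mul_sum]
        exact Finset.sum_congr rfl fun S _ => by rw [hd]; ring
      rw [h2, mul_pow]
      gcongr
    set E := Real.exp (Λ + Λ ^ 3 * Cs / 3) with hE
    have hsq : ‖e T.1‖ ^ 2 ≤ (E * (Cs * Real.exp Λ / 3)) ^ 2 * (P.tEnd * Q) := by
      calc ‖e T.1‖ ^ 2 ≤ (E * ∑ S ∈ 𝒯, d S) ^ 2 := by gcongr
        _ = E ^ 2 * (∑ S ∈ 𝒯, d S) ^ 2 := by ring
        _ ≤ E ^ 2 * ((Cs * Real.exp Λ / 3) ^ 2 * (P.tEnd * Q)) := by gcongr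
        _ = _ := by ring
    have hQ0 : 0 ≤ Q := Finset.sum_nonneg fun S hS =>
      mul_nonneg (pow_nonneg (tri.len_pos hh hS).le _) (sq_nonneg _)
    set w := ω (stepIndex h₀ T) with hw
    set M := (E * (Cs * Real.exp Λ / 3)) ^ 2 with hM
    have hM0 : 0 ≤ M := sq_nonneg _
    -- This scaling makes the constants depend on Λ = βL only, not on the final time.
    have hK6 : K ^ 6 * P.tEnd = Λ ^ 6 / P.tEnd ^ 5 := by rw [hK]; field_simp
    have hr2 : r ^ 2 ≤ Cs ^ 2 / 2 * (Real.exp Λ ^ 2 * w ^ 2 + Λ ^ 6 * M * (Q / P.tEnd ^ 5)) := by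
      calc r ^ 2 ≤ (Cs / 2 * (Real.exp Λ * w + K ^ 3 * ‖e T.1‖)) ^ 2 := by gcongr
        _ ≤ Cs ^ 2 / 2 * ((Real.exp Λ * w) ^ 2 + (K ^ 3 * ‖e T.1‖) ^ 2) := by
          nlinarith [mul_nonneg (sq_nonneg Cs) (sq_nonneg (Real.exp Λ * w - K ^ 3 * ‖e T.1‖))]
        _ = Cs ^ 2 / 2 * (Real.exp Λ ^ 2 * w ^ 2 + K ^ 6 * ‖e T.1‖ ^ 2) := by ring
        _ ≤ Cs ^ 2 / 2 * (Real.exp Λ ^ 2 * w ^ 2 + K ^ 6 * (M * (P.tEnd * Q))) := by gcongr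
        _ = Cs ^ 2 / 2 * (Real.exp Λ ^ 2 * w ^ 2 + (K ^ 6 * P.tEnd) * M * Q) := by ring
        _ = _ := by rw [hK6]; ring
    rw [hind]
    have hq0 : 0 ≤ Q / P.tEnd ^ 5 := by positivity
    calc 4 / 9 * T.len ^ 5 * r ^ 2
        ≤ 4 / 9 * T.len ^ 5 *
          (Cs ^ 2 / 2 * (Real.exp Λ ^ 2 * w ^ 2 + Λ ^ 6 * M * (Q / P.tEnd ^ 5))) := by gcongr
      _ ≤ 4 / 9 * T.len ^ 5 *
          (Cs ^ 2 / 2 * ((Real.exp Λ ^ 2 + Λ ^ 6 * M) * (w ^ 2 + Q / P.tEnd ^ 5))) := by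
        gcongr
        have : 0 ≤ Λ ^ 6 * M * w ^ 2 := by positivity
        have : 0 ≤ Real.exp Λ ^ 2 * (Q / P.tEnd ^ 5) := by positivity
        linarith
      _ = _ := by rw [upperConst]; ring
  · intro 𝒯 hg v hv
    have tri := tri0.generated hh hg
    set F : ℝ → ℝ := fun s => ‖U s - v s‖ ^ 2 +
      ‖restr W (P.toDualL (deriv (fun t => U t - v t) s))‖ ^ 2 with hF
    have key : ∀ T ∈ 𝒯, IntervalIntegrable F volume T.1 T.2 ∧
        lowerConst Λ * (T.len ^ 5 * ω (stepIndex h₀ T) ^ 2) ≤ ∫ s in T.1..T.2, F s := by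
      intro T hT
      obtain ⟨hi, hi1, hi2⟩ := tri.stepIndex_spec hh hT
      set i := stepIndex h₀ T with hidx
      have hlt := tri.lt hh hT
      have hsubI : Icc T.1 T.2 ⊆ Icc (h₀ * i) (h₀ * ((i : ℝ) + 1)) := Icc_subset_Icc hi1 hi2
      have hsub := hsubI.trans (hIcc i hi)
      have hsub' : Ioo T.1 T.2 ⊆ Ioo 0 P.tEnd :=
        (Ioo_subset_Ioo hi1 hi2).trans (hIoo i hi)
      obtain ⟨a₀, a₁, a₂, ha⟩ := hv.1.2 T hT
      have hvd : ∀ s ∈ Ioo T.1 T.2, HasDerivAt v (a₁ + (2 * s) • a₂) s := by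
        intro s hs
        refine (hasDerivAt_quadratic a₀ a₁ a₂ s).congr_of_eventuallyEq ?_
        filter_upwards [Icc_mem_nhds hs.1 hs.2] with r hr using ha r hr
      obtain ⟨i₁, j₁, e₁⟩ := xNorm_integrand (P := P) (W := W) (w := fun s => U s - v s)
        (w' := fun s => U' s - (a₁ + (2 * s) • a₂)) hlt.le
        ((hUc.mono hsub).sub (hv.1.1.mono hsub)) ((hUc'.mono hsub).sub (by fun_prop))
        fun s hs => (hUd s (hsub' hs)).sub (hvd s hs)
      refine ⟨i₁, ?_⟩
      -- On the step v' is affine, so already the time derivative part of the norm is bounded below.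
      have hlow := le_integral_odeRhs_sub_affine hK0 hB (hKh i) (norm_nonneg _)
        (hyc.mono (hIcc i hi)) (hyd i hi) hi1 hlt hi2 (le_refl (ω i))
        (restr W (P.toDualL a₁)) (restr W (P.toDualL ((2 : ℝ) • a₂)))
      have hcont : ContinuousOn (fun s => odeRhs B (q₀ i) (q₁ i) (q₂ i) s (y s) -
          (restr W (P.toDualL a₁) + s • restr W (P.toDualL ((2 : ℝ) • a₂)))) (Icc T.1 T.2) :=
        (continuousOn_odeRhs (hyc.mono hsub)).sub (by fun_prop)
      calc lowerConst Λ * (T.len ^ 5 * ω i ^ 2)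
          = (T.2 - T.1) ^ 5 * ω i ^ 2 * ((4 * Λ * Real.exp Λ + 3)⁻¹ ^ 5 *
              Real.exp (-Λ) ^ 2 / 24) := by rw [lowerConst]; simp only [TimeStep.len]; ring
        _ ≤ _ := hlow
        _ ≤ ∫ s in T.1..T.2, (‖U s - v s‖ ^ 2 +
              ‖restr W (P.toDualL (U' s - (a₁ + (2 * s) • a₂)))‖ ^ 2) := by
          refine intervalIntegral.integral_mono_on_of_le_Ioo hlt.le
            (ContinuousOn.intervalIntegrable (by rw [uIcc_of_le hlt.le]; exact hcont.norm.pow 2))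
            j₁ fun s hs => ?_
          rw [← hU'eq i hi s (hsubI ⟨hs.1.le, hs.2.le⟩)]
          have : restr W (P.toDualL (U' s)) - (restr W (P.toDualL a₁) +
              s • restr W (P.toDualL ((2 : ℝ) • a₂))) =
              restr W (P.toDualL (U' s - (a₁ + (2 * s) • a₂))) := by
            simp only [map_sub, map_add, map_smul]
            module
          rw [this]
          exact le_add_of_nonneg_left (sq_nonneg _)
        _ = ∫ s in T.1..T.2, F s := e₁.symm
    obtain ⟨-, hsum⟩ := integral_eq_sum_generated ht hn hg fun T hT => (key T hT).1
    rw [xNorm_sq]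
    change _ ≤ ∫ s in 0..P.tEnd, F s
    rw [hsum, Finset.mul_sum]
    exact Finset.sum_le_sum fun T hT => (key T hT).2

end AdaptiveRadau

end

/-! ### The approximation class and the convergence rate -/

noncomputable section

namespace AdaptiveRadau

theorem upperConst_nonneg (Λ Cs : ℝ) : 0 ≤ upperConst Λ Cs := by
  unfold upperConst; positivity

theorem lowerConst_pos {Λ : ℝ} (hΛ : 0 ≤ Λ) : 0 < lowerConst Λ := by
  unfold lowerConst; positivity

theorem card_uniform_le (t : ℝ) (n : ℕ) : (TimeMesh.uniform t n).card ≤ n := by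
  classical
  exact Finset.card_image_le.trans (Finset.card_range n).le

theorem len_uniform {t : ℝ} {n : ℕ} {T : TimeStep} (hT : T ∈ TimeMesh.uniform t n) :
    T.len = t / n := by
  classical
  obtain ⟨i, -, rfl⟩ := Finset.mem_image.1 hT
  simp only [TimeStep.len]
  ring

/-- Needed for the set behind `bestError` to be nonempty: the real infimum of the empty set is 0,
which would spoil lower bounds. -/
theorem admissible_uniform {Cg g₀ t : ℝ} (hCg : 1 ≤ Cg) (hg₀ : 0 < g₀) (hg₀' : g₀ ≤ 1) (ht : 0 < t)
    {n : ℕ} (hn : 1 ≤ n) :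
    TimeMesh.Admissible Cg g₀ (TimeMesh.uniform t n) (TimeMesh.uniform t n) := by
  have hn' : (0 : ℝ) < n := by exact_mod_cast hn
  refine ⟨.refl, fun T hT T' hT' => ?_⟩
  rw [len_uniform hT, len_uniform hT', div_self (by positivity)]
  refine one_le_mul_of_one_le_of_one_le hCg ?_
  rw [zpow_neg, ← inv_zpow, ← Int.natCast_natAbs, zpow_natCast]
  exact one_le_pow₀ ((one_le_inv₀ hg₀).2 hg₀')

/-- The refinement of a time step of the initial mesh satisfies a lower bound for the sum of the
fifth powers of the step sizes. -/
theorem pow_five_le_card_mul_sum {t : ℝ} (ht : 0 < t) {n : ℕ} (hn : 1 ≤ n) {𝒯 : TimeMesh}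
    (hg : TimeMesh.GeneratedFrom (TimeMesh.uniform t n) 𝒯) {i : ℕ} (hi : i < n) {ω : ℕ → ℝ}
    (hω : ∀ i, 0 ≤ ω i) :
    (t / n) ^ 5 * ω i ≤ (𝒯.card : ℝ) ^ 4 * ∑ T ∈ 𝒯, T.len ^ 5 * ω (stepIndex (t / n) T) := by
  classical
  have hn' : (0 : ℝ) < n := by exact_mod_cast hn
  set h := t / n with hh
  have hh0 : 0 < h := by positivity
  have tri := isTriadic_uniform ht hn
  have tri' := tri.generated hh0 hg
  have e : ∑ T ∈ 𝒯, (if stepIndex h T = i then T.len else 0) = h := by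
    rw [tri.sum_generated hh0 hg (F := fun T => if stepIndex h T = i then T.len else 0),
      sum_uniform ht hn, Finset.sum_eq_single_of_mem i (Finset.mem_range.2 hi)]
    · rw [if_pos (stepIndex_eq hh0 le_rfl (by dsimp only; nlinarith))]
      simp only [TimeStep.len]
      ring
    · intro j _ hj
      rw [stepIndex_eq (i := j) hh0 le_rfl (by dsimp only; nlinarith), if_neg hj]
    · intro 𝒮 h𝒮 T hT
      have tri𝒮 := tri.generated hh0 h𝒮
      have a : ∑ c ∈ T.children, (if stepIndex h c = i then c.len else 0) =
          ∑ c ∈ T.children, (if stepIndex h T = i then c.len else 0) :=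
        Finset.sum_congr rfl fun c hc => by rw [tri𝒮.stepIndex_child hh0 hT hc]
      rw [a, IsTriadic.sum_children (tri𝒮.len_pos hh0 hT)]
      split_ifs
      · simp only [TimeStep.len]; ring
      · simp
  -- The pieces of the i-th initial step have total length h, and the power mean inequality bounds
  -- h⁵ by the sum of their fifth powers times the fourth power of their number.
  have hp := pow_sum_le_card_mul_sum_pow (s := 𝒯)
    (f := fun T => if stepIndex h T = i then T.len else 0)
    (fun T hT => by have := tri'.len_pos hh0 hT; split_ifs <;> positivity) 4
  rw [e] at hp
  calc h ^ 5 * ω i ≤ (𝒯.card : ℝ) ^ 4 *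
        (∑ T ∈ 𝒯, (if stepIndex h T = i then T.len else 0) ^ (4 + 1)) * ω i :=
        mul_le_mul_of_nonneg_right hp (hω i)
    _ = (𝒯.card : ℝ) ^ 4 * ∑ T ∈ 𝒯, (if stepIndex h T = i then T.len else 0) ^ 5 * ω i := by
        rw [mul_assoc, Finset.sum_mul]
    _ ≤ _ := by
        refine mul_le_mul_of_nonneg_left (Finset.sum_le_sum fun T hT => ?_) (by positivity)
        have := tri'.len_pos hh0 hT
        split_ifs with hTi
        · rw [hTi]
        · have := hω (stepIndex h T)
          rw [zero_pow (by norm_num), zero_mul]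
          positivity

/-- Decay with rate `s` of a quantity that decays at most quadratically. -/
theorem le_mul_rpow_of_forall {c M s : ℝ} {n : ℕ}
    (h : ∀ N : ℕ, 1 ≤ N → c * ((N : ℝ) ^ s) ^ 2 ≤ M ^ 2 * (n + N : ℝ) ^ 4) {x : ℝ} (hx : 1 ≤ x) :
    c ≤ M ^ 2 * (n + 1 : ℝ) ^ 4 * (x ^ (-s)) ^ 2 * x ^ 4 := by
  have hx0 : 0 < x := by positivity
  have h1 := h 1 le_rfl
  rw [Nat.cast_one, Real.one_rpow, one_pow, mul_one] at h1
  rcases le_or_gt s 2 with hs2 | hs2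
  · refine h1.trans ?_
    -- For s ≤ 2 the case N = 1 suffices, since x^{-s}x² ≥ 1.
    rw [mul_assoc]
    refine le_mul_of_one_le_right (by positivity) ?_
    have : 1 ≤ x ^ (-s) * x ^ 2 := by
      rw [← Real.rpow_natCast x 2, ← Real.rpow_add hx0]
      exact Real.one_le_rpow hx (by push_cast; linarith)
    calc (1 : ℝ) ≤ (x ^ (-s) * x ^ 2) ^ 2 := one_le_pow₀ this
      _ = _ := by ring
  · suffices c ≤ 0 from this.trans (by positivity)
    by_contra! hc
    -- For s > 2 a positive c would bound N^{2s-4} for all N.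
    have key : ∀ N : ℕ, 1 ≤ N → (N : ℝ) ^ (2 * s - 4) ≤ M ^ 2 * (n + 1 : ℝ) ^ 4 / c := by
      intro N hN
      have hN' : (1 : ℝ) ≤ N := by exact_mod_cast hN
      have hN0 : (0 : ℝ) < N := by positivity
      have e : ((N : ℝ) ^ s) ^ 2 = (N : ℝ) ^ (2 * s - 4) * (N : ℝ) ^ 4 := by
        rw [← Real.rpow_natCast (N : ℝ) 4, ← Real.rpow_add hN0, ← Real.rpow_natCast _ 2,
          ← Real.rpow_mul hN0.le]
        congr 1
        push_cast
        ring
      have a := h N hN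
      rw [e] at a
      have b : (n + N : ℝ) ^ 4 ≤ (n + 1 : ℝ) ^ 4 * (N : ℝ) ^ 4 := by
        rw [← mul_pow]
        have : (0 : ℝ) ≤ n := by positivity
        gcongr
        nlinarith
      rw [le_div_iff₀ hc]
      refine le_of_mul_le_mul_right ?_ (show (0 : ℝ) < (N : ℝ) ^ 4 by positivity)
      calc (N : ℝ) ^ (2 * s - 4) * c * (N : ℝ) ^ 4 =
            c * ((N : ℝ) ^ (2 * s - 4) * (N : ℝ) ^ 4) := by ring
        _ ≤ M ^ 2 * (n + N : ℝ) ^ 4 := a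
        _ ≤ M ^ 2 * ((n + 1 : ℝ) ^ 4 * (N : ℝ) ^ 4) := by gcongr
        _ = _ := by ring
    have lim := (tendsto_rpow_atTop (show 0 < 2 * s - 4 by linarith)).comp
      (tendsto_natCast_atTop_atTop (R := ℝ))
    obtain ⟨N, hN, hN'⟩ := ((lim.eventually_gt_atTop (M ^ 2 * (n + 1 : ℝ) ^ 4 / c)).and
      (Filter.eventually_ge_atTop 1)).exists
    exact (key N hN').not_gt hN

variable {V H : Type*} [NormedAddCommGroup V] [InnerProductSpace ℝ V]
  [NormedAddCommGroup H] [InnerProductSpace ℝ H] {P : ParabolicProblem V H}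

theorem bestError_nonneg (W : Submodule ℝ V) (Cg g₀ : ℝ) (𝒯₀ : TimeMesh) (u : ℝ → V) (N : ℕ) :
    0 ≤ P.bestError W Cg g₀ 𝒯₀ u N := by
  refine Real.sInf_nonneg ?_
  rintro _ ⟨𝒯, -, -, v, -, rfl⟩
  exact Real.sqrt_nonneg _

theorem ParabolicProblem.ApproxClass.nonneg {W : Submodule ℝ V} {Cg g₀ : ℝ} {𝒯₀ : TimeMesh} {u : ℝ → V} {s M : ℝ}
    (h : P.ApproxClass W Cg g₀ 𝒯₀ u s M) : 0 ≤ M :=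
  (mul_nonneg (bestError_nonneg W Cg g₀ 𝒯₀ u 0) (by positivity)).trans (h 0)

/-- A lower bound for the approximation seminorm in terms of a lower bound of order four for the
squared error on all refinements of the initial mesh. -/
theorem ParabolicProblem.ApproxClass.mul_rpow_sq_le {W : Submodule ℝ V} {Cg g₀ : ℝ} {n : ℕ} {u : ℝ → V} {s M c : ℝ}
    (hCg : 1 ≤ Cg) (hg₀ : 0 < g₀) (hg₀' : g₀ ≤ 1) (hn : 1 ≤ n) (hc : 0 ≤ c)
    (hu : ∀ 𝒯, TimeMesh.GeneratedFrom (TimeMesh.uniform P.tEnd n) 𝒯 → ∀ v ∈ P.ansatz W 𝒯,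
      c ≤ (𝒯.card : ℝ) ^ 4 * P.xNorm W (fun t => u t - v t) ^ 2)
    (h : P.ApproxClass W Cg g₀ (TimeMesh.uniform P.tEnd n) u s M) (N : ℕ) :
    c * ((N : ℝ) ^ s) ^ 2 ≤ M ^ 2 * (n + N : ℝ) ^ 4 := by
  have hn' : (0 : ℝ) < n := by exact_mod_cast hn
  have hb : √c / (n + N : ℝ) ^ 2 ≤
      P.bestError W Cg g₀ (TimeMesh.uniform P.tEnd n) u N := by
    refine le_csInf ⟨_, TimeMesh.uniform P.tEnd n,
      admissible_uniform hCg hg₀ hg₀' P.tEnd_pos hn, Nat.le_add_right _ _, 0,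
      ⟨⟨continuousOn_const, fun T _ => ⟨0, 0, 0, fun r _ => by simp⟩⟩, fun t _ => W.zero_mem⟩,
      rfl⟩ ?_
    rintro _ ⟨𝒯, h𝒯, hcard, v, hv, rfl⟩
    have hcard' : (𝒯.card : ℝ) ≤ n + N := by
      exact_mod_cast hcard.trans (Nat.add_le_add_right (card_uniform_le _ _) _)
    have hx : 0 ≤ P.xNorm W (fun t => u t - v t) := Real.sqrt_nonneg _
    rw [div_le_iff₀ (by positivity)]
    refine Real.sqrt_le_iff.2 ⟨by positivity, (hu 𝒯 h𝒯.1 v hv).trans ?_⟩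
    calc (𝒯.card : ℝ) ^ 4 * P.xNorm W (fun t => u t - v t) ^ 2
        ≤ (n + N : ℝ) ^ 4 * P.xNorm W (fun t => u t - v t) ^ 2 := by gcongr
      _ = _ := by ring
  have hM := (mul_le_mul_of_nonneg_right hb (by positivity : (0 : ℝ) ≤ (N : ℝ) ^ s)).trans (h N)
  have h1 : √c * (N : ℝ) ^ s ≤ M * (n + N : ℝ) ^ 2 := by
    rw [div_mul_eq_mul_div, div_le_iff₀ (by positivity)] at hM
    exact hM
  calc c * ((N : ℝ) ^ s) ^ 2 = (√c * (N : ℝ) ^ s) ^ 2 := by rw [mul_pow, Real.sq_sqrt hc]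
    _ ≤ (M * (n + N : ℝ) ^ 2) ^ 2 := by gcongr
    _ = _ := by ring

/-- Removes the projection error from the reliability estimate when U is the projected solution
itself, so the estimator alone bounds the error. -/
theorem xNorm_sub_starProjection_of_mem {W : Submodule ℝ V} [W.HasOrthogonalProjection] {u : ℝ → V}
    (hu : ∀ t ∈ Icc 0 P.tEnd, u t ∈ W) :
    P.xNorm W (fun t => u t - W.starProjection (u t)) = 0 := by
  have e : ∀ t ∈ Icc 0 P.tEnd, u t - W.starProjection (u t) = 0 := fun t ht => by
    rw [Submodule.starProjection_eq_self_iff.2 (hu t ht), sub_self]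
  have : ∫ t in 0..P.tEnd, (‖u t - W.starProjection (u t)‖ ^ 2 + ParabolicProblem.dualNorm W
      (P.toDual (deriv (fun t => u t - W.starProjection (u t)) t)) ^ 2) =
      ∫ t in 0..P.tEnd, (0 : ℝ) := by
    rw [intervalIntegral.integral_of_le P.tEnd_pos.le, intervalIntegral.integral_of_le P.tEnd_pos.le,
      integral_Ioc_eq_integral_Ioo, integral_Ioc_eq_integral_Ioo]
    refine setIntegral_congr_fun measurableSet_Ioo fun t ht => ?_
    have hd : deriv (fun t => u t - W.starProjection (u t)) t = 0 := by
      rw [Filter.EventuallyEq.deriv_eq (f := fun _ => (0 : V)), deriv_const]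
      filter_upwards [Ioo_mem_nhds ht.1 ht.2] with r hr using e r (Ioo_subset_Icc_self hr)
    have h0 : P.toDual 0 = 0 := by ext v; simp [ParabolicProblem.toDual]
    have h1 : ParabolicProblem.dualNorm W 0 = 0 := by
      change ‖restr W 0‖ = 0
      rw [map_zero, norm_zero]
    simp only [e t (Ioo_subset_Icc_self ht), hd, h0, h1, norm_zero]
    norm_num
  rw [ParabolicProblem.xNorm, this]
  simp

theorem estimator_sq {W : Submodule ℝ V} {n : ℕ} (hn : 1 ≤ n) {𝒯 : TimeMesh}
    (hg : TimeMesh.GeneratedFrom (TimeMesh.uniform P.tEnd n) 𝒯) (u : ℝ → V) :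
    P.estimator W 𝒯 u ^ 2 = ∑ T ∈ 𝒯, P.indicatorSq W u T := by
  have hn' : (0 : ℝ) < n := by exact_mod_cast hn
  have hh : 0 < P.tEnd / n := div_pos P.tEnd_pos hn'
  have tri := (isTriadic_uniform P.tEnd_pos hn).generated hh hg
  exact Real.sq_sqrt (Finset.sum_nonneg fun T hT => indicatorSq_nonneg W u (tri.lt hh hT).le)

theorem sum_len_pow_five_le {t : ℝ} (ht : 0 < t) {n : ℕ} (hn : 1 ≤ n) {𝒯 : TimeMesh}
    (hg : TimeMesh.GeneratedFrom (TimeMesh.uniform t n) 𝒯) : ∑ T ∈ 𝒯, T.len ^ 5 ≤ t ^ 5 := by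
  have hn' : (0 : ℝ) < n := by exact_mod_cast hn
  have hh : 0 < t / n := by positivity
  have tri := (isTriadic_uniform ht hn).generated hh hg
  calc ∑ T ∈ 𝒯, T.len ^ 5 ≤ ∑ T ∈ 𝒯, t ^ 4 * T.len := by
        refine Finset.sum_le_sum fun T hT => ?_
        have h0 := tri.len_pos hh hT
        obtain ⟨h1, h2⟩ := tri.bounds hh hT
        rw [div_mul_cancel₀ _ hn'.ne'] at h2
        have h3 : T.len ≤ t := by simp only [TimeStep.len]; linarith
        rw [pow_succ]
        gcongr
    _ = t ^ 5 := by rw [← Finset.mul_sum, sum_len_generated ht hn hg]; ring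

variable [FiniteDimensional ℝ V]

theorem ParabolicProblem.IsAdaptiveRun.generated {W : Submodule ℝ V} {n : ℕ}
    {θ : ℝ} {G : ℕ} {𝒯 : ℕ → TimeMesh} {u : ℕ → ℝ → V} (hn : 1 ≤ n)
    (h : P.IsAdaptiveRun W (TimeMesh.uniform P.tEnd n) θ G 𝒯 u) (ℓ : ℕ) :
    TimeMesh.GeneratedFrom (TimeMesh.uniform P.tEnd n) (𝒯 ℓ) := by
  have hn' : (0 : ℝ) < n := by exact_mod_cast hn
  have hh : 0 < P.tEnd / n := div_pos P.tEnd_pos hn'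
  induction ℓ with
  | zero => rw [h.init]; exact .refl
  | succ ℓ ih =>
    obtain ⟨-, l, -, -, -, hl⟩ := h.refine ℓ
    exact ih.trans (TrisectList.generated hh hl ((isTriadic_uniform P.tEnd_pos hn).generated hh ih))

/-- The decay of the estimator in the adaptive algorithm, in terms of the approximation seminorm of
the solution. -/
theorem exists_estimator_le {α β Cg g₀ θ L : ℝ} (hα : 0 < α) (hβ : 0 < β) (hCg : 1 ≤ Cg)
    (hg₀ : 0 < g₀) (hg₀' : g₀ ≤ 1) (G : ℕ) (hθ : 0 < θ) (hθ' : θ ≤ 1 / 4) {n : ℕ} (hn : 1 ≤ n)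
    (hL : 0 ≤ L) (s : ℝ) :
    ∃ K > (0 : ℝ), ∀ (V : Type*) [NormedAddCommGroup V] [InnerProductSpace ℝ V]
      [FiniteDimensional ℝ V] (H : Type*) [NormedAddCommGroup H] [InnerProductSpace ℝ H]
      (P : ParabolicProblem V H), P.IsElliptic α β →
      IsSpline P.tEnd (TimeMesh.uniform P.tEnd n) P.f →
      ∀ W : Submodule ℝ V, (∀ v ∈ W, P.tEnd * ‖v‖ ^ 2 ≤ L * ‖P.ι v‖ ^ 2) →
      ∀ U : ℝ → V, P.IsSolution W U → ∀ M : ℝ,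
      P.ApproxClass W Cg g₀ (TimeMesh.uniform P.tEnd n) U s M →
      ∀ (𝒯 : ℕ → TimeMesh) (u : ℕ → ℝ → V),
      P.IsAdaptiveRun W (TimeMesh.uniform P.tEnd n) θ G 𝒯 u → ∀ ℓ : ℕ,
      P.estimator W (𝒯 ℓ) (u ℓ) ≤ K * M * ((𝒯 ℓ).card : ℝ) ^ (-s) := by
  have hn' : (0 : ℝ) < n := by exact_mod_cast hn
  set cu := upperConst (β * L) (β / α) with hcu
  set cl := lowerConst (β * L) with hcl
  have hcu0 : 0 ≤ cu := upperConst_nonneg _ _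
  have hcl0 : 0 < cl := lowerConst_pos (by positivity)
  set cr := 3 + 3 * (3 + (2 + 3 * β ^ 2) / α ^ 2) * (1 + β ^ 2) with hcr
  have hcr0 : 0 < cr := by positivity
  -- cl N ≤ ‖U - u‖² ≤ cr η² explains c. The added 1 keeps C positive.
  obtain ⟨K₀, hK₀, key⟩ := exists_card_pow_mul_le hn G (c := cl / cr) (C := cu + 1) (by positivity)
    (by positivity) hθ hθ'
  set K₁ := 2 * (cu + 1) * K₀ * (n ^ 5 * (n + 1 : ℝ) ^ 4) / cl with hK₁
  have hK₁0 : 0 < K₁ := by positivity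
  refine ⟨√K₁, Real.sqrt_pos.2 hK₁0, ?_⟩
  intro V _ _ _ H _ _ P hP hf W hW U hU M hM 𝒯 u hrun ℓ
  have ht := P.tEnd_pos
  set t := P.tEnd with htdef
  have hh : 0 < t / n := by positivity
  have tri0 := isTriadic_uniform ht hn
  obtain ⟨ω, hω, hup, hlow⟩ := exists_weight hα hβ hP hL hn hf hW hU
  rw [← htdef, ← hcu] at hup
  rw [← htdef, ← hcl] at hlow
  obtain ⟨i₀, hi₀, hmax⟩ := Finset.exists_max_image (Finset.range n) (fun i => ω i ^ 2)
    ⟨0, Finset.mem_range.2 hn⟩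
  set m := ω i₀ ^ 2 with hm
  have hm0 : 0 ≤ m := sq_nonneg _
  have hmax' : ∀ i < n, ω i ^ 2 ≤ m := fun i hi => hmax i (Finset.mem_range.2 hi)
  rw [Finset.mem_range] at hi₀
  have hlist : ∀ ℓ, TimeMesh.GeneratedFrom (TimeMesh.uniform t n) (𝒯 ℓ) := hrun.generated hn
  have tri : ∀ ℓ, IsTriadic (t / n) n (𝒯 ℓ) := fun ℓ => tri0.generated hh (hlist ℓ)
  have hind : ∀ ℓ, ∀ T ∈ 𝒯 ℓ, 0 ≤ P.indicatorSq W (u ℓ) T := fun ℓ T hT =>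
    indicatorSq_nonneg W (u ℓ) ((tri ℓ).lt hh hT).le
  set N : ℕ → ℝ := fun ℓ => ∑ S ∈ 𝒯 ℓ, S.len ^ 5 * ω (stepIndex (t / n) S) ^ 2 with hN
  have hN0 : ∀ ℓ, 0 ≤ N ℓ := fun ℓ => Finset.sum_nonneg fun S hS => by
    have := (tri ℓ).len_pos hh hS; positivity
  have hest : P.estimator W (𝒯 ℓ) (u ℓ) ^ 2 ≤ 2 * cu * N ℓ := by
    rw [estimator_sq hn (hlist ℓ)]
    calc ∑ T ∈ 𝒯 ℓ, P.indicatorSq W (u ℓ) T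
        ≤ ∑ T ∈ 𝒯 ℓ, cu * T.len ^ 5 * (ω (stepIndex (t / n) T) ^ 2 + N ℓ / t ^ 5) :=
          Finset.sum_le_sum fun T hT => hup _ (hlist ℓ) _ (hrun.solve ℓ) T hT
      _ = cu * N ℓ + cu * (N ℓ / t ^ 5) * ∑ T ∈ 𝒯 ℓ, T.len ^ 5 := by
          rw [hN, Finset.mul_sum, Finset.mul_sum, ← Finset.sum_add_distrib]
          exact Finset.sum_congr rfl fun T _ => by ring
      _ ≤ cu * N ℓ + cu * (N ℓ / t ^ 5) * t ^ 5 := by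
          have := hN0 ℓ
          gcongr
          exact sum_len_pow_five_le ht hn (hlist ℓ)
      _ = _ := by field_simp; ring
  have hcard : N ℓ * ((𝒯 ℓ).card : ℝ) ^ 4 ≤ K₀ * (t ^ 5 * m) := by
    rcases hm0.eq_or_lt with hm0 | hm0
    · have : N ℓ = 0 := Finset.sum_eq_zero fun S hS => by
        have := hmax' _ ((tri ℓ).stepIndex_spec hh hS).1
        rw [le_antisymm (this.trans hm0.ge) (sq_nonneg _), mul_zero]
      rw [this, ← hm0]
      simp
    have hE : 0 < t ^ 5 * m := by positivity
    -- Weights normalized by their maximum m. The default 0 applies to pairs outside the mesh, where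
    -- ω is not bounded by m.
    set w : TimeStep → ℝ := fun T =>
      if stepIndex (t / n) T < n then ω (stepIndex (t / n) T) ^ 2 / m else 0 with hw
    have hwT : ∀ ℓ, ∀ T ∈ 𝒯 ℓ, w T = ω (stepIndex (t / n) T) ^ 2 / m := fun ℓ T hT =>
      if_pos ((tri ℓ).stepIndex_spec hh hT).1
    have hν : ∀ ℓ, N ℓ / (t ^ 5 * m) = ∑ T ∈ 𝒯 ℓ, (T.len / t) ^ 5 * w T := by
      intro ℓ
      rw [hN, Finset.sum_div]
      refine Finset.sum_congr rfl fun T hT => ?_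
      rw [hwT ℓ T hT]
      field_simp
    have := key t ht w (fun T => by simp only [hw]; split_ifs <;> positivity)
      (fun T => by
        simp only [hw]
        split_ifs with h
        · exact div_le_one_of_le₀ (hmax' _ h) hm0.le
        · exact zero_le_one)
      (fun 𝒮 h𝒮 T hT S hS => by
        simp only [hw, (tri0.generated hh h𝒮).stepIndex_child hh hT hS])
      𝒯 hrun.init (fun ℓ T => P.indicatorSq W (u ℓ) T / (t ^ 5 * m))
      (fun ℓ T hT => div_nonneg (hind ℓ T hT) hE.le) (fun ℓ => N ℓ / (t ^ 5 * m)) hν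
      (fun ℓ T hT => by
        have h1 := (tri ℓ).len_pos hh hT
        have h2 := hN0 ℓ
        rw [div_le_iff₀ hE, hwT ℓ T hT]
        calc P.indicatorSq W (u ℓ) T
            ≤ cu * T.len ^ 5 * (ω (stepIndex (t / n) T) ^ 2 + N ℓ / t ^ 5) :=
              hup _ (hlist ℓ) _ (hrun.solve ℓ) T hT
          _ ≤ (cu + 1) * T.len ^ 5 * (ω (stepIndex (t / n) T) ^ 2 + N ℓ / t ^ 5) := by
              gcongr; linarith
          _ = _ := by field_simp)
      (fun ℓ => by
        rw [← Finset.sum_div, ← mul_div_assoc]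
        refine div_le_div_of_nonneg_right ?_ hE.le
        have h1 := xNorm_sq_le hα hβ.le hP hn hf le_rfl hU (hlist ℓ) (hrun.solve ℓ)
        rw [xNorm_sub_starProjection_of_mem hU.mem, zero_pow two_ne_zero, zero_add, ← hcr] at h1
        have h2 := (hlow _ (hlist ℓ) _ (hrun.solve ℓ).mem).trans h1
        rw [div_mul_eq_mul_div, div_le_iff₀ hcr0, mul_comm _ cr]
        exact h2)
      ⟨fun ℓ => by
        obtain ⟨M', l, ⟨hsub, hM1, hM2⟩, -, hl, htl⟩ := hrun.refine ℓ
        rw [estimator_sq hn (hlist ℓ)] at hM1 hM2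
        refine ⟨M', l, hsub, ?_, fun M'' h'' h => hM2 M'' h'' ?_, hl, htl⟩
        · rw [← Finset.sum_div, ← Finset.sum_div, ← mul_div_assoc]
          exact div_le_div_of_nonneg_right hM1 hE.le
        · rw [← Finset.sum_div, ← Finset.sum_div, ← mul_div_assoc] at h
          exact (div_le_div_iff_of_pos_right hE).1 h⟩ ℓ
    rwa [div_mul_eq_mul_div, div_le_iff₀ hE] at this
  have hcard1 : 1 ≤ (𝒯 ℓ).card := by
    refine Finset.card_pos.2 (Finset.nonempty_iff_ne_empty.2 fun h => ?_)
    have := sum_len_generated ht hn (hlist ℓ)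
    rw [h, Finset.sum_empty] at this
    exact ht.ne this
  have hcard1' : (1 : ℝ) ≤ (𝒯 ℓ).card := by exact_mod_cast hcard1
  have hM0 := hM.nonneg
  -- Approximability bounds the largest weight. This is where the two cases s ≤ 2 and s > 2 meet in
  -- a single inequality.
  have hc : cl * ((t / n) ^ 5 * m) ≤ M ^ 2 * (n + 1 : ℝ) ^ 4 *
      (((𝒯 ℓ).card : ℝ) ^ (-s)) ^ 2 * ((𝒯 ℓ).card : ℝ) ^ 4 := by
    refine le_mul_rpow_of_forall (fun N _ => hM.mul_rpow_sq_le hCg hg₀ hg₀' hn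
      (by positivity) (fun 𝒮 h𝒮 v hv => ?_) N) hcard1'
    have h1 := pow_five_le_card_mul_sum ht hn h𝒮 hi₀ (ω := fun i => ω i ^ 2) fun i => sq_nonneg _
    calc cl * ((t / n) ^ 5 * m) ≤ cl * ((𝒮.card : ℝ) ^ 4 *
          ∑ T ∈ 𝒮, T.len ^ 5 * ω (stepIndex (t / n) T) ^ 2) := by gcongr
      _ = (𝒮.card : ℝ) ^ 4 * (cl * ∑ T ∈ 𝒮, T.len ^ 5 * ω (stepIndex (t / n) T) ^ 2) := by ring
      _ ≤ _ := by
          gcongr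
          exact hlow 𝒮 h𝒮 v hv
  refine le_of_sq_le_sq ?_ (by positivity)
  refine le_of_mul_le_mul_right ?_ (show (0 : ℝ) < ((𝒯 ℓ).card : ℝ) ^ 4 by positivity)
  calc P.estimator W (𝒯 ℓ) (u ℓ) ^ 2 * ((𝒯 ℓ).card : ℝ) ^ 4
      ≤ 2 * cu * N ℓ * ((𝒯 ℓ).card : ℝ) ^ 4 := by gcongr
    _ = 2 * cu * (N ℓ * ((𝒯 ℓ).card : ℝ) ^ 4) := by ring
    _ ≤ 2 * (cu + 1) * (K₀ * (t ^ 5 * m)) :=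
        mul_le_mul (by linarith) hcard (mul_nonneg (hN0 ℓ) (by positivity)) (by positivity)
    _ = 2 * (cu + 1) * K₀ * n ^ 5 / cl * (cl * ((t / n) ^ 5 * m)) := by field_simp
    _ ≤ 2 * (cu + 1) * K₀ * n ^ 5 / cl * (M ^ 2 * (n + 1 : ℝ) ^ 4 *
        (((𝒯 ℓ).card : ℝ) ^ (-s)) ^ 2 * ((𝒯 ℓ).card : ℝ) ^ 4) := by gcongr
    _ = K₁ * M ^ 2 * (((𝒯 ℓ).card : ℝ) ^ (-s)) ^ 2 * ((𝒯 ℓ).card : ℝ) ^ 4 := by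
        rw [hK₁]; ring
    _ = _ := by rw [mul_pow, mul_pow, Real.sq_sqrt hK₁0.le]

/-- Reliability of the estimator, up to the error of the projection onto the subspace. -/
theorem xNorm_le {α β : ℝ} (hα : 0 < α) (hβ : 0 ≤ β) (hP : P.IsElliptic α β) {n : ℕ} (hn : 1 ≤ n)
    (hf : IsSpline P.tEnd (TimeMesh.uniform P.tEnd n) P.f) {W W' : Submodule ℝ V} (hWW : W ≤ W')
    {U : ℝ → V} (hU : P.IsSolution W' U) {𝒯 : TimeMesh}
    (hg : TimeMesh.GeneratedFrom (TimeMesh.uniform P.tEnd n) 𝒯) {u : ℝ → V}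
    (hu : P.IsDiscreteSolution W 𝒯 u) :
    P.xNorm W (fun t => U t - u t) ≤
      √(3 + 3 * (3 + (2 + 3 * β ^ 2) / α ^ 2) * (1 + β ^ 2)) *
        (P.estimator W 𝒯 u + P.xNorm W (fun t => U t - W.starProjection (U t))) := by
  have h := xNorm_sq_le hα hβ hP hn hf hWW hU hg hu
  rw [← estimator_sq hn hg] at h
  have h1 : 0 ≤ P.estimator W 𝒯 u := Real.sqrt_nonneg _
  have h2 : 0 ≤ P.xNorm W (fun t => U t - W.starProjection (U t)) := Real.sqrt_nonneg _
  refine le_of_sq_le_sq (h.trans ?_) (by positivity)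
  rw [mul_pow, Real.sq_sqrt (by positivity)]
  gcongr
  nlinarith

end AdaptiveRadau

end

theorem theorem4p1 (α β Cg : ℝ) (hα : 0 < α) (hαβ : α ≤ β) (hCg : 1 ≤ Cg) :
    -- the thresholds for "close to one", "sufficiently large", "sufficiently small"
    ∃ γ ∈ Set.Ioo (0 : ℝ) 1, ∃ G₀ : ℕ, ∃ θ₀ ∈ Set.Ioc (0 : ℝ) 1, ∃ C > (0 : ℝ),
    ∀ g₀ ∈ Set.Ico γ 1, ∀ G : ℕ, G₀ ≤ G → ∀ θ ∈ Set.Ioc 0 θ₀,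
    ∀ s : ℝ, 0 < s → ∀ n₀ : ℕ, 1 ≤ n₀ → ∀ L : ℝ, ∃ K > (0 : ℝ),
    ∀ (V : Type*) [NormedAddCommGroup V] [InnerProductSpace ℝ V] [FiniteDimensional ℝ V]
      (H : Type*) [NormedAddCommGroup H] [InnerProductSpace ℝ H]
      (P : AdaptiveRadau.ParabolicProblem V H),
      P.IsElliptic α β →
      AdaptiveRadau.IsSpline P.tEnd (AdaptiveRadau.TimeMesh.uniform P.tEnd n₀) P.f →
    ∀ uh : ℝ → V, P.IsSolution ⊤ uh →
    ∀ VR : Submodule ℝ V, (∀ v ∈ VR, P.tEnd * ‖v‖ ^ 2 ≤ L * ‖P.ι v‖ ^ 2) →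
    ∀ uR : ℝ → V, P.IsSolution VR uR →
    ∀ M : ℝ,
      P.ApproxClass VR Cg g₀ (AdaptiveRadau.TimeMesh.uniform P.tEnd n₀) uR s M →
    ∀ (𝒯 : ℕ → AdaptiveRadau.TimeMesh) (u : ℕ → ℝ → V),
      P.IsAdaptiveRun VR (AdaptiveRadau.TimeMesh.uniform P.tEnd n₀) θ G 𝒯 u →
    ∀ ℓ : ℕ,
      P.xNorm VR (fun t => uh t - u ℓ t) ≤
        C * (min (P.estimator VR (𝒯 ℓ) (u ℓ)) (K * M * ((𝒯 ℓ).card : ℝ) ^ (-s)) +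
          P.xNorm VR (fun t => uh t - VR.starProjection (uh t))) := by
  have hβ : 0 < β := hα.trans_le hαβ
  -- γ = 1/2 keeps g₀ positive, 1/4 is the marking threshold of `marked_small_unique`, and C is the
  -- reliability constant.
  refine ⟨1 / 2, by norm_num, 0, 1 / 4, by norm_num,
    √(3 + 3 * (3 + (2 + 3 * β ^ 2) / α ^ 2) * (1 + β ^ 2)), by positivity, ?_⟩
  intro g₀ hg₀ G _ θ hθ s _ n₀ hn₀ L
  -- L may be negative; the estimates are run with `max L 0`.
  obtain ⟨K, hK, key⟩ := AdaptiveRadau.exists_estimator_le hα hβ hCg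
    (lt_of_lt_of_le (by norm_num) hg₀.1) hg₀.2.le G hθ.1 hθ.2 hn₀ (le_max_right L 0) s
  refine ⟨K, hK, ?_⟩
  intro V _ _ _ H _ _ P hP hf uh hh VR hVR uR hR M hM 𝒯 u hrun ℓ
  -- The estimator obeys the rate bound itself, so the minimum equals the estimator and reliability
  -- finishes the proof.
  rw [min_eq_left (key V H P hP hf VR (fun v hv => (hVR v hv).trans (by gcongr; exact le_max_left _ _))
    uR hR M hM 𝒯 u hrun ℓ)]
  exact AdaptiveRadau.xNorm_le hα hβ.le hP hn₀ hf le_top hh (hrun.generated hn₀ ℓ) (hrun.solve ℓ)
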